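/- Let $V$ be a finite-dimensional real vector space and $\Delta$ a (not necessarily rational) fan of strictly convex polyhedral cones in $V$, regarded as a finite topological space whose open sets are the subfans. For $\sigma\in\Delta$ let $V_\sigma$ be the linear span of $\sigma$, $A_\sigma=S(V_\sigma^*)$ with linear forms in degree $2$, and $\det V_\sigma^*=\bigwedge^{\dim\sigma}V_\sigma^*$, placed in degree $2\dim\sigma$; let $\mathcal A$ be the sheaf of conewise polynomial functions, with $\mathcal A(\langle\sigma\rangle)=A_\sigma$, where $\langle\sigma\rangle$ is the fan of faces of $\sigma$. For a sheaf $\mathcal F$ of graded $\mathcal A$-modules write $F_\Lambda=\mathcal F(\Lambda)$ for a subfan $\Lambda$, $F_\sigma=\mathcal F(\langle\sigma\rangle)$, and $F_{(\sigma,\partial\sigma)}$ for the sections in $F_\sigma$ that vanish on all proper faces of $\sigma$. The sheaf $\mathcal F$ is pure if it is flabby and every $F_\sigma$ is a finitely generated free $A_\sigma$-module. The fan $\Delta$ is oriented if an orientation of each $V_\sigma$ is fixed so that the orientations of all full-dimensional cones coincide. On an oriented fan, the dual $\mathcal D\mathcal F$ of a flabby sheaf $\mathcal F$ of graded $\mathcal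 A$-modules with finitely generated $F_\sigma$ is the sheaf with $$(\mathcal D\mathcal F)_\sigma=\operatorname{Hom}_{A_\sigma}(F_{(\sigma,\partial\sigma)},A_\sigma)\otimes_{\mathbb R}\det V_\sigma^*$$ whose restriction to a facet $\tau$ of $\sigma$ is $\varepsilon\cdot\varphi_h\otimes\psi_h$. Here $h\in V_\sigma^*$ is a linear form with $\ker h=V_\tau$ and $h|_\sigma\ge 0$; $\varphi_h(f)(s)=f(h\check s)|_{V_\tau}$ for any $\check s\in F_\sigma$ that restricts to $s$ on $\tau$ and to $0$ on all proper faces of $\sigma$ other than $\tau$; $\psi_h(h\wedge\eta)=\eta|_{V_\tau}$; and $\varepsilon=\pm1$ is chosen such that $\varepsilon\psi_h$ carries positive volume forms on $V_\sigma$ to positive volume forms on $V_\tau$. Restrictions to faces of higher codimension are compositions along flags of facets. Let $\hat\Delta$ be an oriented refinement of the oriented fan $\Delta$: each cone of $\hat\Delta$ lies in a cone of $\Delta$, both fans have the same support, and whenever a cone of $\hat\Delta$ is contained in a cone of $\Delta$ of the same dimension, their orientations coincide. Let $\pi=\mathrm{id}_V:(V,\hat\Delta)\to(V,\Delta)$,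 and for $\sigma\in\Delta$ let $\hat\sigma=\{\tau\in\hat\Delta:\tau\subset\sigma\}$; the direct image is given by $(\pi_*\mathcal F)_\sigma=F_{\hat\sigma}$. **Proposition.** For every pure sheaf $\mathcal F$ on $\hat\Delta$, the dual sheaves $\mathcal D\mathcal F$ and $\mathcal D(\pi_*\mathcal F)$ are well defined, and there is a canonical isomorphism, of degree zero, of sheaves of graded $\mathcal A$-modules on $\Delta$ $$\Phi_{\mathcal F}:\ \mathcal D(\pi_*\mathcal F)\ \xrightarrow{\ \cong\ }\ \pi_*(\mathcal D\mathcal F).$$ It is the unique one such that, for all $\sigma\in\Delta$ and all $\tau\in\hat\sigma$ with $\dim\tau=\dim\sigma$ (so that $V_\tau=V_\sigma$), and all $c\in\mathcal D(\pi_*\mathcal F)_\sigma$, the sections $c$ and $\Phi_{\mathcal F}(c)|_\tau\in(\mathcal D\mathcal F)_\tau$ take the same value in $A_\sigma\otimes\det V_\sigma^*=A_\tau\otimes\det V_\tau^*$ on each $x\in F_{(\tau,\partial\tau)}$, where $x$ is regarded, by extension by zero, as an element of $(\pi_*\mathcal F)_{(\sigma,\partial\sigma)}$. Moreover $\Phi_{\mathcal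 F}$ is natural in $\mathcal F$: for every homomorphism $f:\mathcal F\to\mathcal G$ of $\mathcal A$-modules between pure sheaves on $\hat\Delta$ one has $\Phi_{\mathcal F}\circ\mathcal D(\pi_*f)=\pi_*(\mathcal Df)\circ\Phi_{\mathcal G}$. -/

import Mathlib

open scoped TensorProduct

universe u w w'

noncomputable section

namespace FanDuality

variable {V : Type u} [AddCommGroup V] [Module ℝ V]

/-! ## Polynomial functions and volume forms on a subspace -/

/-- The algebra `S(W^*)` of polynomial functions on a subspace `W` of `V`. -/
def Poly (W : Submodule ℝ V) : Type u := SymmetricAlgebra ℝ (Module.Dual ℝ W)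

instance Poly.commRing (W : Submodule ℝ V) : CommRing (Poly W) :=
  inferInstanceAs (CommRing (SymmetricAlgebra ℝ (Module.Dual ℝ W)))

instance Poly.algebra (W : Submodule ℝ V) : Algebra ℝ (Poly W) :=
  inferInstanceAs (Algebra ℝ (SymmetricAlgebra ℝ (Module.Dual ℝ W)))

/-- Linear forms on `W`, regarded as elements of `S(W^*)`. -/
def Poly.ofForm {W : Submodule ℝ V} : Module.Dual ℝ W →ₗ[ℝ] Poly W :=
  SymmetricAlgebra.ι ℝ (Module.Dual ℝ W)

/-- Restriction of polynomial functions to a smaller subspace. -/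
def Poly.restrict {W₁ W₂ : Submodule ℝ V} (h : W₁ ≤ W₂) : Poly W₂ →ₐ[ℝ] Poly W₁ :=
  SymmetricAlgebra.lift (Poly.ofForm.comp (Submodule.inclusion h).dualMap)

/-- The homogeneous part of degree `q` for the even grading in which linear forms have degree
`2`: it is `S^k(W^*)` if `q = 2k` with `k ≥ 0`, and zero otherwise. -/
def Poly.grade (W : Submodule ℝ V) (q : ℤ) : Submodule ℝ (Poly W) :=
  ⨆ k : {k : ℕ // 2 * (k : ℤ) = q}, (LinearMap.range (Poly.ofForm (W := W))) ^ (k : ℕ)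

theorem Poly.restrict_ofForm {W₁ W₂ : Submodule ℝ V} (h : W₁ ≤ W₂) (f : Module.Dual ℝ W₂) :
    Poly.restrict h (Poly.ofForm f) = Poly.ofForm (f ∘ₗ Submodule.inclusion h) :=
  SymmetricAlgebra.lift_ι_apply (Poly.ofForm.comp (Submodule.inclusion h).dualMap) f

theorem Poly.algHom_ext {W : Submodule ℝ V} {B : Type*} [CommRing B] [Algebra ℝ B]
    {f g : Poly W →ₐ[ℝ] B} (h : ∀ l : Module.Dual ℝ W, f (Poly.ofForm l) = g (Poly.ofForm l)) :
    f = g :=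
  SymmetricAlgebra.algHom_ext (LinearMap.ext h)

theorem Poly.restrict_refl {W : Submodule ℝ V} (h : W ≤ W) (a : Poly W) :
    Poly.restrict h a = a := by
  have : Poly.restrict h = AlgHom.id ℝ (Poly W) :=
    Poly.algHom_ext fun f => Poly.restrict_ofForm h f
  rw [this]; rfl

theorem Poly.restrict_trans {W₁ W₂ W₃ : Submodule ℝ V} (h₁₂ : W₁ ≤ W₂) (h₂₃ : W₂ ≤ W₃)
    (a : Poly W₃) :
    Poly.restrict h₁₂ (Poly.restrict h₂₃ a) = Poly.restrict (h₁₂.trans h₂₃) a := by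
  have : (Poly.restrict h₁₂).comp (Poly.restrict h₂₃) = Poly.restrict (h₁₂.trans h₂₃) :=
    Poly.algHom_ext fun f => by
      rw [AlgHom.comp_apply, Poly.restrict_ofForm, Poly.restrict_ofForm, Poly.restrict_ofForm]
      rfl
  exact DFunLike.congr_fun this a

theorem Poly.mul_mem_grade {W : Submodule ℝ V} {i j : ℤ} {a b : Poly W}
    (ha : a ∈ Poly.grade W i) (hb : b ∈ Poly.grade W j) : a * b ∈ Poly.grade W (i + j) := by
  have key : Poly.grade W i * Poly.grade W j ≤ Poly.grade W (i + j) := by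
    unfold Poly.grade
    rw [Submodule.iSup_mul]
    refine iSup_le fun k => ?_
    rw [Submodule.mul_iSup]
    refine iSup_le fun l => ?_
    rw [← pow_add]
    exact le_iSup (fun m : {m : ℕ // 2 * (m : ℤ) = i + j} =>
      (LinearMap.range (Poly.ofForm (W := W))) ^ (m : ℕ))
      ⟨k.1 + l.1, by have := k.2; have := l.2; push_cast; linarith⟩
  exact key (Submodule.mul_mem_mul ha hb)

theorem Poly.restrict_mem_grade {W₁ W₂ : Submodule ℝ V} (h : W₁ ≤ W₂) {q : ℤ} {a : Poly W₂}
    (ha : a ∈ Poly.grade W₂ q) : Poly.restrict h a ∈ Poly.grade W₁ q := by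
  have key : Poly.grade W₂ q ≤ (Poly.grade W₁ q).comap (Poly.restrict h).toLinearMap := by
    unfold Poly.grade
    refine iSup_le fun k => ?_
    rw [← Submodule.map_le_iff_le_comap, Submodule.map_pow]
    refine le_trans (pow_le_pow_left' ?_ _) (le_iSup (fun m : {m : ℕ // 2 * (m : ℤ) = q} =>
      (LinearMap.range (Poly.ofForm (W := W₁))) ^ (m : ℕ)) k)
    rintro _ ⟨_, ⟨f, rfl⟩, rfl⟩
    exact ⟨_, (Poly.restrict_ofForm h f).symm⟩
  exact key ha

/-- `det W^*`, the top exterior power of `W^*`, as the space of alternating forms of top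
degree on `W`. -/
abbrev Det (W : Submodule ℝ V) : Type u := W [⋀^Fin (Module.finrank ℝ W)]→ₗ[ℝ] ℝ

/-- Restriction of volume forms to a subspace of the same dimension. -/
def Det.restrict {W₁ W₂ : Submodule ℝ V} (h : W₁ ≤ W₂)
    (hd : Module.finrank ℝ W₁ = Module.finrank ℝ W₂) : Det W₂ →ₗ[ℝ] Det W₁ where
  toFun ω := (ω.compLinearMap (Submodule.inclusion h)).domDomCongr (finCongr hd.symm)
  map_add' _ _ := rfl
  map_smul' _ _ := rfl

/-- Contraction with a vector `n`, followed by restriction to a subspace of codimension one.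
If `h` is a linear form on `W₂` with kernel `W₁` and `h n = 1`, this is the map
`h ∧ η ↦ η|_{W₁}`, because `(h ∧ η)(n, v₂, …, v_d) = η(v₂, …, v_d)` for `v₂, …, v_d ∈ W₁`. -/
def Det.contract {W₁ W₂ : Submodule ℝ V} (h : W₁ ≤ W₂)
    (hd : Module.finrank ℝ W₁ + 1 = Module.finrank ℝ W₂) (n : W₂) : Det W₂ →ₗ[ℝ] Det W₁ where
  toFun ω := ((ω.domDomCongr (finCongr hd.symm)).curryLeft n).compLinearMap
    (Submodule.inclusion h)
  map_add' _ _ := rfl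
  map_smul' _ _ := rfl

/-- The volume form `ω` defines the orientation `o`. -/
def IsPositive {W : Submodule ℝ V} (o : Orientation ℝ W (Fin (Module.finrank ℝ W)))
    (ω : Det W) : Prop :=
  ∃ h : ω ≠ 0, rayOfNeZero ℝ ω h = o

/-- Two orientations of one and the same subspace coincide (the subspace is given twice, by two
names `W₁ = W₂`). -/
def SameOrientation {W₁ W₂ : Submodule ℝ V} (h : W₁ = W₂)
    (o₁ : Orientation ℝ W₁ (Fin (Module.finrank ℝ W₁)))
    (o₂ : Orientation ℝ W₂ (Fin (Module.finrank ℝ W₂))) : Prop :=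
  ∀ ω : Det W₂, IsPositive o₂ ω → IsPositive o₁ (Det.restrict h.le (by rw [h]) ω)

/-! ## Fans -/

variable (V) in
/-- A fan in `V`: a finite non-empty set of strictly convex polyhedral cones, closed under
taking faces, in which any two cones meet in a common face. -/
structure Fan where
  cones : Set (PointedCone ℝ V)
  finite : cones.Finite
  nonempty : cones.Nonempty
  polyhedral : ∀ σ ∈ cones, σ.FG
  salient : ∀ σ ∈ cones, (σ : ConvexCone ℝ V).Salient
  face_mem : ∀ σ ∈ cones, ∀ τ : PointedCone ℝ V, τ.IsFaceOf σ → τ ∈ cones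
  inter_face : ∀ σ ∈ cones, ∀ τ ∈ cones, (σ ⊓ τ).IsFaceOf σ

namespace Fan

/-- The cones of a fan, ordered by inclusion. For two cones of a fan, `τ ≤ σ` holds if and only
if `τ` is a face of `σ`. The open sets of the fan space are the subfans, that is, the subsets
that are closed under passage to faces (`LowerSet Δ.Cone`). -/
abbrev Cone (Δ : Fan V) : Type u := {σ : PointedCone ℝ V // σ ∈ Δ.cones}

theorem Cone.le_iff_isFaceOf {Δ : Fan V} {τ σ : Δ.Cone} : τ ≤ σ ↔ τ.1.IsFaceOf σ.1 := by
  constructor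
  · intro h
    have := Δ.inter_face σ.1 σ.2 τ.1 τ.2
    rwa [inf_eq_right.mpr (show τ.1 ≤ σ.1 from h)] at this
  · intro h
    exact h.le

/-- The linear span `V_σ` of a cone. -/
def Cone.lin {Δ : Fan V} (σ : Δ.Cone) : Submodule ℝ V := Submodule.span ℝ (σ.1 : Set V)

/-- The dimension of a cone. -/
def Cone.dim {Δ : Fan V} (σ : Δ.Cone) : ℕ := Module.finrank ℝ σ.lin

theorem Cone.lin_mono {Δ Δ' : Fan V} {τ : Δ.Cone} {σ : Δ'.Cone} (h : τ.1 ≤ σ.1) :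
    τ.lin ≤ σ.lin :=
  Submodule.span_mono h

/-- `τ` is a facet of `σ`. -/
structure Cone.IsFacet {Δ : Fan V} (τ σ : Δ.Cone) : Prop where
  le : τ ≤ σ
  dim_eq : τ.dim + 1 = σ.dim

/-- The linear form `h` on `V_σ` has kernel `V_τ` and is non-negative on `σ`. -/
structure Cone.IsFacetForm {Δ : Fan V} (τ σ : Δ.Cone) (h : Module.Dual ℝ σ.lin) : Prop where
  ker_eq : ∀ v : σ.lin, h v = 0 ↔ (v : V) ∈ τ.lin
  nonneg : ∀ v : σ.lin, (v : V) ∈ σ.1 → 0 ≤ h v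

/-- An orientation of a fan: an orientation of `V_σ` for each cone `σ`, such that the
orientations of all full-dimensional cones coincide. -/
structure Orient (Δ : Fan V) where
  or : ∀ σ : Δ.Cone, Orientation ℝ σ.lin (Fin (Module.finrank ℝ σ.lin))
  full : ∀ (σ σ' : Δ.Cone) (h : σ.lin = ⊤) (h' : σ'.lin = ⊤),
    SameOrientation (h.trans h'.symm) (or σ) (or σ')

/-- The transition coefficient of a facet `τ` of `σ`, for a vector `n ∈ V_σ` with `h n = 1` for
some facet form `h`: it is `1` if contraction with `n` carries positive volume forms on `V_σ` to
positive volume forms on `V_τ`, and `-1` otherwise. -/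
def Orient.sign {Δ : Fan V} (o : Δ.Orient) {τ σ : Δ.Cone} (hf : τ.IsFacet σ) (n : σ.lin) : ℝ :=
  open Classical in
  if ∃ ω : Det σ.lin, IsPositive (o.or σ) ω ∧
    IsPositive (o.or τ) (Det.contract (Cone.lin_mono hf.le) hf.dim_eq n ω) then 1 else -1

/-- `Δ'` is a refinement of `Δ`: every cone of `Δ'` lies in a cone of `Δ`, and the two fans have
the same support. -/
structure IsRefinement (Δ' Δ : Fan V) : Prop where
  exists_le : ∀ τ : Δ'.Cone, ∃ σ : Δ.Cone, τ.1 ≤ σ.1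
  support_eq : (⋃ τ : Δ'.Cone, (τ.1 : Set V)) = ⋃ σ : Δ.Cone, (σ.1 : Set V)

theorem lin_eq_of_le_of_dim_eq [FiniteDimensional ℝ V] {Δ' Δ : Fan V} {τ : Δ'.Cone} {σ : Δ.Cone}
    (h : τ.1 ≤ σ.1) (hd : τ.dim = σ.dim) : τ.lin = σ.lin :=
  Submodule.eq_of_le_of_finrank_eq (Cone.lin_mono h) hd

/-- The orientations of a refinement `Δ'` and of `Δ` are compatible: if a cone of `Δ'` is
contained in a cone of `Δ` of the same dimension, their orientations coincide. -/
def Orient.IsCompatible [FiniteDimensional ℝ V] {Δ' Δ : Fan V} (o' : Δ'.Orient) (o : Δ.Orient) :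
    Prop :=
  ∀ (τ : Δ'.Cone) (σ : Δ.Cone) (h : τ.1 ≤ σ.1) (hd : τ.dim = σ.dim),
    SameOrientation (lin_eq_of_le_of_dim_eq h hd) (o'.or τ) (o.or σ)

end Fan

/-! ## Sheaves on a fan -/

/-- A sheaf of `𝒜`-modules on the fan space, given on the basis of affine subfans `⟨σ⟩`: the
module `stalk σ` of sections on `⟨σ⟩`, over the algebra of polynomial functions on `V_σ`, with
restriction maps to the faces. The subgroups `gr σ q` are the homogeneous parts; that they
decompose the module is `FanSheaf.IsGraded`. -/
structure FanSheaf (Δ : Fan V) where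
  stalk : Δ.Cone → Type w
  [acg : ∀ σ, AddCommGroup (stalk σ)]
  [mod : ∀ σ, Module (Poly σ.lin) (stalk σ)]
  res : ∀ {τ σ : Δ.Cone}, τ ≤ σ → stalk σ →+ stalk τ
  res_smul : ∀ {τ σ : Δ.Cone} (h : τ ≤ σ) (a : Poly σ.lin) (x : stalk σ),
    res h (a • x) = Poly.restrict (Fan.Cone.lin_mono h) a • res h x
  res_refl : ∀ {σ : Δ.Cone} (h : σ ≤ σ) (x : stalk σ), res h x = x
  res_trans : ∀ {ρ τ σ : Δ.Cone} (h₁ : ρ ≤ τ) (h₂ : τ ≤ σ) (x : stalk σ),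
    res h₁ (res h₂ x) = res (h₁.trans h₂) x
  gr : ∀ σ : Δ.Cone, ℤ → AddSubgroup (stalk σ)
  smul_mem_gr : ∀ {σ : Δ.Cone} {i j : ℤ} {a : Poly σ.lin} {x : stalk σ},
    a ∈ Poly.grade σ.lin i → x ∈ gr σ j → a • x ∈ gr σ (i + j)
  res_mem_gr : ∀ {τ σ : Δ.Cone} (h : τ ≤ σ) {j : ℤ} {x : stalk σ},
    x ∈ gr σ j → res h x ∈ gr τ j

attribute [instance] FanSheaf.acg FanSheaf.mod

namespace FanSheaf

variable {Δ : Fan V}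

/-- The sections over a subfan: the compatible families. -/
def sections (F : FanSheaf.{u, w} Δ) (Λ : LowerSet Δ.Cone) :
    AddSubgroup (∀ τ : Λ, F.stalk τ) where
  carrier := {s | ∀ (ρ τ : Λ) (h : (ρ : Δ.Cone) ≤ τ), F.res h (s τ) = s ρ}
  zero_mem' := fun _ _ _ => map_zero _
  add_mem' := fun hs ht ρ τ h => by
    simp only [Pi.add_apply, map_add, hs ρ τ h, ht ρ τ h]
  neg_mem' := fun hs ρ τ h => by simp only [Pi.neg_apply, map_neg, hs ρ τ h]

/-- Every section over a subfan extends to a global section. -/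
def IsFlabby (F : FanSheaf.{u, w} Δ) : Prop :=
  ∀ (Λ : LowerSet Δ.Cone) (s : F.sections Λ), ∃ t : F.sections ⊤,
    ∀ τ : Λ, t.1 ⟨τ, trivial⟩ = s.1 τ

/-- The homogeneous parts decompose each module of sections over a cone. -/
def IsGraded (F : FanSheaf.{u, w} Δ) : Prop :=
  ∀ σ : Δ.Cone, DirectSum.IsInternal (F.gr σ)

/-- A pure sheaf: a flabby sheaf of graded `𝒜`-modules whose modules of sections over the cones
are finitely generated and free. -/
structure IsPure (F : FanSheaf.{u, w} Δ) : Prop where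
  graded : F.IsGraded
  flabby : F.IsFlabby
  finite : ∀ σ : Δ.Cone, Module.Finite (Poly σ.lin) (F.stalk σ)
  free : ∀ σ : Δ.Cone, Module.Free (Poly σ.lin) (F.stalk σ)

/-- A homomorphism of sheaves of `𝒜`-modules. -/
@[ext]
structure Hom (F : FanSheaf.{u, w} Δ) (G : FanSheaf.{u, w'} Δ) where
  app : ∀ σ : Δ.Cone, F.stalk σ →ₗ[Poly σ.lin] G.stalk σ
  comm : ∀ {τ σ : Δ.Cone} (h : τ ≤ σ) (x : F.stalk σ), app τ (F.res h x) = G.res h (app σ x)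

/-- The homomorphism is an isomorphism of sheaves of graded `𝒜`-modules, of degree zero. -/
def Hom.IsIso {F : FanSheaf.{u, w} Δ} {G : FanSheaf.{u, w'} Δ} (f : Hom F G) : Prop :=
  ∀ σ : Δ.Cone, Function.Bijective (f.app σ) ∧
    ∀ (q : ℤ) (x : F.stalk σ), x ∈ F.gr σ q ↔ f.app σ x ∈ G.gr σ q

/-! ### Direct image -/

/-- The subfan of the cones of `Δ'` that are contained in the cone `σ` of `Δ`. -/
def below (Δ' : Fan V) (σ : Δ.Cone) : LowerSet Δ'.Cone where
  carrier := {τ | τ.1 ≤ σ.1}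
  lower' := fun _ _ h h' => le_trans (α := PointedCone ℝ V) h h'

theorem lin_le_of_below {Δ' : Fan V} {σ : Δ.Cone} (τ : below Δ' σ) : τ.1.lin ≤ σ.lin :=
  Fan.Cone.lin_mono τ.2

variable {Δ' : Fan V}

/-- Polynomial functions on `V_σ` act on the sections of `F` over the cones contained in `σ`. -/
instance pushModule (F : FanSheaf.{u, w} Δ') (σ : Δ.Cone) :
    Module (Poly σ.lin) (F.sections (below Δ' σ)) where
  smul a s := ⟨fun τ => Poly.restrict (lin_le_of_below τ) a • s.1 τ, fun ρ τ h => by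
    rw [F.res_smul, Poly.restrict_trans, s.2 ρ τ h]⟩
  one_smul s := Subtype.ext <| funext fun τ => by
    change Poly.restrict (lin_le_of_below τ) 1 • s.1 τ = s.1 τ
    rw [map_one, one_smul]
  mul_smul a b s := Subtype.ext <| funext fun τ => by
    change Poly.restrict (lin_le_of_below τ) (a * b) • s.1 τ =
      Poly.restrict (lin_le_of_below τ) a • Poly.restrict (lin_le_of_below τ) b • s.1 τ
    rw [map_mul, mul_smul]
  smul_zero a := Subtype.ext <| funext fun _ => smul_zero _
  smul_add a s t := Subtype.ext <| funext fun _ => smul_add _ _ _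
  add_smul a b s := Subtype.ext <| funext fun τ => by
    change Poly.restrict (lin_le_of_below τ) (a + b) • s.1 τ =
      Poly.restrict (lin_le_of_below τ) a • s.1 τ + Poly.restrict (lin_le_of_below τ) b • s.1 τ
    rw [map_add, add_smul]
  zero_smul s := Subtype.ext <| funext fun τ => by
    change Poly.restrict (lin_le_of_below τ) 0 • s.1 τ = 0
    rw [map_zero, zero_smul]

variable (Δ) in
/-- The direct image under `id_V`, with sections over `σ` those of `F` over the subfan of all
cones contained in `σ`. -/
def push (F : FanSheaf.{u, w} Δ') : FanSheaf.{u, max u w} Δ where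
  stalk σ := F.sections (below Δ' σ)
  acg _ := inferInstance
  mod σ := pushModule F σ
  res {τ σ} h :=
    { toFun := fun s => ⟨fun ρ => s.1 ⟨ρ, le_trans (α := PointedCone ℝ V) ρ.2 h⟩,
        fun ρ ρ' hr => s.2 ⟨ρ, _⟩ ⟨ρ', _⟩ hr⟩
      map_zero' := rfl
      map_add' := fun _ _ => rfl }
  res_smul {τ σ} h a s := Subtype.ext <| funext fun ρ => by
    change Poly.restrict _ a • _ = Poly.restrict _ (Poly.restrict _ a) • _
    rw [Poly.restrict_trans]
    rfl
  res_refl _ _ := rfl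
  res_trans _ _ _ := rfl
  gr σ q :=
    { carrier := {s | ∀ τ : below Δ' σ, s.1 τ ∈ F.gr τ q}
      zero_mem' := fun _ => zero_mem _
      add_mem' := fun hs ht τ => add_mem (hs τ) (ht τ)
      neg_mem' := fun hs τ => neg_mem (hs τ) }
  smul_mem_gr ha hs τ := F.smul_mem_gr (Poly.restrict_mem_grade _ ha) (hs τ)
  res_mem_gr _ _ _ hs τ := hs ⟨τ, _⟩

variable (Δ) in
/-- The direct image of a homomorphism. -/
def pushMap {F : FanSheaf.{u, w} Δ'} {G : FanSheaf.{u, w'} Δ'} (f : Hom F G) :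
    Hom (push Δ F) (push Δ G) where
  app σ :=
    { toFun := fun s => ⟨fun τ => f.app τ (s.1 τ), fun ρ τ h => by
        rw [← f.comm, s.2 ρ τ h]⟩
      map_add' := fun s t => Subtype.ext <| funext fun τ => map_add _ _ _
      map_smul' := fun a s => Subtype.ext <| funext fun τ => map_smul _ _ _ }
  comm _ _ := rfl

/-! ### Duality -/

/-- The module `F_{(σ, ∂σ)}` of the sections over `σ` that vanish on the boundary of `σ`. -/
def rel (F : FanSheaf.{u, w} Δ) (σ : Δ.Cone) : Submodule (Poly σ.lin) (F.stalk σ) where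
  carrier := {x | ∀ (τ : Δ.Cone) (h : τ < σ), F.res h.le x = 0}
  zero_mem' := fun _ _ => map_zero _
  add_mem' := fun hx hy τ h => by rw [map_add, hx τ h, hy τ h, add_zero]
  smul_mem' := fun a x hx τ h => by rw [F.res_smul, hx τ h, smul_zero]

/-- `Hom(F_{(σ, ∂σ)}, A_σ) ⊗ det V_σ^*`. -/
abbrev LocDual (F : FanSheaf.{u, w} Δ) (σ : Δ.Cone) : Type (max u w) :=
  (F.rel σ →ₗ[Poly σ.lin] Poly σ.lin) ⊗[ℝ] Det σ.lin

/-- The homogeneous part of degree `q` of `Hom(F_{(σ, ∂σ)}, A_σ) ⊗ det V_σ^*`, where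
`det V_σ^*` has degree `2 dim σ`. -/
def locGr (F : FanSheaf.{u, w} Δ) (σ : Δ.Cone) (q : ℤ) : AddSubgroup (F.LocDual σ) :=
  AddSubgroup.closure {t | ∃ (f : F.rel σ →ₗ[Poly σ.lin] Poly σ.lin) (ω : Det σ.lin),
    (∀ (j : ℤ) (x : F.rel σ), (x : F.stalk σ) ∈ F.gr σ j →
      f x ∈ Poly.grade σ.lin (j + (q - 2 * (σ.dim : ℤ)))) ∧ t = f ⊗ₜ[ℝ] ω}

/-- The map `Hom(F_{(σ, ∂σ)}, A_σ) ⊗ det V_σ^* → A_W ⊗ det W^*` given by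
`f ⊗ ω ↦ r (f y) ⊗ g ω`. -/
def pair (F : FanSheaf.{u, w} Δ) {σ : Δ.Cone} (y : F.rel σ) {W : Submodule ℝ V}
    (r : Poly σ.lin →ₐ[ℝ] Poly W) (g : Det σ.lin →ₗ[ℝ] Det W) :
    F.LocDual σ →ₗ[ℝ] Poly W ⊗[ℝ] Det W :=
  TensorProduct.map
    { toFun := fun f => r (f y)
      map_add' := fun f f' => by rw [LinearMap.add_apply, map_add]
      map_smul' := fun c f => by rw [LinearMap.smul_apply, map_smul, RingHom.id_apply] } g

theorem pair_tmul (F : FanSheaf.{u, w} Δ) {σ : Δ.Cone} (y : F.rel σ) {W : Submodule ℝ V}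
    (r : Poly σ.lin →ₐ[ℝ] Poly W) (g : Det σ.lin →ₗ[ℝ] Det W)
    (f : F.rel σ →ₗ[Poly σ.lin] Poly σ.lin) (ω : Det σ.lin) :
    F.pair y r g (f ⊗ₜ[ℝ] ω) = r (f y) ⊗ₜ[ℝ] g ω :=
  rfl

theorem pair_smul (F : FanSheaf.{u, w} Δ) {σ : Δ.Cone} (y : F.rel σ) {W : Submodule ℝ V}
    (r : Poly σ.lin →ₐ[ℝ] Poly W) (g : Det σ.lin →ₗ[ℝ] Det W) (a : Poly σ.lin)
    (c : F.LocDual σ) : F.pair y r g (a • c) = r a • F.pair y r g c := by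
  induction c using TensorProduct.induction_on with
  | zero => simp
  | tmul f ω =>
    rw [TensorProduct.smul_tmul', pair_tmul, pair_tmul, TensorProduct.smul_tmul',
      LinearMap.smul_apply, smul_eq_mul, map_mul, smul_eq_mul]
  | add c d hc hd => rw [smul_add, map_add, map_add, smul_add, hc, hd]

/-- `x ∈ F_σ` extends by zero the section `x|_τ`, that is, `x` vanishes on all proper faces of
`σ` other than `τ`. -/
def IsExtension (F : FanSheaf.{u, w} Δ) {σ : Δ.Cone} (τ : Δ.Cone) (x : F.stalk σ) : Prop :=
  ∀ (ρ : Δ.Cone) (h : ρ < σ), ρ ≠ τ → F.res h.le x = 0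

theorem IsExtension.res_mem {F : FanSheaf.{u, w} Δ} {τ σ : Δ.Cone} {x : F.stalk σ}
    (hx : F.IsExtension τ x) (hf : τ ≤ σ) : F.res hf x ∈ F.rel τ := by
  intro ρ h
  rw [F.res_trans]
  exact hx ρ (lt_of_lt_of_le h hf) h.ne

theorem IsExtension.smul_mem {F : FanSheaf.{u, w} Δ} {τ σ : Δ.Cone} {x : F.stalk σ}
    (hx : F.IsExtension τ x) {h : Module.Dual ℝ σ.lin} (hh : τ.IsFacetForm σ h) :
    Poly.ofForm h • x ∈ F.rel σ := by
  intro ρ hρ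
  rw [F.res_smul]
  by_cases e : ρ = τ
  · subst e
    rw [Poly.restrict_ofForm]
    have : h ∘ₗ Submodule.inclusion (Fan.Cone.lin_mono hρ.le) = 0 := by
      ext v
      exact (hh.ker_eq _).2 v.2
    rw [this, map_zero, zero_smul]
  · rw [hx ρ hρ e, smul_zero]

/-- For a facet `τ` of `σ`, the element `d` is the restriction `ε (φ_h ⊗ ψ_h) c` of `c`. Here
`φ_h(f)(s) = f(h š)|_τ` for every section `š` over `σ` that extends `s` and vanishes on the
proper faces of `σ` other than `τ`, the map `ψ_h` sends `h ∧ η` to `η|_{V_τ}`, and `ε` is the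
transition coefficient. -/
def IsFacetRes (F : FanSheaf.{u, w} Δ) (o : Δ.Orient) {τ σ : Δ.Cone} (hf : τ.IsFacet σ)
    (c : F.LocDual σ) (d : F.LocDual τ) : Prop :=
  ∀ (h : Module.Dual ℝ σ.lin) (hh : τ.IsFacetForm σ h) (n : σ.lin), h n = 1 →
    ∀ (x : F.stalk σ) (hx : F.IsExtension τ x),
      F.pair ⟨F.res hf.le x, hx.res_mem hf.le⟩ (AlgHom.id ℝ _) LinearMap.id d =
        o.sign hf n • F.pair ⟨Poly.ofForm h • x, hx.smul_mem hh⟩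
          (Poly.restrict (Fan.Cone.lin_mono hf.le))
          (Det.contract (Fan.Cone.lin_mono hf.le) hf.dim_eq n) c

/-- The sections of the dual sheaf over the affine subfan `⟨σ⟩`: the families of elements of
`Hom(F_{(τ, ∂τ)}, A_τ) ⊗ det V_τ^*`, for the faces `τ` of `σ`, in which each member restricts to
the members at its facets. -/
def DualStalk (F : FanSheaf.{u, w} Δ) (o : Δ.Orient) (σ : Δ.Cone) :
    AddSubgroup (∀ τ : Set.Iic σ, F.LocDual τ) where
  carrier := {ψ | ∀ (ρ τ : Set.Iic σ) (hf : ρ.1.IsFacet τ.1), F.IsFacetRes o hf (ψ τ) (ψ ρ)}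
  zero_mem' := fun ρ τ hf h hh n hn x hx => by
    simp only [Pi.zero_apply, map_zero, smul_zero]
  add_mem' := fun hψ hχ ρ τ hf h hh n hn x hx => by
    simp only [Pi.add_apply, map_add, smul_add]
    rw [hψ ρ τ hf h hh n hn x hx, hχ ρ τ hf h hh n hn x hx]
  neg_mem' := fun hψ ρ τ hf h hh n hn x hx => by
    simp only [Pi.neg_apply, map_neg, smul_neg]
    rw [hψ ρ τ hf h hh n hn x hx]

theorem lin_le_of_Iic {σ : Δ.Cone} (τ : Set.Iic σ) : τ.1.lin ≤ σ.lin :=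
  Fan.Cone.lin_mono (show τ.1 ≤ σ from τ.2)

instance dualModule (F : FanSheaf.{u, w} Δ) (o : Δ.Orient) (σ : Δ.Cone) :
    Module (Poly σ.lin) (F.DualStalk o σ) where
  smul a ψ := ⟨fun τ => Poly.restrict (lin_le_of_Iic τ) a • ψ.1 τ,
    fun ρ τ hf h hh n hn x hx => by
      rw [pair_smul, pair_smul, ψ.2 ρ τ hf h hh n hn x hx, Poly.restrict_trans, AlgHom.id_apply,
        smul_comm]⟩
  one_smul s := Subtype.ext <| funext fun τ => by
    change Poly.restrict (lin_le_of_Iic τ) 1 • s.1 τ = s.1 τ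
    rw [map_one, one_smul]
  mul_smul a b s := Subtype.ext <| funext fun τ => by
    change Poly.restrict (lin_le_of_Iic τ) (a * b) • s.1 τ =
      Poly.restrict (lin_le_of_Iic τ) a • Poly.restrict (lin_le_of_Iic τ) b • s.1 τ
    rw [map_mul, mul_smul]
  smul_zero a := Subtype.ext <| funext fun _ => smul_zero _
  smul_add a s t := Subtype.ext <| funext fun _ => smul_add _ _ _
  add_smul a b s := Subtype.ext <| funext fun τ => by
    change Poly.restrict (lin_le_of_Iic τ) (a + b) • s.1 τ =
      Poly.restrict (lin_le_of_Iic τ) a • s.1 τ + Poly.restrict (lin_le_of_Iic τ) b • s.1 τ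
    rw [map_add, add_smul]
  zero_smul s := Subtype.ext <| funext fun τ => by
    change Poly.restrict (lin_le_of_Iic τ) 0 • s.1 τ = 0
    rw [map_zero, zero_smul]

theorem smul_mem_locGr (F : FanSheaf.{u, w} Δ) {σ : Δ.Cone} {i j : ℤ} {a : Poly σ.lin}
    {c : F.LocDual σ} (ha : a ∈ Poly.grade σ.lin i) (hc : c ∈ F.locGr σ j) :
    a • c ∈ F.locGr σ (i + j) := by
  unfold locGr at hc
  induction hc using AddSubgroup.closure_induction with
  | mem t ht =>
    obtain ⟨f, ω, hf, rfl⟩ := ht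
    refine AddSubgroup.subset_closure ⟨a • f, ω, fun k x hx => ?_, TensorProduct.smul_tmul' _ _ _⟩
    have := Poly.mul_mem_grade ha (hf k x hx)
    rw [LinearMap.smul_apply, smul_eq_mul]
    convert this using 1
    ring_nf
  | zero => rw [smul_zero]; exact zero_mem _
  | add x y _ _ hx hy => rw [smul_add]; exact add_mem hx hy
  | neg x _ hx => rw [smul_neg]; exact neg_mem hx

/-- The dual sheaf `𝒟F`. -/
def dual (F : FanSheaf.{u, w} Δ) (o : Δ.Orient) : FanSheaf.{u, max u w} Δ where
  stalk σ := F.DualStalk o σ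
  acg _ := inferInstance
  mod σ := dualModule F o σ
  res {τ σ} h :=
    { toFun := fun ψ => ⟨fun ρ => ψ.1 ⟨ρ, le_trans (Set.mem_Iic.1 ρ.2) h⟩,
        fun ρ ρ' hf => ψ.2 ⟨ρ, _⟩ ⟨ρ', _⟩ hf⟩
      map_zero' := rfl
      map_add' := fun _ _ => rfl }
  res_smul {τ σ} h a ψ := Subtype.ext <| funext fun ρ => by
    change Poly.restrict _ a • _ = Poly.restrict _ (Poly.restrict _ a) • _
    rw [Poly.restrict_trans]
    rfl
  res_refl _ _ := rfl
  res_trans _ _ _ := rfl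
  gr σ q :=
    { carrier := {ψ | ∀ τ : Set.Iic σ, ψ.1 τ ∈ F.locGr τ q}
      zero_mem' := fun _ => zero_mem _
      add_mem' := fun hs ht τ => add_mem (hs τ) (ht τ)
      neg_mem' := fun hs τ => neg_mem (hs τ) }
  smul_mem_gr ha hs τ := F.smul_mem_locGr (Poly.restrict_mem_grade _ ha) (hs τ)
  res_mem_gr _ _ _ hs τ := hs ⟨τ, _⟩

/-- The map `(𝒟F)_σ → Hom(F_{(σ, ∂σ)}, A_σ) ⊗ det V_σ^*`, taking the member at `σ`. -/
def dualTop (F : FanSheaf.{u, w} Δ) (o : Δ.Orient) (σ : Δ.Cone) (ψ : (F.dual o).stalk σ) :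
    F.LocDual σ :=
  ψ.1 ⟨σ, Set.mem_Iic.2 le_rfl⟩

/-- The restriction maps of the dual sheaf are well defined on
`Hom(F_{(σ, ∂σ)}, A_σ) ⊗ det V_σ^*`: through the member at `σ`, the graded module of sections of
the dual sheaf over `σ` is `Hom(F_{(σ, ∂σ)}, A_σ) ⊗ det V_σ^*`. -/
def HasDualStalks (F : FanSheaf.{u, w} Δ) (o : Δ.Orient) : Prop :=
  ∀ σ : Δ.Cone, Function.Bijective (F.dualTop o σ) ∧
    ∀ (q : ℤ) (ψ : (F.dual o).stalk σ), ψ ∈ (F.dual o).gr σ q ↔ F.dualTop o σ ψ ∈ F.locGr σ q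

/-- The restriction of a homomorphism to the sections that vanish on the boundary. -/
def relMap {F : FanSheaf.{u, w} Δ} {G : FanSheaf.{u, w'} Δ} (f : Hom F G) (σ : Δ.Cone) :
    F.rel σ →ₗ[Poly σ.lin] G.rel σ :=
  (f.app σ).restrict fun x hx τ h => by rw [← f.comm, hx τ h, map_zero]

/-- `g ⊗ ω ↦ (g ∘ f) ⊗ ω`. -/
def locDualMap {F : FanSheaf.{u, w} Δ} {G : FanSheaf.{u, w'} Δ} (f : Hom F G) (σ : Δ.Cone) :
    G.LocDual σ →ₗ[Poly σ.lin] F.LocDual σ :=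
  TensorProduct.AlgebraTensorModule.map (LinearMap.lcomp (Poly σ.lin) (Poly σ.lin) (relMap f σ))
    (LinearMap.id : Det σ.lin →ₗ[ℝ] Det σ.lin)

theorem pair_locDualMap {F : FanSheaf.{u, w} Δ} {G : FanSheaf.{u, w'} Δ} (f : Hom F G)
    {σ : Δ.Cone} (y : F.rel σ) {W : Submodule ℝ V}
    (r : Poly σ.lin →ₐ[ℝ] Poly W) (g : Det σ.lin →ₗ[ℝ] Det W) (c : G.LocDual σ) :
    F.pair y r g (locDualMap f σ c) = G.pair (relMap f σ y) r g c := by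
  induction c using TensorProduct.induction_on with
  | zero => simp
  | tmul g' ω => rfl
  | add c d hc hd => rw [map_add, map_add, map_add, hc, hd]

theorem IsFacetRes.map {F : FanSheaf.{u, w} Δ} {G : FanSheaf.{u, w'} Δ} (f : Hom F G)
    {o : Δ.Orient} {τ σ : Δ.Cone} {hf : τ.IsFacet σ} {c : G.LocDual σ} {d : G.LocDual τ}
    (hcd : G.IsFacetRes o hf c d) :
    F.IsFacetRes o hf (locDualMap f σ c) (locDualMap f τ d) := by
  intro h hh n hn x hx
  have hx' : G.IsExtension τ (f.app σ x) := fun ρ hρ hne => by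
    rw [← f.comm, hx ρ hρ hne, map_zero]
  have e₁ : relMap f τ ⟨F.res hf.le x, hx.res_mem hf.le⟩ =
      ⟨G.res hf.le (f.app σ x), hx'.res_mem hf.le⟩ := Subtype.ext (f.comm hf.le x)
  have e₂ : relMap f σ ⟨Poly.ofForm h • x, hx.smul_mem hh⟩ =
      ⟨Poly.ofForm h • f.app σ x, hx'.smul_mem hh⟩ :=
    Subtype.ext (map_smul (f.app σ) (Poly.ofForm h) x)
  rw [pair_locDualMap, pair_locDualMap, e₁, e₂]
  exact hcd h hh n hn (f.app σ x) hx'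

/-- The homomorphism of dual sheaves induced by a homomorphism. -/
def dualMap {F : FanSheaf.{u, w} Δ} {G : FanSheaf.{u, w'} Δ} (f : Hom F G) (o : Δ.Orient) :
    Hom (G.dual o) (F.dual o) where
  app _ :=
    { toFun := fun ψ => ⟨fun τ => locDualMap f τ (ψ.1 τ), fun ρ τ hf => (ψ.2 ρ τ hf).map f⟩
      map_add' := fun _ _ => Subtype.ext <| funext fun _ => map_add _ _ _
      map_smul' := fun _ _ => Subtype.ext <| funext fun _ => map_smul _ _ _ }
  comm _ _ := rfl

/-! ### Comparison of duality and direct image -/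

theorem rel_of_supported (F : FanSheaf.{u, w} Δ') {σ : Δ.Cone} {τ : below Δ' σ}
    {x : (push Δ F).stalk σ} (hx : ∀ ρ : below Δ' σ, ρ ≠ τ → x.1 ρ = 0) :
    x.1 τ ∈ F.rel τ := by
  intro ρ h
  have hρ : ρ ∈ below Δ' σ := (below Δ' σ).lower h.le τ.2
  have e := x.2 ⟨ρ, hρ⟩ τ h.le
  rw [e]
  exact hx ⟨ρ, hρ⟩ fun e' => h.ne (congrArg Subtype.val e')

/-- The normalization that characterizes the comparison map. Let `σ` be a cone of `Δ`, let `τ` be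
a cone of `Δ'` of the same dimension that is contained in `σ`, and let `x` be a section over `σ`
of the direct image that vanishes on `∂σ` and on all cones of `Δ'` in `σ` other than `τ`. If `c`
is a section over `σ` of the dual of the direct image, with member `∑ f_i ⊗ ω_i` at `σ`, and the
image of `c` has member `∑ g_i ⊗ η_i` at `τ`, then `∑ g_i(x|_τ) ⊗ η_i = ∑ f_i(x) ⊗ ω_i` under the
identification `V_τ = V_σ`. -/
def IsCanonical (F : FanSheaf.{u, w} Δ') (o' : Δ'.Orient) (o : Δ.Orient)
    (Φ : Hom ((push Δ F).dual o) (push Δ (F.dual o'))) : Prop :=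
  ∀ (σ : Δ.Cone) (τ : below Δ' σ) (hd : τ.1.dim = σ.dim) (x : (push Δ F).rel σ)
    (hx : ∀ ρ : below Δ' σ, ρ ≠ τ → x.1.1 ρ = 0) (c : ((push Δ F).dual o).stalk σ),
    F.pair ⟨x.1.1 τ, F.rel_of_supported hx⟩ (AlgHom.id ℝ _) LinearMap.id
        (F.dualTop o' τ ((Φ.app σ c).1 τ)) =
      (push Δ F).pair x (Poly.restrict (lin_le_of_below τ)) (Det.restrict (lin_le_of_below τ) hd)
        ((push Δ F).dualTop o σ c)

end FanSheaf

end FanDuality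

end

noncomputable section

namespace FanDuality

variable {V : Type u} [AddCommGroup V] [Module ℝ V]

/-! ## Finitely generated cones -/

/-! Call a cone of `Δ'` in `σ` of the dimension of `σ` a chamber. A functional `f` on the sections
over `σ` that vanish on `∂σ` has a component at each chamber, its restriction to the sections
supported there. The comparison map sends `f` to the family of its components.

Let `H` be the product of linear forms, one for each hyperplane of `V_σ` spanned by a cone in `σ` of
codimension one (`wallProd`). Multiplication by `H` turns a section `s` into a sum of sections
supported on single chambers (`wallProd_smul_eq_sum`). Hence `H f(s)` is computed from the
components, and `f` is determined by them because polynomial functions form a domain. Conversely,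
functionals `g_τ` at the chambers are the components of a functional as soon as `H` divides `∑ g_τ(H
s)` for all `s` (`exists_comp_eq`). The wall forms are pairwise non-associated primes, so this means
that the sum vanishes on each wall `W` (`wallProd_dvd`). On `W` only the chambers with a facet in
`W` contribute. A facet in `∂σ` contributes zero, because `s` vanishes on it. Any other facet is
shared by exactly two chambers, whose normal forms are opposite, and since the two functionals
restrict to the same functional on the facet, their contributions cancel
(`IsCompatibleFamily.restrict_glue`).

The same cancellation shows that the components of a given `f` agree on a common facet `ρ`. If a
section `x` extends a section over `ρ`, and `h` is a form vanishing on `ρ`, suitably normalized,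
then `h x` is a difference of sections supported on the two chambers, while `f(h x) = h f(x)`
vanishes on `ρ` (`Chamber.IsTransfer.eq_of_isFacetRes`).

Two connectivity statements pass from facets to higher codimension. The faces strictly between `ρ`
and `σ` are connected in codimension at least three (`rel_of_between`); together with the case of
codimension two (`IsFacetRes.diamond`), where the two flags have the same product of normal forms
(`form_mul_form`), this makes the restriction maps of the dual independent of the flag. The star of
`ρ` inside `σ` is connected in codimension at least two (`rel_of_star`), so elements at the chambers
that agree on common facets glue. Both rest on the fact that a segment covered by finitely many
closed sets is connected; cones are closed along lines by Farkas' lemma.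

Signs and constants disappear once each `det V_σ^*` is trivialized by a positive generator `vol` and
each facet form is scaled so that `vol` goes to `±vol`. The restriction to a facet then reads `f ↦
f(h ·)|_τ` (`isFacetRes_tmul_iff`). Linearity, compatibility with restriction and naturality of the
comparison map all follow from its uniqueness. -/

theorem exists_dual_separating_sum {ι : Type*} (s : Finset ι) :
    ∀ (a : ι → V) (b : V), (¬ ∃ c : ι → ℝ, (∀ i ∈ s, 0 ≤ c i) ∧ b = ∑ i ∈ s, c i • a i) →
      ∃ l : Module.Dual ℝ V, (∀ i ∈ s, 0 ≤ l (a i)) ∧ l b < 0 := by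
  classical
  induction s using Finset.induction_on with
  | empty =>
    intro a b hb
    have hb0 : b ≠ 0 := fun h => hb ⟨0, by simp, by simp [h]⟩
    have hb1 : ∃ l : Module.Dual ℝ V, l b ≠ 0 := by
      by_contra! h
      exact hb0 ((Module.forall_dual_apply_eq_zero_iff ℝ b).1 h)
    obtain ⟨l, hl⟩ := hb1
    rcases lt_or_gt_of_ne hl with h | h
    · exact ⟨l, by simp, h⟩
    · exact ⟨-l, by simp, by simpa using h⟩
  | insert i₀ s hi₀ ih =>
    intro a b hb
    obtain ⟨l, hl, hlb⟩ := ih a b (by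
      rintro ⟨c, hc, hbc⟩
      refine hb ⟨fun i => if i = i₀ then 0 else c i, ?_, ?_⟩
      · intro i hi
        by_cases h : i = i₀
        · simp [h]
        · simpa [h] using hc i ((Finset.mem_insert.1 hi).resolve_left h)
      · rw [Finset.sum_insert hi₀, hbc]
        simp only [if_true, zero_smul, zero_add]
        refine Finset.sum_congr rfl fun i hi => ?_
        rw [if_neg (ne_of_mem_of_not_mem hi hi₀)])
    by_cases h0 : 0 ≤ l (a i₀)
    · exact ⟨l, fun i hi => (Finset.mem_insert.1 hi).elim (fun h => h ▸ h0) (hl i), hlb⟩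
    · push Not at h0
      -- Project along `a i₀` onto `ker l` and separate there. If the projection of `b` were a
      -- non-negative combination of the projected vectors, `b` would be one of the original
      -- vectors: the coefficient of `a i₀` is non-negative because `l b` and `l (a i₀)` are
      -- negative and the other `l (a j)` are not.
      obtain ⟨l', hl', hlb'⟩ := ih (fun i => a i - (l (a i) / l (a i₀)) • a i₀)
        (b - (l b / l (a i₀)) • a i₀) (by
          rintro ⟨c, hc, hbc⟩
          refine hb ⟨fun i => if i = i₀ then
            l b / l (a i₀) - ∑ j ∈ s, c j * (l (a j) / l (a i₀)) else c i, ?_, ?_⟩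
          · intro i hi
            by_cases h : i = i₀
            · simp only [h, if_true]
              have h1 : 0 ≤ l b / l (a i₀) := (div_pos_of_neg_of_neg hlb h0).le
              have h2 : ∑ j ∈ s, c j * (l (a j) / l (a i₀)) ≤ 0 :=
                Finset.sum_nonpos fun j hj => mul_nonpos_of_nonneg_of_nonpos (hc j hj)
                  (div_nonpos_of_nonneg_of_nonpos (hl j hj) h0.le)
              linarith
            · simpa [h] using hc i ((Finset.mem_insert.1 hi).resolve_left h)
          · rw [Finset.sum_insert hi₀]
            have : ∑ i ∈ s, (if i = i₀ then
                l b / l (a i₀) - ∑ j ∈ s, c j * (l (a j) / l (a i₀)) else c i) • a i =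
                ∑ i ∈ s, c i • a i :=
              Finset.sum_congr rfl fun i hi => by rw [if_neg (ne_of_mem_of_not_mem hi hi₀)]
            simp only [this, if_true, sub_smul]
            simp only [smul_sub, Finset.sum_sub_distrib, smul_smul] at hbc
            rw [← Finset.sum_smul] at hbc
            rw [sub_eq_iff_eq_add] at hbc
            nth_rewrite 1 [hbc]
            abel)
      -- This is `l'` composed with the projection, so it vanishes on `a i₀`.
      refine ⟨l' - (l' (a i₀) / l (a i₀)) • l, ?_, ?_⟩
      · intro i hi
        rcases Finset.mem_insert.1 hi with rfl | hi
        · simp [div_mul_cancel₀ _ h0.ne]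
        · have := hl' i hi
          simp only [map_sub, map_smul, smul_eq_mul] at this
          simp only [LinearMap.sub_apply, LinearMap.smul_apply, smul_eq_mul]
          have e : l' (a i₀) / l (a i₀) * l (a i) = l (a i) / l (a i₀) * l' (a i₀) := by ring
          rw [e]; exact this
      · have := hlb'
        simp only [map_sub, map_smul, smul_eq_mul] at this
        simp only [LinearMap.sub_apply, LinearMap.smul_apply, smul_eq_mul]
        have e : l' (a i₀) / l (a i₀) * l b = l b / l (a i₀) * l' (a i₀) := by ring
        rw [e]; exact this

/-- **Farkas' lemma** for finitely generated cones. -/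
theorem exists_dual_separating {σ : PointedCone ℝ V} (hσ : σ.FG) {x : V} (hx : x ∉ σ) :
    ∃ l : Module.Dual ℝ V, (∀ v ∈ σ, 0 ≤ l v) ∧ l x < 0 := by
  obtain ⟨s, rfl⟩ := hσ
  obtain ⟨l, hl, hlx⟩ := exists_dual_separating_sum s (fun v => v) x (by
    rintro ⟨c, hc, rfl⟩
    exact hx (sum_mem fun i hi => PointedCone.smul_mem _ (hc i hi) (Submodule.subset_span hi)))
  refine ⟨l, fun v hv => ?_, hlx⟩
  induction hv using Submodule.span_induction with
  | mem v hv => exact hl v hv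
  | zero => simp
  | add v w _ _ hv hw => rw [map_add]; exact add_nonneg hv hw
  | smul c v _ hv =>
    change 0 ≤ l ((c : ℝ) • v)
    rw [map_smul]; exact mul_nonneg c.2 hv

/-- A finitely generated cone is closed along affine paths. -/
theorem isClosed_setOf_mem_of_fg {σ : PointedCone ℝ V} (hσ : σ.FG) (p q : V) :
    IsClosed {t : ℝ | p + t • q ∈ σ} := by
  -- By Farkas' lemma the cone is an intersection of half-spaces `0 ≤ l`.
  have : {t : ℝ | p + t • q ∈ σ} =
      ⋂ l : {l : Module.Dual ℝ V // ∀ v ∈ σ, 0 ≤ l v}, {t : ℝ | 0 ≤ l.1 p + t * l.1 q} := by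
    ext t
    simp only [Set.mem_ofPred_eq, Set.mem_iInter, Subtype.forall]
    constructor
    · intro h l hl
      simpa using hl _ h
    · intro h
      by_contra hn
      obtain ⟨l, hl, hlt⟩ := exists_dual_separating hσ hn
      have := h l hl
      simp only [map_add, map_smul, smul_eq_mul] at hlt
      linarith
  rw [this]
  exact isClosed_iInter fun l => isClosed_le continuous_const (by fun_prop)

/-- For small `ε`, a point `x + ε y` can lie only in those of finitely many cones which
contain `x`. -/
theorem exists_pos_forall_mem_of_add_mem {ι κ : Type*} [Finite ι] [Finite κ]
    (C : ι → PointedCone ℝ V)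
    (hC : ∀ i, (C i).FG) (x : V) (y : κ → V) :
    ∃ ε : ℝ, 0 < ε ∧ ∀ i, x ∉ C i → ∃ l : Module.Dual ℝ V, (∀ v ∈ C i, 0 ≤ l v) ∧
      ∀ k, l (x + ε • y k) < 0 := by
  classical
  cases nonempty_fintype ι
  cases nonempty_fintype κ
  have h1 : ∀ i, ∃ l : Module.Dual ℝ V, (∀ v ∈ C i, 0 ≤ l v) ∧ (x ∉ C i → l x < 0) := by
    intro i
    by_cases h : x ∈ C i
    · exact ⟨0, by simp, fun h' => absurd h h'⟩
    · obtain ⟨l, hl, hlx⟩ := exists_dual_separating (hC i) h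
      exact ⟨l, hl, fun _ => hlx⟩
  choose l hl hlx using h1
  have h2 : ∀ i k, x ∉ C i → ∀ᶠ ε : ℝ in nhdsWithin 0 (Set.Ioi 0), l i (x + ε • y k) < 0 := by
    intro i k hi
    refine Filter.Eventually.filter_mono nhdsWithin_le_nhds ?_
    have : Continuous fun ε : ℝ => l i (x + ε • y k) := by
      simp only [map_add, map_smul, smul_eq_mul]; fun_prop
    exact this.continuousAt.eventually_lt continuousAt_const (by simpa using hlx i hi)
  have h3 : ∀ᶠ ε : ℝ in nhdsWithin 0 (Set.Ioi 0), ∀ i k, x ∉ C i → l i (x + ε • y k) < 0 := by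
    refine Filter.eventually_all.2 fun i => Filter.eventually_all.2 fun k => ?_
    by_cases h : x ∈ C i
    · exact Filter.Eventually.of_forall fun _ h' => absurd h h'
    · filter_upwards [h2 i k h] with ε hε _ using hε
  obtain ⟨ε, hε, hε0⟩ := (h3.and self_mem_nhdsWithin).exists
  exact ⟨ε, hε0, fun i hi => ⟨l i, hl i, fun k => hε i k hi⟩⟩

theorem exists_pos_mem_of_add_mem {ι : Type*} [Finite ι] (C : ι → PointedCone ℝ V)
    (hC : ∀ i, (C i).FG) (x y : V) :
    ∃ ε : ℝ, 0 < ε ∧ ∀ i, x + ε • y ∈ C i → x ∈ C i := by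
  obtain ⟨ε, hε, h⟩ := exists_pos_forall_mem_of_add_mem C hC x (fun _ : Unit => y)
  refine ⟨ε, hε, fun i hi => ?_⟩
  by_contra hx
  obtain ⟨l, hl, hlx⟩ := h i hx
  exact absurd (hl _ hi) (not_le.2 (hlx ()))

/-- Suppose that finitely many finitely generated cones cover, near `x`, the segment from `y₁` to
`y₂` seen from `x`. If any two of them that share `x` and a point of the segment are related,
then those at the two ends are related. -/
theorem rel_of_segment_covered {ι : Type*} [Finite ι] (C : ι → PointedCone ℝ V)
    (hC : ∀ i, (C i).FG) (x y₁ y₂ : V)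
    (hcov : ∀ ε : ℝ, 0 < ε → ∀ t ∈ Set.Icc (0 : ℝ) 1,
      ∃ i, x + ε • (y₁ + t • (y₂ - y₁)) ∈ C i)
    (R : ι → ι → Prop) (hR : Equivalence R)
    (hrel : ∀ i j, x ∈ C i → x ∈ C j → ∀ ε : ℝ, 0 < ε → ∀ t ∈ Set.Icc (0 : ℝ) 1,
      x + ε • (y₁ + t • (y₂ - y₁)) ∈ C i → x + ε • (y₁ + t • (y₂ - y₁)) ∈ C j → R i j)
    {i j : ι} (hxi : x ∈ C i) (hyi : y₁ ∈ C i) (hxj : x ∈ C j) (hyj : y₂ ∈ C j) : R i j := by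
  -- For this `ε`, a cone without `x` has a form negative at both ends of the scaled segment, hence
  -- on all of it. So every cone that meets the segment contains `x`.
  obtain ⟨ε, hε, hx⟩ := exists_pos_forall_mem_of_add_mem C hC x ![y₁, y₂]
  have hmem : ∀ k, ∀ t ∈ Set.Icc (0 : ℝ) 1, x + ε • (y₁ + t • (y₂ - y₁)) ∈ C k → x ∈ C k := by
    intro k t ht hk
    by_contra hxk
    obtain ⟨l, hl, hlx⟩ := hx k hxk
    have h0 := hlx 0
    have h1 := hlx 1
    have h2 := hl _ hk
    simp only [Matrix.cons_val_zero, Matrix.cons_val_one, map_add, map_smul, smul_eq_mul,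
      map_sub] at h0 h1 h2
    have e : l x + ε * (l y₁ + t * (l y₂ - l y₁)) =
        (1 - t) * (l x + ε * l y₁) + t * (l x + ε * l y₂) := by ring
    rw [e] at h2
    rcases eq_or_lt_of_le ht.1 with h | h
    · rw [← h] at h2; linarith
    · nlinarith [ht.2, mul_neg_of_pos_of_neg h h1,
        mul_nonneg (sub_nonneg.2 ht.2) (neg_nonneg.2 h0.le)]
  have hclosed : ∀ k, IsClosed {t : ℝ | x + ε • (y₁ + t • (y₂ - y₁)) ∈ C k} := by
    intro k
    have := isClosed_setOf_mem_of_fg (hC k) (x + ε • y₁) (ε • (y₂ - y₁))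
    convert this using 4
    rw [smul_add, add_assoc, smul_comm]
  by_contra hij
  -- The cones related to `i` and those that are not give two closed sets covering `[0, 1]`, each
  -- non-empty. By connectedness they share a point, and there `hrel` applies.
  let A : Set ℝ := ⋃ k : {k // R i k}, {t : ℝ | x + ε • (y₁ + t • (y₂ - y₁)) ∈ C k}
  let B : Set ℝ := ⋃ k : {k // ¬ R i k}, {t : ℝ | x + ε • (y₁ + t • (y₂ - y₁)) ∈ C k}
  have hA : IsClosed A := isClosed_iUnion_of_finite fun k => hclosed k
  have hB : IsClosed B := isClosed_iUnion_of_finite fun k => hclosed k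
  have hpre := isPreconnected_closed_iff.1 (isPreconnected_Icc (a := (0 : ℝ)) (b := 1)) A B hA hB
    (fun t ht => by
      obtain ⟨k, hk⟩ := hcov ε hε t ht
      by_cases h : R i k
      · exact Or.inl (Set.mem_iUnion.2 ⟨⟨k, h⟩, hk⟩)
      · exact Or.inr (Set.mem_iUnion.2 ⟨⟨k, h⟩, hk⟩))
    ⟨0, by simp, Set.mem_iUnion.2 ⟨⟨i, hR.refl i⟩, by
      simpa using add_mem hxi (PointedCone.smul_mem _ hε.le hyi)⟩⟩
    ⟨1, by simp, Set.mem_iUnion.2 ⟨⟨j, hij⟩, by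
      have e : y₁ + (1 : ℝ) • (y₂ - y₁) = y₂ := by rw [one_smul, add_sub_cancel]
      rw [Set.mem_ofPred_eq, e]
      exact add_mem hxj (PointedCone.smul_mem _ hε.le hyj)⟩⟩
  obtain ⟨t, ht, htA, htB⟩ := hpre
  obtain ⟨⟨k, hk⟩, hkt⟩ := Set.mem_iUnion.1 htA
  obtain ⟨⟨k', hk'⟩, hkt'⟩ := Set.mem_iUnion.1 htB
  exact hk' (hR.trans hk (hrel k k' (hmem k t ht hkt) (hmem k' t ht hkt') ε hε t ht hkt hkt'))

/-- `w` lies in the relative interior of `σ`. -/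
def IsRelint (σ : PointedCone ℝ V) (w : V) : Prop :=
  w ∈ σ ∧ ∀ v ∈ σ, ∃ c : ℝ, 0 < c ∧ c • w - v ∈ σ

theorem exists_isRelint {σ : PointedCone ℝ V} (hσ : σ.FG) : ∃ w, IsRelint σ w := by
  classical
  obtain ⟨s, rfl⟩ := hσ
  have hw : ∑ v ∈ s, v ∈ PointedCone.hull ℝ (s : Set V) :=
    sum_mem fun i hi => Submodule.subset_span hi
  refine ⟨∑ v ∈ s, v, hw, fun v hv => ?_⟩
  induction hv using Submodule.span_induction with
  | mem v hv =>
    refine ⟨1, one_pos, ?_⟩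
    rw [one_smul, ← Finset.add_sum_erase s (fun v => v) hv, add_sub_cancel_left]
    exact sum_mem fun i hi => Submodule.subset_span (Finset.mem_of_mem_erase hi)
  | zero => exact ⟨1, one_pos, by simpa using hw⟩
  | add v v' _ _ hv hv' =>
    obtain ⟨c, hc, h⟩ := hv
    obtain ⟨c', hc', h'⟩ := hv'
    refine ⟨c + c', add_pos hc hc', ?_⟩
    rw [add_smul, add_sub_add_comm]
    exact add_mem h h'
  | smul a v _ hv =>
    obtain ⟨c, hc, h⟩ := hv
    refine ⟨a * c + 1, by have := mul_nonneg a.2 hc.le; linarith, ?_⟩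
    have e : ((a : ℝ) * c + 1) • ∑ v ∈ s, v - a • v =
        a • (c • ∑ v ∈ s, v - v) + ∑ v ∈ s, v := by
      change _ - (a : ℝ) • v = (a : ℝ) • _ + _
      module
    rw [e]
    exact add_mem (Submodule.smul_mem _ _ h) hw

/-- For `v ∈ σ`, both `v` and `c • w - v` lie in `σ` and their sum `c • w` lies in the face, so `v`
does. -/
theorem IsRelint.eq_of_mem_face {σ F : PointedCone ℝ V} {w : V} (hw : IsRelint σ w)
    (hF : F.IsFaceOf σ) (h : w ∈ F) : F = σ := by
  refine le_antisymm hF.le fun v hv => ?_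
  obtain ⟨c, hc, h'⟩ := hw.2 v hv
  refine hF.mem_of_add_mem_left hv h' ?_
  rw [add_sub_cancel]
  exact PointedCone.smul_mem _ hc.le h

theorem IsRelint.exists_add_smul_mem {σ : PointedCone ℝ V} {w v : V} (hw : IsRelint σ w)
    (hv : v ∈ Submodule.span ℝ (σ : Set V)) : ∃ ε : ℝ, 0 < ε ∧ w + ε • v ∈ σ := by
  -- The two-sided statement survives multiplication of `v` by a negative scalar.
  suffices H : ∃ ε : ℝ, 0 < ε ∧ w + ε • v ∈ σ ∧ w - ε • v ∈ σ by
    obtain ⟨ε, h, h', -⟩ := H; exact ⟨ε, h, h'⟩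
  induction hv using Submodule.span_induction with
  | mem v hv =>
    obtain ⟨c, hc, h⟩ := hw.2 v hv
    refine ⟨c⁻¹, inv_pos.2 hc, add_mem hw.1 (PointedCone.smul_mem _ (inv_pos.2 hc).le hv), ?_⟩
    have e : w - c⁻¹ • v = c⁻¹ • (c • w - v) := by
      rw [smul_sub, smul_smul, inv_mul_cancel₀ hc.ne', one_smul]
    rw [e]
    exact PointedCone.smul_mem _ (inv_pos.2 hc).le h
  | zero => exact ⟨1, one_pos, by simpa using hw.1, by simpa using hw.1⟩
  | add v v' _ _ hv hv' =>
    obtain ⟨ε, hε, h₁, h₂⟩ := hv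
    obtain ⟨δ, hδ, h₁', h₂'⟩ := hv'
    have hs : 0 < ε + δ := add_pos hε hδ
    have hd : 0 ≤ δ / (ε + δ) := (div_pos hδ hs).le
    have he : 0 ≤ ε / (ε + δ) := (div_pos hε hs).le
    have e1 : w = (δ / (ε + δ)) • w + (ε / (ε + δ)) • w := by
      rw [← add_smul, ← add_div, add_comm δ, div_self hs.ne', one_smul]
    -- With this step length, `w + _ • (v + v')` is the convex combination of `w + ε • v` and `w + δ
    -- • v'` with weights `δ / (ε + δ)` and `ε / (ε + δ)`.
    refine ⟨ε * δ / (ε + δ), by positivity, ?_, ?_⟩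
    · have e : w + (ε * δ / (ε + δ)) • (v + v') =
          (δ / (ε + δ)) • (w + ε • v) + (ε / (ε + δ)) • (w + δ • v') := by
        nth_rewrite 1 [e1]
        module
      rw [e]
      exact add_mem (PointedCone.smul_mem _ hd h₁) (PointedCone.smul_mem _ he h₁')
    · have e : w - (ε * δ / (ε + δ)) • (v + v') =
          (δ / (ε + δ)) • (w - ε • v) + (ε / (ε + δ)) • (w - δ • v') := by
        nth_rewrite 1 [e1]
        module
      rw [e]
      exact add_mem (PointedCone.smul_mem _ hd h₂) (PointedCone.smul_mem _ he h₂')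
  | smul a v _ hv =>
    obtain ⟨ε, hε, h₁, h₂⟩ := hv
    rcases lt_trichotomy a 0 with ha | rfl | ha
    · refine ⟨ε / (-a), div_pos hε (neg_pos.2 ha), ?_, ?_⟩
      · rw [smul_smul, div_neg, neg_mul, div_mul_cancel₀ _ ha.ne, neg_smul, ← sub_eq_add_neg]
        exact h₂
      · rw [smul_smul, div_neg, neg_mul, div_mul_cancel₀ _ ha.ne, neg_smul, sub_neg_eq_add]
        exact h₁
    · exact ⟨1, one_pos, by simpa using hw.1, by simpa using hw.1⟩
    · refine ⟨ε / a, div_pos hε ha, ?_, ?_⟩ <;> rw [smul_smul, div_mul_cancel₀ _ ha.ne']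
      exacts [h₁, h₂]

/-- The smallest face of `σ` that contains `b ∈ σ`. -/
def minFace (σ : PointedCone ℝ V) (b : V) : PointedCone ℝ V where
  carrier := {v | v ∈ σ ∧ ∃ c : ℝ, 0 ≤ c ∧ c • b - v ∈ σ}
  zero_mem' := ⟨zero_mem _, 0, le_rfl, by simp⟩
  add_mem' := by
    rintro v v' ⟨hv, c, hc, h⟩ ⟨hv', c', hc', h'⟩
    refine ⟨add_mem hv hv', c + c', add_nonneg hc hc', ?_⟩
    rw [add_smul, add_sub_add_comm]
    exact add_mem h h'
  smul_mem' := by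
    rintro a v ⟨hv, c, hc, h⟩
    refine ⟨Submodule.smul_mem _ _ hv, a * c, mul_nonneg a.2 hc, ?_⟩
    have e : ((a : ℝ) * c) • b - a • v = a • (c • b - v) := by
      change _ - (a : ℝ) • v = (a : ℝ) • _
      module
    rw [e]
    exact Submodule.smul_mem _ _ h

theorem minFace_isFaceOf (σ : PointedCone ℝ V) (b : V) : (minFace σ b).IsFaceOf σ := by
  refine PointedCone.IsFaceOf.of_mem_of_add_mem_left (fun v hv => hv.1) ?_
  rintro x y hx hy ⟨-, c, hc, h⟩
  refine ⟨hx, c, hc, ?_⟩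
  have e : c • b - x = (c • b - (x + y)) + y := by abel
  rw [e]
  exact add_mem h hy

theorem mem_minFace {σ : PointedCone ℝ V} {b : V} (hb : b ∈ σ) : b ∈ minFace σ b :=
  ⟨hb, 1, zero_le_one, by simp⟩

theorem exists_sub_of_mem_span {σ : PointedCone ℝ V} {v : V}
    (hv : v ∈ Submodule.span ℝ (σ : Set V)) : ∃ a ∈ σ, ∃ b ∈ σ, v = a - b := by
  induction hv using Submodule.span_induction with
  | mem v hv => exact ⟨v, hv, 0, zero_mem _, (sub_zero v).symm⟩
  | zero => exact ⟨0, zero_mem _, 0, zero_mem _, (sub_zero 0).symm⟩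
  | add v v' _ _ hv hv' =>
    obtain ⟨a, ha, b, hb, rfl⟩ := hv
    obtain ⟨a', ha', b', hb', rfl⟩ := hv'
    exact ⟨a + a', add_mem ha ha', b + b', add_mem hb hb', by abel⟩
  | smul c v _ hv =>
    obtain ⟨a, ha, b, hb, rfl⟩ := hv
    rcases le_total 0 c with hc | hc
    · exact ⟨c • a, PointedCone.smul_mem _ hc ha, c • b, PointedCone.smul_mem _ hc hb,
        smul_sub _ _ _⟩
    · exact ⟨(-c) • b, PointedCone.smul_mem _ (neg_nonneg.2 hc) hb, (-c) • a,
        PointedCone.smul_mem _ (neg_nonneg.2 hc) ha, by module⟩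

/-- Writing `v = a - b` with `a, b ∈ F`, the sum `v + b` lies in `F` and both summands lie in `σ`.
-/
theorem mem_face_of_mem_span {σ F : PointedCone ℝ V} (hF : F.IsFaceOf σ) {v : V} (hv : v ∈ σ)
    (hvF : v ∈ Submodule.span ℝ (F : Set V)) : v ∈ F := by
  obtain ⟨a, ha, b, hb, rfl⟩ := exists_sub_of_mem_span hvF
  refine hF.mem_of_add_mem_left hv (hF.le hb) ?_
  rwa [sub_add_cancel]

theorem exists_dual_ker_eq {E : Type*} [AddCommGroup E] [Module ℝ E] [FiniteDimensional ℝ E]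
    (W : Submodule ℝ E) (h : Module.finrank ℝ W + 1 = Module.finrank ℝ E) :
    ∃ l : Module.Dual ℝ E, LinearMap.ker l = W := by
  have hlt : W < ⊤ := lt_of_le_of_ne le_top fun e => by
    rw [e, finrank_top] at h; omega
  obtain ⟨l, hl0, hl⟩ := Submodule.exists_le_ker_of_lt_top W hlt
  refine ⟨l, (Submodule.eq_of_le_of_finrank_eq hl ?_).symm⟩
  have h1 := Submodule.finrank_mono hl
  have h2 := Submodule.finrank_lt fun e => hl0 (LinearMap.ker_eq_top.1 e)
  omega

theorem exists_mem_notMem {σ : PointedCone ℝ V} {S : Submodule ℝ V}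
    (h : ¬ Submodule.span ℝ (σ : Set V) ≤ S) : ∃ v ∈ σ, v ∉ S := by
  by_contra! H
  exact h (Submodule.span_le.2 H)

/-! ### Faces of the cones of a fan: existence of facets and connectivity of intervals -/

namespace Fan

instance {Δ : Fan V} : Finite Δ.Cone := Δ.finite

namespace Cone

variable {Δ : Fan V}

theorem fg (σ : Δ.Cone) : σ.1.FG := Δ.polyhedral σ.1 σ.2

theorem subset_lin (σ : Δ.Cone) {v : V} (hv : v ∈ σ.1) : v ∈ σ.lin := Submodule.subset_span hv

/-- A cone of the fan, given as a face of another one. -/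
def ofFace (σ : Δ.Cone) (F : PointedCone ℝ V) (h : F.IsFaceOf σ.1) : Δ.Cone :=
  ⟨F, Δ.face_mem σ.1 σ.2 F h⟩

/-- The intersection of two cones of a fan. -/
def inter (σ τ : Δ.Cone) : Δ.Cone := σ.ofFace (σ.1 ⊓ τ.1) (Δ.inter_face σ.1 σ.2 τ.1 τ.2)

theorem inter_le_left (σ τ : Δ.Cone) : σ.inter τ ≤ σ :=
  inf_le_left (a := σ.1) (b := τ.1)

theorem inter_le_right (σ τ : Δ.Cone) : σ.inter τ ≤ τ :=
  inf_le_right (a := σ.1) (b := τ.1)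

theorem mem_inter {σ τ : Δ.Cone} {v : V} : v ∈ (σ.inter τ).1 ↔ v ∈ σ.1 ∧ v ∈ τ.1 := Iff.rfl

theorem le_inter {ρ σ τ : Δ.Cone} (h : ρ ≤ σ) (h' : ρ ≤ τ) : ρ ≤ σ.inter τ :=
  fun _ hv => ⟨h hv, h' hv⟩

/-- A point in the relative interior of a cone. -/
def pt (σ : Δ.Cone) : V := (exists_isRelint σ.fg).choose

theorem isRelint_pt (σ : Δ.Cone) : IsRelint σ.1 σ.pt := (exists_isRelint σ.fg).choose_spec

theorem pt_mem (σ : Δ.Cone) : σ.pt ∈ σ.1 := σ.isRelint_pt.1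

/-- The intersection with `μ` is a face of `ρ` that meets the relative interior of `ρ`. This reduces
the face order to membership of a single point. -/
theorem pt_mem_iff {ρ μ : Δ.Cone} : ρ.pt ∈ μ.1 ↔ ρ ≤ μ := by
  refine ⟨fun h => ?_, fun h => h ρ.pt_mem⟩
  have := ρ.isRelint_pt.eq_of_mem_face (le_iff_isFaceOf.1 (inter_le_left ρ μ))
    (mem_inter.2 ⟨ρ.pt_mem, h⟩)
  have e : ρ.inter μ = ρ := Subtype.ext this
  exact e ▸ inter_le_right ρ μ

theorem mem_of_mem_lin {τ σ : Δ.Cone} (h : τ ≤ σ) {v : V} (hv : v ∈ σ.1) (hv' : v ∈ τ.lin) :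
    v ∈ τ.1 :=
  mem_face_of_mem_span (le_iff_isFaceOf.1 h) hv hv'

theorem pt_notMem_lin {τ σ : Δ.Cone} (h : τ < σ) : σ.pt ∉ τ.lin := fun hv =>
  h.not_ge (pt_mem_iff.1 (mem_of_mem_lin h.le σ.pt_mem hv))

theorem exists_mem_notMem_of_lt {τ σ : Δ.Cone} (h : τ < σ) : ∃ v ∈ σ.1, v ∉ τ.lin :=
  ⟨σ.pt, σ.pt_mem, pt_notMem_lin h⟩

theorem dim_mono [FiniteDimensional ℝ V] {Δ' : Fan V} {τ : Δ'.Cone} {σ : Δ.Cone} (h : τ.1 ≤ σ.1) :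
    τ.dim ≤ σ.dim :=
  Submodule.finrank_mono (lin_mono h)

theorem dim_lt [FiniteDimensional ℝ V] {τ σ : Δ.Cone} (h : τ < σ) : τ.dim < σ.dim := by
  refine Submodule.finrank_lt_finrank_of_lt (lt_of_le_of_ne (lin_mono h.le) fun e => ?_)
  exact pt_notMem_lin h (e ▸ σ.subset_lin σ.pt_mem)

theorem eq_of_le_of_dim_le [FiniteDimensional ℝ V] {τ σ : Δ.Cone} (h : τ ≤ σ) (hd : σ.dim ≤ τ.dim) :
    τ = σ := by
  by_contra hne
  exact absurd (dim_lt (lt_of_le_of_ne h hne)) (not_lt.2 hd)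

theorem IsFacet.lt {τ σ : Δ.Cone} (h : τ.IsFacet σ) : τ < σ :=
  lt_of_le_of_ne h.le fun e => by have := h.dim_eq; rw [e] at this; omega

theorem isFacet_of_between [FiniteDimensional ℝ V] {ρ τ σ : Δ.Cone} (h₁ : ρ < τ) (h₂ : τ < σ)
    (hd : ρ.dim + 2 = σ.dim) : ρ.IsFacet τ ∧ τ.IsFacet σ := by
  have := dim_lt h₁
  have := dim_lt h₂
  exact ⟨⟨h₁.le, by omega⟩, ⟨h₂.le, by omega⟩⟩

/-- The cone generated by `μ` and a vector `w`. -/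
def join (μ : Δ.Cone) (w : V) : PointedCone ℝ V := μ.1 ⊔ PointedCone.hull ℝ {w}

theorem join_fg (μ : Δ.Cone) (w : V) : (μ.join w).FG :=
  Submodule.FG.sup μ.fg (Submodule.fg_span (Set.finite_singleton w))

theorem mem_join {μ : Δ.Cone} {w z : V} : z ∈ μ.join w ↔ ∃ s : ℝ, 0 ≤ s ∧ z - s • w ∈ μ.1 := by
  constructor
  · intro h
    obtain ⟨m, hm, y, hy, rfl⟩ := Submodule.mem_sup.1 h
    obtain ⟨s, rfl⟩ := Submodule.mem_span_singleton.1 hy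
    refine ⟨s, s.2, ?_⟩
    change m + (s : ℝ) • w - (s : ℝ) • w ∈ μ.1
    rwa [add_sub_cancel_right]
  · rintro ⟨s, hs, h⟩
    refine Submodule.mem_sup.2 ⟨_, h, s • w, PointedCone.smul_mem _ hs
      (Submodule.subset_span rfl), sub_add_cancel _ _⟩

/-- Moving from `z` in the direction `-σ.pt`, one leaves `σ` because `σ` is salient; the last point
in `σ` lies on a proper face. Thus `σ` is covered by the cones `μ.join σ.pt` over its proper faces.
The cone `ρ` only guarantees `σ.pt ≠ 0`. -/
theorem exists_sub_smul_pt_mem {ρ σ : Δ.Cone} (h : ρ < σ) {z : V} (hz : z ∈ σ.1) :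
    ∃ s : ℝ, 0 ≤ s ∧ ∃ μ : Δ.Cone, μ < σ ∧ z - s • σ.pt ∈ μ.1 := by
  have hw0 : σ.pt ≠ 0 := fun e => pt_notMem_lin h (e ▸ zero_mem _)
  have hneg : -σ.pt ∉ σ.1 := Δ.salient σ.1 σ.2 _ σ.pt_mem hw0
  obtain ⟨l, hl, hlw⟩ := exists_dual_separating σ.fg hneg
  rw [map_neg, neg_lt_zero] at hlw
  let T : Set ℝ := {t | 0 ≤ t} ∩ {t | z + t • (-σ.pt) ∈ σ.1}
  have hT : IsClosed T := isClosed_Ici.inter (isClosed_setOf_mem_of_fg σ.fg z (-σ.pt))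
  have hne : T.Nonempty := ⟨0, le_refl (0 : ℝ), by
    rw [Set.mem_ofPred_eq, zero_smul, add_zero]; exact hz⟩
  have hbdd : BddAbove T := ⟨l z / l σ.pt, fun t ht => by
    have := hl _ ht.2
    simp only [map_add, map_smul, map_neg, smul_eq_mul] at this
    rw [le_div_iff₀ hlw]; linarith⟩
  have hs := hT.csSup_mem hne hbdd
  set s := sSup T
  have hb : z - s • σ.pt ∈ σ.1 := by
    have := hs.2
    rwa [Set.mem_ofPred_eq, smul_neg, ← sub_eq_add_neg] at this
  refine ⟨s, hs.1, σ.ofFace _ (minFace_isFaceOf σ.1 (z - s • σ.pt)), ?_, mem_minFace hb⟩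
  refine lt_of_le_of_ne (minFace_isFaceOf σ.1 (z - s • σ.pt)).le fun e => ?_
  have hw : σ.pt ∈ minFace σ.1 (z - s • σ.pt) := by
    have : minFace σ.1 (z - s • σ.pt) = σ.1 := congrArg Subtype.val e
    rw [this]; exact σ.pt_mem
  obtain ⟨-, c, hc, hcw⟩ := hw
  -- If the smallest face through the last point were `σ`, it would contain `σ.pt`, and one could
  -- move on by `c⁻¹`.
  rcases eq_or_lt_of_le hc with rfl | hc
  · rw [zero_smul, zero_sub] at hcw
    exact hneg hcw
  · have : s + c⁻¹ ∈ T := by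
      refine ⟨add_nonneg hs.1 (inv_pos.2 hc).le, ?_⟩
      rw [Set.mem_ofPred_eq]
      have e : z + (s + c⁻¹) • (-σ.pt) = c⁻¹ • (c • (z - s • σ.pt) - σ.pt) := by
        rw [smul_sub, smul_smul, inv_mul_cancel₀ hc.ne', one_smul]; module
      rw [e]
      exact PointedCone.smul_mem _ (inv_pos.2 hc).le hcw
    have := le_csSup hbdd this
    have := inv_pos.2 hc
    linarith

theorem smul_pt_mem_lin {μ σ : Δ.Cone} (h : μ < σ) {c : ℝ} (hc : c • σ.pt ∈ μ.lin) : c = 0 := by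
  by_contra h0
  have := Submodule.smul_mem _ c⁻¹ hc
  rw [smul_smul, inv_mul_cancel₀ h0, one_smul] at this
  exact pt_notMem_lin h this

/-- For `s ≤ t`, the point `z - s • σ.pt` of the face `μ` is the sum of `z - t • σ.pt` and `(t - s)
• σ.pt`. Hence the last summand lies in `μ`, although `σ.pt` is not in its span. So the projection
to `∂σ` from `σ.pt` is well defined. -/
theorem sub_smul_pt_unique {μ ν σ : Δ.Cone} (hμ : μ < σ) (hν : ν < σ) {z : V} {s t : ℝ}
    (hs : z - s • σ.pt ∈ μ.1) (ht : z - t • σ.pt ∈ ν.1) : s = t := by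
  have key : ∀ {μ ν : Δ.Cone}, μ < σ → ν < σ → ∀ {s t : ℝ}, z - s • σ.pt ∈ μ.1 →
      z - t • σ.pt ∈ ν.1 → s ≤ t → s = t := by
    intro μ ν hμ hν s t hs ht hst
    have hmem : (t - s) • σ.pt ∈ μ.1 := by
      refine (le_iff_isFaceOf.1 hμ.le).mem_of_add_mem_right (hν.le ht)
        (PointedCone.smul_mem _ (sub_nonneg.2 hst) σ.pt_mem) ?_
      have e : z - t • σ.pt + (t - s) • σ.pt = z - s • σ.pt := by module
      rwa [e]
    linarith [smul_pt_mem_lin hμ (μ.subset_lin hmem)]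
  rcases le_total s t with h | h
  · exact key hμ hν hs ht h
  · exact (key hν hμ ht hs h).symm

/-- The point `ρ.pt` is already on the boundary, so its projection is itself. -/
theorem le_of_pt_mem_join {ρ μ σ : Δ.Cone} (hρ : ρ < σ) (hμ : μ < σ)
    (h : ρ.pt ∈ μ.join σ.pt) : ρ ≤ μ := by
  obtain ⟨s, -, hs⟩ := mem_join.1 h
  have : (0 : ℝ) = s := sub_smul_pt_unique hρ hμ (z := ρ.pt) (by simpa using ρ.pt_mem) hs
  rw [← this, zero_smul, sub_zero] at hs
  exact pt_mem_iff.1 hs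

/-- Move from `ρ.pt` slightly towards `y` and project to `∂σ` along `σ.pt`. For small `ε` the face
that is reached contains `ρ`, and it is not `ρ` because `y` lies outside `ρ.lin` and the line of
`σ.pt`. -/
theorem exists_between_of_notMem {ρ σ : Δ.Cone} (h : ρ < σ) {y : V} (hy : y ∈ σ.1)
    (hy' : y ∉ ρ.lin ⊔ Submodule.span ℝ {σ.pt}) :
    ∃ μ : Δ.Cone, ρ < μ ∧ μ < σ ∧ ∃ ε s : ℝ, 0 < ε ∧ ρ.pt + ε • y - s • σ.pt ∈ μ.1 := by
  obtain ⟨ε, hε, H⟩ := exists_pos_mem_of_add_mem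
    (fun μ : {μ : Δ.Cone // μ < σ} => μ.1.join σ.pt) (fun μ => μ.1.join_fg _) ρ.pt y
  obtain ⟨s, hs, μ, hμ, hm⟩ := exists_sub_smul_pt_mem h
    (add_mem (h.le ρ.pt_mem) (PointedCone.smul_mem _ hε.le hy))
  have hle : ρ ≤ μ := le_of_pt_mem_join h hμ (H ⟨μ, hμ⟩ (mem_join.2 ⟨s, hs, hm⟩))
  refine ⟨μ, lt_of_le_of_ne hle ?_, hμ, ε, s, hε, hm⟩
  rintro rfl
  refine hy' ?_
  have e : y = ε⁻¹ • ((ρ.pt + ε • y - s • σ.pt) - ρ.pt) + (ε⁻¹ * s) • σ.pt := by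
    rw [mul_smul, ← smul_add]
    have : ρ.pt + ε • y - s • σ.pt - ρ.pt + s • σ.pt = ε • y := by abel
    rw [this, smul_smul, inv_mul_cancel₀ hε.ne', one_smul]
  rw [e]
  exact add_mem (Submodule.mem_sup_left (Submodule.smul_mem _ _ (sub_mem (ρ.subset_lin hm)
    (ρ.subset_lin ρ.pt_mem)))) (Submodule.mem_sup_right (Submodule.smul_mem _ _
      (Submodule.mem_span_singleton_self _)))

theorem finrank_sup_span_le [FiniteDimensional ℝ V] (S : Submodule ℝ V) (v : V) :
    Module.finrank ℝ (S ⊔ Submodule.span ℝ {v} : Submodule ℝ V) ≤ Module.finrank ℝ S + 1 := by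
  refine (Submodule.finrank_add_le_finrank_add_finrank S _).trans ?_
  have := finrank_span_le_card (R := ℝ) ({v} : Set V)
  simp only [Set.toFinset_singleton, Finset.card_singleton] at this
  omega

theorem exists_between [FiniteDimensional ℝ V] {ρ σ : Δ.Cone} (h : ρ < σ) (hd : ρ.dim + 2 ≤ σ.dim) :
    ∃ μ : Δ.Cone, ρ < μ ∧ μ < σ := by
  obtain ⟨y, hy, hy'⟩ := exists_mem_notMem (σ := σ.1) (S := ρ.lin ⊔ Submodule.span ℝ {σ.pt})
    fun hle => by
      have h1 : σ.dim ≤ _ := Submodule.finrank_mono hle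
      have h2 := finrank_sup_span_le ρ.lin σ.pt
      have h3 : ρ.dim = Module.finrank ℝ ρ.lin := rfl
      omega
  obtain ⟨μ, h₁, h₂, -⟩ := exists_between_of_notMem h hy hy'
  exact ⟨μ, h₁, h₂⟩

/-- Every proper face lies in a facet. -/
theorem exists_isFacet [FiniteDimensional ℝ V] {ρ σ : Δ.Cone} (h : ρ < σ) : ∃ τ :
    Δ.Cone, τ.IsFacet σ ∧ ρ ≤ τ := by
  induction hn : σ.dim - ρ.dim using Nat.strong_induction_on generalizing ρ with
  | _ n ih =>
    have h0 := dim_lt h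
    by_cases hd : ρ.dim + 1 = σ.dim
    · exact ⟨ρ, ⟨h.le, hd⟩, le_rfl⟩
    · obtain ⟨μ, h₁, h₂⟩ := exists_between h (by omega)
      have h3 := dim_lt h₁
      have h4 := dim_lt h₂
      obtain ⟨τ, hτ, hμτ⟩ := ih (σ.dim - μ.dim) (by omega) h₂ rfl
      exact ⟨τ, hτ, h₁.le.trans hμτ⟩

theorem notMem_sup_span_pt {ρ τ σ : Δ.Cone} (h₁ : ρ < τ) (h₂ : τ < σ) {e : V} (he : e ∈ τ.1)
    (he' : e ∉ ρ.1) : e ∉ ρ.lin ⊔ Submodule.span ℝ {σ.pt} := by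
  intro hmem
  obtain ⟨r, hr, y, hy, rfl⟩ := Submodule.mem_sup.1 hmem
  obtain ⟨k, rfl⟩ := Submodule.mem_span_singleton.1 hy
  have hk : k • σ.pt ∈ τ.lin := by
    have := sub_mem (τ.subset_lin he) (lin_mono h₁.le hr)
    rwa [add_sub_cancel_left] at this
  rw [smul_pt_mem_lin h₂ hk, zero_smul, add_zero] at he he'
  exact he' (mem_of_mem_lin h₁.le he hr)

/-- A face of codimension at least two lies in at least two facets. -/
theorem exists_isFacet_ne [FiniteDimensional ℝ V] {ρ τ σ : Δ.Cone} (h₁ : ρ < τ) (h₂ : τ < σ) :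
    ∃ τ' : Δ.Cone, τ'.IsFacet σ ∧ ρ ≤ τ' ∧ τ' ≠ τ := by
  obtain ⟨e, he, he'⟩ := exists_mem_notMem_of_lt h₁
  replace he' : e ∉ ρ.1 := fun h => he' (ρ.subset_lin h)
  -- The vector `e` points from `ρ` into `τ`. Modulo `σ.pt`, the vector `c • σ.pt - e ∈ σ` points
  -- the opposite way, so the face found in its direction should be another one.
  obtain ⟨c, hc, hy⟩ := σ.isRelint_pt.2 e (h₂.le he)
  have hpt : σ.pt ∈ ρ.lin ⊔ Submodule.span ℝ {σ.pt} :=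
    Submodule.mem_sup_right (Submodule.mem_span_singleton_self _)
  obtain ⟨μ, hρμ, hμ, ε, s, hε, hm⟩ := exists_between_of_notMem (h₁.trans h₂) hy fun hmem =>
    notMem_sup_span_pt h₁ h₂ he he' (by
      have := sub_mem (Submodule.smul_mem _ c hpt) hmem
      rwa [sub_sub_cancel] at this)
  obtain ⟨τ', hτ', hle⟩ := exists_isFacet hμ
  refine ⟨τ', hτ', hρμ.le.trans hle, ?_⟩
  rintro rfl
  have hm' := hle hm
  have hk : (ε * c - s) • σ.pt ∈ τ'.lin := by
    have := add_mem (sub_mem (τ'.subset_lin hm') (τ'.subset_lin (h₁.le ρ.pt_mem)))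
      (Submodule.smul_mem _ ε (τ'.subset_lin he))
    convert this using 1
    module
  -- If the facet were the same, `ρ.pt - ε • e` would lie in it. Adding `ε • e` gives `ρ.pt`, so the
  -- face property would put `e` into `ρ`.
  have hs : s = ε * c := by linarith [smul_pt_mem_lin h₂ hk]
  have hm'' : ρ.pt - ε • e ∈ τ'.1 := by
    convert hm' using 1
    rw [hs]; module
  have := (le_iff_isFaceOf.1 h₁.le).mem_of_smul_add_mem he hm'' hε
    (by rw [add_sub_cancel]; exact ρ.pt_mem)
  exact he' this

/-- In codimension at least three, the set of cones strictly between two cones is connected. -/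
theorem rel_of_between [FiniteDimensional ℝ V] {ρ σ : Δ.Cone} (hd : ρ.dim + 3 ≤ σ.dim)
    (R : Δ.Cone → Δ.Cone → Prop) (hR : Equivalence R)
    (hrel : ∀ μ ν : Δ.Cone, ρ < μ → μ ≤ ν → ν < σ → R μ ν)
    {τ₁ τ₂ : Δ.Cone} (h₁ : ρ ≤ τ₁) (h₂ : ρ ≤ τ₂) (hf₁ : τ₁.IsFacet σ) (hf₂ : τ₂.IsFacet σ) :
    R τ₁ τ₂ := by
  have hlt₁ : ρ < τ₁ := lt_of_le_of_ne h₁ fun e => by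
    have := hf₁.dim_eq; rw [← e] at this; omega
  have hρσ : ρ < σ := hlt₁.trans hf₁.lt
  obtain ⟨y₁, hy₁, hy₁'⟩ := exists_mem_notMem_of_lt hlt₁
  replace hy₁' := notMem_sup_span_pt hlt₁ hf₁.lt hy₁ (fun h => hy₁' (ρ.subset_lin h))
  -- Otherwise `τ₂.lin` would be contained in a space of dimension at most `ρ.dim + 2 ≤ τ₂.dim`,
  -- hence equal to it, and would contain `σ.pt`. The choice keeps the whole segment from `y₁` to
  -- `y₂` out of `ρ.lin` plus the line of `σ.pt`.
  obtain ⟨y₂, hy₂, hy₂'⟩ := exists_mem_notMem (σ := τ₂.1)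
    (S := ρ.lin ⊔ Submodule.span ℝ {σ.pt} ⊔ Submodule.span ℝ {y₁}) fun hle => by
      have e := Submodule.eq_of_le_of_finrank_le hle (by
        have h1 := finrank_sup_span_le (ρ.lin ⊔ Submodule.span ℝ {σ.pt}) y₁
        have h2 := finrank_sup_span_le ρ.lin σ.pt
        have h3 : ρ.dim = Module.finrank ℝ ρ.lin := rfl
        have h4 := hf₂.dim_eq
        have h5 : τ₂.dim = Module.finrank ℝ (Submodule.span ℝ (τ₂.1 : Set V)) := rfl
        omega)
      refine pt_notMem_lin hf₂.lt ?_
      change σ.pt ∈ Submodule.span ℝ (τ₂.1 : Set V)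
      rw [e]
      exact Submodule.mem_sup_left (Submodule.mem_sup_right (Submodule.mem_span_singleton_self _))
  have hseg : ∀ t : ℝ, y₁ + t • (y₂ - y₁) ∉ ρ.lin ⊔ Submodule.span ℝ {σ.pt} := by
    intro t ht
    by_cases h0 : t = 0
    · rw [h0, zero_smul, add_zero] at ht
      exact hy₁' ht
    · refine hy₂' ?_
      have e : y₂ = t⁻¹ • (y₁ + t • (y₂ - y₁)) + (1 - t⁻¹) • y₁ := by
        rw [smul_add, smul_smul, inv_mul_cancel₀ h0, one_smul]; module
      rw [e]
      exact add_mem (Submodule.mem_sup_left (Submodule.smul_mem _ _ ht))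
        (Submodule.mem_sup_right (Submodule.smul_mem _ _ (Submodule.mem_span_singleton_self _)))
  have hjoin : ∀ {μ : Δ.Cone} {v : V}, v ∈ μ.1 → v ∈ μ.join σ.pt := fun hv =>
    mem_join.2 ⟨0, le_rfl, by simpa using hv⟩
  -- The segment near `ρ.pt` is covered by the cones over proper faces with apex ray `σ.pt`. This
  -- amounts to following the path in `∂σ` that is its projection from `σ.pt`.
  refine rel_of_segment_covered (fun μ : {μ : Δ.Cone // μ < σ} => μ.1.join σ.pt)
    (fun μ => μ.1.join_fg _) ρ.pt y₁ y₂ ?_ (fun μ ν => R μ.1 ν.1)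
    ⟨fun μ => hR.refl _, fun h => hR.symm h, fun h h' => hR.trans h h'⟩ ?_
    (i := ⟨τ₁, hf₁.lt⟩) (j := ⟨τ₂, hf₂.lt⟩) (hjoin (h₁ ρ.pt_mem)) (hjoin hy₁)
    (hjoin (h₂ ρ.pt_mem)) (hjoin hy₂)
  · intro ε hε t ht
    have hz : ρ.pt + ε • (y₁ + t • (y₂ - y₁)) ∈ σ.1 := by
      have e : y₁ + t • (y₂ - y₁) = (1 - t) • y₁ + t • y₂ := by module
      rw [e]
      exact add_mem (hρσ.le ρ.pt_mem) (PointedCone.smul_mem _ hε.le (add_mem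
        (PointedCone.smul_mem _ (sub_nonneg.2 ht.2) (hf₁.le hy₁))
        (PointedCone.smul_mem _ ht.1 (hf₂.le hy₂))))
    obtain ⟨s, hs, μ, hμ, hm⟩ := exists_sub_smul_pt_mem hρσ hz
    exact ⟨⟨μ, hμ⟩, mem_join.2 ⟨s, hs, hm⟩⟩
  · rintro ⟨μ, hμ⟩ ⟨ν, hν⟩ hxμ hxν ε hε t ht hzμ hzν
    have hρμ := le_of_pt_mem_join hρσ hμ hxμ
    have hρν := le_of_pt_mem_join hρσ hν hxν
    obtain ⟨s, -, hs⟩ := mem_join.1 hzμ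
    obtain ⟨s', -, hs'⟩ := mem_join.1 hzν
    have e := sub_smul_pt_unique hμ hν hs hs'
    subst e
    -- Both faces contain the projection of the same segment point, which is not in `ρ.lin`. Their
    -- intersection therefore links them.
    have hlt : ρ < μ.inter ν := by
      refine lt_of_le_of_ne (le_inter hρμ hρν) fun e => hseg t ?_
      have hm : ρ.pt + ε • (y₁ + t • (y₂ - y₁)) - s • σ.pt ∈ ρ.lin :=
        by
          have : _ ∈ (μ.inter ν).1 := mem_inter.2 ⟨hs, hs'⟩
          rw [← e] at this
          exact ρ.subset_lin this
      have e' : y₁ + t • (y₂ - y₁) = ε⁻¹ • ((ρ.pt + ε • (y₁ + t • (y₂ - y₁)) - s • σ.pt)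
          - ρ.pt) + (ε⁻¹ * s) • σ.pt := by
        rw [mul_smul, ← smul_add]
        have : ρ.pt + ε • (y₁ + t • (y₂ - y₁)) - s • σ.pt - ρ.pt + s • σ.pt =
          ε • (y₁ + t • (y₂ - y₁)) := by abel
        rw [this, smul_smul, inv_mul_cancel₀ hε.ne', one_smul]
      rw [e']
      exact add_mem (Submodule.mem_sup_left (Submodule.smul_mem _ _ (sub_mem hm
        (ρ.subset_lin ρ.pt_mem)))) (Submodule.mem_sup_right (Submodule.smul_mem _ _
          (Submodule.mem_span_singleton_self _)))
    exact hR.trans (hR.symm (hrel _ _ hlt (inter_le_left μ ν) hμ))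
      (hrel _ _ hlt (inter_le_right μ ν) hν)

end Cone

end Fan

namespace Fan

namespace Cone

variable {Δ Δ' : Fan V}

/-! ### Facet forms -/

theorem IsFacetForm.pos {τ σ : Δ.Cone} {h : Module.Dual ℝ σ.lin} (hh : τ.IsFacetForm σ h)
    {v : V} (hv : v ∈ σ.1) (hv' : v ∉ τ.lin) : 0 < h ⟨v, σ.subset_lin hv⟩ :=
  lt_of_le_of_ne (hh.nonneg _ hv) fun e => hv' ((hh.ker_eq ⟨v, σ.subset_lin hv⟩).1 e.symm)

/-- A form with kernel `V_τ` cannot change sign on `σ`. If `l a > 0 > l b`, a positive combination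
of `a` and `b` lies in the kernel, hence in `τ`, and the face property puts `a` into `τ`. -/
theorem exists_isFacetForm [FiniteDimensional ℝ V] {τ σ : Δ.Cone} (hf : τ.IsFacet σ) :
    ∃ h : Module.Dual ℝ σ.lin, τ.IsFacetForm σ h := by
  have hle : τ.lin ≤ σ.lin := lin_mono hf.le
  obtain ⟨l, hl⟩ := exists_dual_ker_eq (τ.lin.submoduleOf σ.lin) (by
    rw [(Submodule.submoduleOfEquivOfLe hle).finrank_eq]; exact hf.dim_eq)
  have hker : ∀ v : σ.lin, l v = 0 ↔ (v : V) ∈ τ.lin := fun v => by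
    rw [← LinearMap.mem_ker, hl]; rfl
  have hsign : ∀ a b : σ.lin, (a : V) ∈ σ.1 → (b : V) ∈ σ.1 → 0 < l a → 0 ≤ l b := by
    intro a b ha hb h
    by_contra! hneg
    have hmem : (-l b) • (a : V) + (l a) • (b : V) ∈ τ.lin := by
      refine (hker ((-l b) • a + (l a) • b)).1 ?_
      rw [map_add, map_smul, map_smul, smul_eq_mul, smul_eq_mul]; ring
    have hmem' := mem_of_mem_lin hf.le (add_mem (PointedCone.smul_mem _ (neg_pos.2 hneg).le ha)
      (PointedCone.smul_mem _ h.le hb)) hmem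
    have := (le_iff_isFaceOf.1 hf.le).mem_of_smul_add_smul_mem_left ha hb (neg_pos.2 hneg) h hmem'
    rw [(hker a).2 (τ.subset_lin this)] at h
    exact lt_irrefl _ h
  by_cases hpos : ∃ a : σ.lin, (a : V) ∈ σ.1 ∧ 0 < l a
  · obtain ⟨a, ha, h⟩ := hpos
    exact ⟨l, hker, fun b hb => hsign a b ha hb h⟩
  · push Not at hpos
    exact ⟨-l, fun v => by rw [← hker v, LinearMap.neg_apply, neg_eq_zero], fun v hv => by
      rw [LinearMap.neg_apply]; exact neg_nonneg.2 (hpos v hv)⟩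

theorem IsFacetForm.exists_eq_smul {τ σ : Δ.Cone} (hlt : τ < σ) {h h' : Module.Dual ℝ σ.lin}
    (hh : τ.IsFacetForm σ h) (hh' : τ.IsFacetForm σ h') : ∃ c : ℝ, 0 < c ∧ h' = c • h := by
  have h0 := hh.pos σ.pt_mem (pt_notMem_lin hlt)
  have h0' := hh'.pos σ.pt_mem (pt_notMem_lin hlt)
  set e : σ.lin := ⟨σ.pt, σ.subset_lin σ.pt_mem⟩
  refine ⟨h' e / h e, div_pos h0' h0, LinearMap.ext fun u => ?_⟩
  have hk : h (u - (h u / h e) • e) = 0 := by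
    rw [map_sub, map_smul, smul_eq_mul, div_mul_cancel₀ _ h0.ne', sub_self]
  have := (hh'.ker_eq _).2 ((hh.ker_eq _).1 hk)
  rw [map_sub, map_smul, smul_eq_mul, sub_eq_zero] at this
  rw [this, LinearMap.smul_apply, smul_eq_mul]
  ring

theorem inter_eq_of_isFacet [FiniteDimensional ℝ V] {ρ τ₁ τ₂ : Δ.Cone} (h₁ : ρ.IsFacet τ₁)
    (h₂ : ρ.IsFacet τ₂) (hne : τ₁ ≠ τ₂) : τ₁.inter τ₂ = ρ := by
  symm
  refine eq_of_le_of_dim_le (le_inter h₁.le h₂.le) ?_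
  by_contra! hlt
  have e₁ : τ₁.inter τ₂ = τ₁ := eq_of_le_of_dim_le (inter_le_left _ _) (by
    have := h₁.dim_eq; omega)
  have e₂ : τ₁.inter τ₂ = τ₂ := eq_of_le_of_dim_le (inter_le_right _ _) (by
    have := h₂.dim_eq; omega)
  exact hne (e₁.symm.trans e₂)

theorem lin_inf_lin [FiniteDimensional ℝ V] {ρ τ₁ τ₂ σ : Δ.Cone} (h₁ : ρ.IsFacet τ₁)
    (h₂ : ρ.IsFacet τ₂) (hσ₁ : τ₁ ≤ σ) (hσ₂ : τ₂ ≤ σ) (hne : τ₁ ≠ τ₂) :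
    τ₁.lin ⊓ τ₂.lin = ρ.lin := by
  symm
  refine Submodule.eq_of_le_of_finrank_le (le_inf (lin_mono h₁.le) (lin_mono h₂.le)) ?_
  have hlt : τ₁.lin ⊓ τ₂.lin < τ₁.lin := by
    refine lt_of_le_of_ne inf_le_left fun e => ?_
    have h0 : τ₁.pt ∈ τ₂.lin := by
      have : τ₁.pt ∈ τ₁.lin ⊓ τ₂.lin := by rw [e]; exact τ₁.subset_lin τ₁.pt_mem
      exact this.2
    have h3 : τ₁.pt ∈ (τ₁.inter τ₂).1 :=
      mem_inter.2 ⟨τ₁.pt_mem, mem_of_mem_lin hσ₂ (hσ₁ τ₁.pt_mem) h0⟩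
    rw [inter_eq_of_isFacet h₁ h₂ hne] at h3
    exact h₁.lt.not_ge (pt_mem_iff.1 h3)
  have h1 := Submodule.finrank_lt_finrank_of_lt hlt
  have h2 : Module.finrank ℝ ρ.lin + 1 = Module.finrank ℝ τ₁.lin := h₁.dim_eq
  omega

/-- This holds because `V_τ₁ ∩ V_τ₂ = V_ρ`. It relates the facet forms on the two sides of a
diamond. -/
theorem IsFacetForm.restrict [FiniteDimensional ℝ V] {ρ τ₁ τ₂ σ : Δ.Cone} (h₁ : ρ.IsFacet τ₁)
    (h₂ : ρ.IsFacet τ₂) (hσ₁ : τ₁ ≤ σ) (hσ₂ : τ₂ ≤ σ) (hne : τ₁ ≠ τ₂)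
    {h : Module.Dual ℝ σ.lin} (hh : τ₂.IsFacetForm σ h) :
    ρ.IsFacetForm τ₁ (h ∘ₗ Submodule.inclusion (lin_mono hσ₁)) where
  ker_eq v := by
    refine (hh.ker_eq _).trans ?_
    rw [← lin_inf_lin h₁ h₂ hσ₁ hσ₂ hne]
    exact ⟨fun h => ⟨v.2, h⟩, fun h => h.2⟩
  nonneg v hv := hh.nonneg _ (hσ₁ hv)

/-- There are at most two cones strictly between cones whose dimensions differ by two. -/
theorem eq_or_eq_of_between [FiniteDimensional ℝ V] {ρ σ τ₁ τ₂ τ₃ : Δ.Cone}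
    (hd : ρ.dim + 2 = σ.dim) (hρ₁ : ρ < τ₁) (hρ₂ : ρ < τ₂) (hρ₃ : ρ < τ₃) (hσ₁ : τ₁ < σ)
    (hσ₂ : τ₂ < σ) (hσ₃ : τ₃ < σ) (hne : τ₁ ≠ τ₂) : τ₃ = τ₁ ∨ τ₃ = τ₂ := by
  by_contra! hcon
  obtain ⟨h31, h32⟩ := hcon
  obtain ⟨f₁, g₁⟩ := isFacet_of_between hρ₁ hσ₁ hd
  obtain ⟨f₂, g₂⟩ := isFacet_of_between hρ₂ hσ₂ hd
  obtain ⟨f₃, g₃⟩ := isFacet_of_between hρ₃ hσ₃ hd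
  obtain ⟨h₁, hh₁⟩ := exists_isFacetForm g₁
  obtain ⟨h₂, hh₂⟩ := exists_isFacetForm g₂
  obtain ⟨h₃, hh₃⟩ := exists_isFacetForm g₃
  have hpos : ∀ {τ τ' : Δ.Cone} {h : Module.Dual ℝ σ.lin}, τ'.IsFacetForm σ h → ρ.IsFacet τ →
      ρ.IsFacet τ' → ∀ (hτ : τ < σ), τ' < σ → τ ≠ τ' →
      0 < h ⟨τ.pt, σ.subset_lin (hτ.le τ.pt_mem)⟩ := by
    intro τ τ' h hh f f' hτ hτ' hne
    refine hh.pos (hτ.le τ.pt_mem) fun hmem => ?_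
    have h3 : τ.pt ∈ (τ.inter τ').1 :=
      mem_inter.2 ⟨τ.pt_mem, mem_of_mem_lin hτ'.le (hτ.le τ.pt_mem) hmem⟩
    rw [inter_eq_of_isFacet f f' hne] at h3
    exact f.lt.not_ge (pt_mem_iff.1 h3)
  have p21 := hpos hh₂ f₁ f₂ hσ₁ hσ₂ hne
  have p31 := hpos hh₃ f₁ f₃ hσ₁ hσ₃ h31.symm
  have p12 := hpos hh₁ f₂ f₁ hσ₂ hσ₁ hne.symm
  have p32 := hpos hh₃ f₂ f₃ hσ₂ hσ₃ h32.symm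
  have p13 := hpos hh₁ f₃ f₁ hσ₃ hσ₁ h31
  have p23 := hpos hh₂ f₃ f₂ hσ₃ hσ₂ h32
  set e₁ : σ.lin := ⟨τ₁.pt, σ.subset_lin (hσ₁.le τ₁.pt_mem)⟩
  set e₂ : σ.lin := ⟨τ₂.pt, σ.subset_lin (hσ₂.le τ₂.pt_mem)⟩
  set e₃ : σ.lin := ⟨τ₃.pt, σ.subset_lin (hσ₃.le τ₃.pt_mem)⟩
  have z1 : h₁ e₁ = 0 := (hh₁.ker_eq e₁).2 (τ₁.subset_lin τ₁.pt_mem)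
  have z2 : h₂ e₂ = 0 := (hh₂.ker_eq e₂).2 (τ₂.subset_lin τ₂.pt_mem)
  have z3 : h₃ e₃ = 0 := (hh₃.ker_eq e₃).2 (τ₃.subset_lin τ₃.pt_mem)
  -- Subtracting multiples of `e₁` and `e₂` from `e₃` makes `h₁` and `h₂` vanish, so `v ∈ ρ.lin` and
  -- `h₃ v = 0`. But the multiples are positive, and `h₃` is zero at `e₃` and positive at `e₁` and
  -- `e₂`.
  set v : σ.lin := e₃ - (h₂ e₃ / h₂ e₁) • e₁ - (h₁ e₃ / h₁ e₂) • e₂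
  have hv1 : h₁ v = 0 := by
    simp only [v, map_sub, map_smul, smul_eq_mul, z1, mul_zero, sub_zero,
      div_mul_cancel₀ _ p12.ne', sub_self]
  have hv2 : h₂ v = 0 := by
    simp only [v, map_sub, map_smul, smul_eq_mul, z2, mul_zero,
      div_mul_cancel₀ _ p21.ne', sub_self]
  have hvρ : (v : V) ∈ ρ.lin := by
    rw [← lin_inf_lin f₁ f₂ hσ₁.le hσ₂.le hne]
    exact ⟨(hh₁.ker_eq v).1 hv1, (hh₂.ker_eq v).1 hv2⟩
  have hv3 : h₃ v = 0 := (hh₃.ker_eq v).2 (lin_mono hρ₃.le hvρ)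
  simp only [v, map_sub, map_smul, smul_eq_mul, z3] at hv3
  have q1 := mul_pos (div_pos p23 p21) p31
  have q2 := mul_pos (div_pos p13 p12) p32
  linarith

/-! ### Cones of a refinement inside a cone -/

/-- The restriction of a facet form to a cone of another fan. -/
theorem IsFacetForm.of_le {ρ τ : Δ'.Cone} {σ' σ : Δ.Cone} (hτσ : τ.1 ≤ σ.1)
    (hlin : ρ.lin = σ'.lin) {h : Module.Dual ℝ σ.lin} (hh : σ'.IsFacetForm σ h) :
    ρ.IsFacetForm τ (h ∘ₗ Submodule.inclusion (lin_mono hτσ)) where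
  ker_eq v := by rw [hlin]; exact hh.ker_eq _
  nonneg v hv := hh.nonneg _ (hτσ hv)

end Cone

namespace IsRefinement

open Cone

variable {Δ Δ' : Fan V}

/-- A cone `τ` of the refinement through `v` may stick out of `σ`. It lies in some `σ'` of `Δ`,
where `σ' ∩ σ` is a face of `σ'`, so `τ ∩ σ` is a face of `τ`. -/
theorem exists_mem (href : Δ'.IsRefinement Δ) (σ : Δ.Cone) {v : V} (hv : v ∈ σ.1) :
    ∃ τ : Δ'.Cone, τ.1 ≤ σ.1 ∧ v ∈ τ.1 := by
  have hv' : v ∈ ⋃ τ : Δ'.Cone, (τ.1 : Set V) := by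
    rw [href.support_eq]; exact Set.mem_iUnion.2 ⟨σ, hv⟩
  obtain ⟨τ, hτ⟩ := Set.mem_iUnion.1 hv'
  obtain ⟨σ', hσ'⟩ := href.exists_le τ
  have hface : (τ.1 ⊓ (σ'.1 ⊓ σ.1)).IsFaceOf τ.1 := by
    have := (PointedCone.IsFaceOf.refl τ.1).inf (Δ.inter_face σ'.1 σ'.2 σ.1 σ.2)
    rwa [inf_eq_left.2 hσ'] at this
  exact ⟨τ.ofFace _ hface, inf_le_right.trans inf_le_right, hτ, hσ' hτ, hv⟩

/-- Close to `ρ.pt` there are only cones of the refinement that have `ρ` as a face. -/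
theorem exists_mem_of_pt {ρ : Δ'.Cone} {σ : Δ.Cone} (href : Δ'.IsRefinement Δ) (h : ρ.1 ≤ σ.1)
    {y : V} (hy : y ∈ σ.1) : ∃ ε : ℝ, 0 < ε ∧ ∃ μ : Δ'.Cone, μ.1 ≤ σ.1 ∧ ρ ≤ μ ∧
      ρ.pt + ε • y ∈ μ.1 := by
  obtain ⟨ε, hε, H⟩ := exists_pos_mem_of_add_mem (fun μ : Δ'.Cone => μ.1) (fun μ => μ.fg) ρ.pt y
  obtain ⟨μ, hμ, hm⟩ := href.exists_mem σ
    (add_mem (h ρ.pt_mem) (PointedCone.smul_mem _ hε.le hy))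
  exact ⟨ε, hε, μ, hμ, pt_mem_iff.1 (H μ hm), hm⟩

/-- Each cone of the refinement in `σ` is a face of one in `σ` of the dimension of `σ`. -/
theorem exists_dim_eq [FiniteDimensional ℝ V] (href : Δ'.IsRefinement Δ) {ρ : Δ'.Cone}
    {σ : Δ.Cone} (h : ρ.1 ≤ σ.1) : ∃ τ : Δ'.Cone, ρ ≤ τ ∧ τ.1 ≤ σ.1 ∧ τ.dim = σ.dim := by
  induction hn : σ.dim - ρ.dim using Nat.strong_induction_on generalizing ρ with
  | _ n ih =>
    by_cases hd : ρ.dim = σ.dim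
    · exact ⟨ρ, le_rfl, h, hd⟩
    have hle : ρ.dim ≤ σ.dim := dim_mono h
    obtain ⟨y, hy, hy'⟩ := exists_mem_notMem (σ := σ.1) (S := ρ.lin) fun hle' => by
      have : σ.dim ≤ ρ.dim := Submodule.finrank_mono hle'
      omega
    obtain ⟨ε, hε, μ, hμ, hρμ, hm⟩ := href.exists_mem_of_pt h hy
    have hlt : ρ < μ := lt_of_le_of_ne hρμ fun e => by
      subst e
      refine hy' ?_
      have := Submodule.smul_mem _ ε⁻¹ (sub_mem (ρ.subset_lin hm) (ρ.subset_lin ρ.pt_mem))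
      rwa [add_sub_cancel_left, smul_smul, inv_mul_cancel₀ hε.ne', one_smul] at this
    have := dim_lt hlt
    have : μ.dim ≤ σ.dim := dim_mono hμ
    obtain ⟨τ, h1, h2, h3⟩ := ih (σ.dim - μ.dim) (by omega) hμ rfl
    exact ⟨τ, hρμ.trans h1, h2, h3⟩

/-- Inside `σ`, the cones of the refinement that contain properly a given one of codimension at
least two form a connected set. -/
theorem rel_of_star [FiniteDimensional ℝ V] (href : Δ'.IsRefinement Δ) {ρ : Δ'.Cone} {σ : Δ.Cone}
    (hd : ρ.dim + 2 ≤ σ.dim) (R : Δ'.Cone → Δ'.Cone → Prop) (hR : Equivalence R)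
    (hrel : ∀ μ ν : Δ'.Cone, ρ < μ → μ ≤ ν → ν.1 ≤ σ.1 → R μ ν)
    {τ₁ τ₂ : Δ'.Cone} (h₁ : ρ ≤ τ₁) (h₂ : ρ ≤ τ₂) (hσ₁ : τ₁.1 ≤ σ.1) (hσ₂ : τ₂.1 ≤ σ.1)
    (hd₁ : τ₁.dim = σ.dim) (hd₂ : τ₂.dim = σ.dim) : R τ₁ τ₂ := by
  have hlt₁ : ρ < τ₁ := lt_of_le_of_ne h₁ fun e => by rw [← e] at hd₁; omega
  obtain ⟨y₁, hy₁, hy₁'⟩ := exists_mem_notMem_of_lt hlt₁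
  -- Codimension at least two leaves room for `y₂` outside the span of `ρ` and `y₁`, so the segment
  -- avoids `ρ.lin`. Two cones sharing `ρ.pt` and a segment point then meet in a cone larger than
  -- `ρ`.
  obtain ⟨y₂, hy₂, hy₂'⟩ := exists_mem_notMem (σ := τ₂.1)
    (S := ρ.lin ⊔ Submodule.span ℝ {y₁}) fun hle => by
      have h0 : τ₂.dim ≤ _ := Submodule.finrank_mono hle
      have h1 := finrank_sup_span_le ρ.lin y₁
      have h3 : ρ.dim = Module.finrank ℝ ρ.lin := rfl
      omega
  have hseg : ∀ t : ℝ, y₁ + t • (y₂ - y₁) ∉ ρ.lin := by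
    intro t ht
    by_cases h0 : t = 0
    · rw [h0, zero_smul, add_zero] at ht
      exact hy₁' ht
    · refine hy₂' ?_
      have e : y₂ = t⁻¹ • (y₁ + t • (y₂ - y₁)) + (1 - t⁻¹) • y₁ := by
        rw [smul_add, smul_smul, inv_mul_cancel₀ h0, one_smul]; module
      rw [e]
      exact add_mem (Submodule.mem_sup_left (Submodule.smul_mem _ _ ht))
        (Submodule.mem_sup_right (Submodule.smul_mem _ _ (Submodule.mem_span_singleton_self _)))
  refine rel_of_segment_covered (fun μ : {μ : Δ'.Cone // μ.1 ≤ σ.1} => μ.1.1)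
    (fun μ => μ.1.fg) ρ.pt y₁ y₂ ?_ (fun μ ν => R μ.1 ν.1)
    ⟨fun μ => hR.refl _, fun h => hR.symm h, fun h h' => hR.trans h h'⟩ ?_
    (i := ⟨τ₁, hσ₁⟩) (j := ⟨τ₂, hσ₂⟩) (h₁ ρ.pt_mem) hy₁ (h₂ ρ.pt_mem) hy₂
  · intro ε hε t ht
    have e : y₁ + t • (y₂ - y₁) = (1 - t) • y₁ + t • y₂ := by module
    have hz : ρ.pt + ε • (y₁ + t • (y₂ - y₁)) ∈ σ.1 := by
      rw [e]
      exact add_mem (hσ₁ (h₁ ρ.pt_mem)) (PointedCone.smul_mem _ hε.le (add_mem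
        (PointedCone.smul_mem _ (sub_nonneg.2 ht.2) (hσ₁ hy₁))
        (PointedCone.smul_mem _ ht.1 (hσ₂ hy₂))))
    obtain ⟨μ, hμ, hm⟩ := href.exists_mem σ hz
    exact ⟨⟨μ, hμ⟩, hm⟩
  · rintro ⟨μ, hμ⟩ ⟨ν, hν⟩ hxμ hxν ε hε t ht hzμ hzν
    have hlt : ρ < μ.inter ν := by
      refine lt_of_le_of_ne (le_inter (pt_mem_iff.1 hxμ) (pt_mem_iff.1 hxν)) fun e => hseg t ?_
      have hm : ρ.pt + ε • (y₁ + t • (y₂ - y₁)) ∈ (μ.inter ν).1 := mem_inter.2 ⟨hzμ, hzν⟩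
      rw [← e] at hm
      have := Submodule.smul_mem _ ε⁻¹ (sub_mem (ρ.subset_lin hm) (ρ.subset_lin ρ.pt_mem))
      rwa [add_sub_cancel_left, smul_smul, inv_mul_cancel₀ hε.ne', one_smul] at this
    exact hR.trans (hR.symm (hrel _ _ hlt (inter_le_left μ ν) hμ))
      (hrel _ _ hlt (inter_le_right μ ν) hν)

/-- A cone of codimension one inside `σ` lies in the boundary of `σ` or in two cones of the
refinement of the dimension of `σ`. -/
theorem exists_ne_or_exists_lt [FiniteDimensional ℝ V] (href : Δ'.IsRefinement Δ)
    {ρ τ : Δ'.Cone} {σ : Δ.Cone} (hτσ : τ.1 ≤ σ.1) (hd : τ.dim = σ.dim) (hf : ρ.IsFacet τ) :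
    (∃ τ' : Δ'.Cone, τ' ≠ τ ∧ τ'.1 ≤ σ.1 ∧ τ'.dim = σ.dim ∧ ρ.IsFacet τ') ∨
      ∃ σ' : Δ.Cone, σ' < σ ∧ ρ.1 ≤ σ'.1 := by
  by_cases hex : ∃ τ' : Δ'.Cone, τ' ≠ τ ∧ τ'.1 ≤ σ.1 ∧ τ'.dim = σ.dim ∧ ρ.IsFacet τ'
  · exact Or.inl hex
  right
  push Not at hex
  have hρσ : ρ.1 ≤ σ.1 := le_trans (α := PointedCone ℝ V) hf.le hτσ
  have hlin : τ.lin = σ.lin := lin_eq_of_le_of_dim_eq hτσ hd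
  obtain ⟨h, hh⟩ := exists_isFacetForm hf
  have hx : h ⟨ρ.pt, τ.subset_lin (hf.le ρ.pt_mem)⟩ = 0 :=
    (hh.ker_eq _).2 (ρ.subset_lin ρ.pt_mem)
  -- If `τ` is the only cone in `σ` of full dimension with facet `ρ`, every point of `σ` near `ρ.pt`
  -- lies in `τ`, so the facet form is non-negative on all of `σ`.
  have hnn : ∀ y (hy : y ∈ σ.1), 0 ≤ h ⟨y, hlin ▸ σ.subset_lin hy⟩ := by
    intro y hy
    obtain ⟨ε, hε, μ, hμ, hρμ, hm⟩ := href.exists_mem_of_pt hρσ hy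
    have hmτ : μ ≤ τ := by
      rcases eq_or_lt_of_le hρμ with rfl | hlt
      · exact hf.le
      · have h1 := dim_lt hlt
        have h2 : μ.dim ≤ σ.dim := dim_mono hμ
        have h3 := hf.dim_eq
        by_contra hne
        exact hex μ (fun e => hne e.le) hμ (by omega) ⟨hρμ, by omega⟩
    have h4 := hh.nonneg ⟨ρ.pt + ε • y, τ.subset_lin (hmτ hm)⟩ (hmτ hm)
    have h5 : (⟨ρ.pt + ε • y, τ.subset_lin (hmτ hm)⟩ : τ.lin) =
      ⟨ρ.pt, τ.subset_lin (hf.le ρ.pt_mem)⟩ + ε • ⟨y, hlin ▸ σ.subset_lin hy⟩ := rfl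
    rw [h5, map_add, hx, zero_add, map_smul, smul_eq_mul] at h4
    exact nonneg_of_mul_nonneg_right h4 hε
  -- A form that is non-negative on `σ` cuts out a face by its kernel. It contains `ρ`, and it is
  -- proper because `τ.pt` is not in the kernel.
  have hface : (σ.1 ⊓ PointedCone.ofSubmodule ρ.lin).IsFaceOf σ.1 := by
    refine PointedCone.IsFaceOf.of_mem_of_add_mem_left inf_le_left ?_
    rintro x y hx hy ⟨-, hxy⟩
    refine ⟨hx, ?_⟩
    have h1 := hnn x hx
    have h2 := hnn y hy
    have h3 : h (⟨x, hlin ▸ σ.subset_lin hx⟩ + ⟨y, hlin ▸ σ.subset_lin hy⟩) = 0 :=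
      (hh.ker_eq _).2 hxy
    rw [map_add] at h3
    exact (hh.ker_eq ⟨x, hlin ▸ σ.subset_lin hx⟩).1 (by linarith)
  refine ⟨σ.ofFace _ hface, lt_of_le_of_ne hface.le fun e => ?_,
    fun v hv => ⟨hρσ hv, ρ.subset_lin hv⟩⟩
  have e' : σ.1 ⊓ PointedCone.ofSubmodule ρ.lin = σ.1 := congrArg Subtype.val e
  have : τ.pt ∈ σ.1 ⊓ PointedCone.ofSubmodule ρ.lin := by rw [e']; exact hτσ τ.pt_mem
  exact pt_notMem_lin hf.lt this.2

end IsRefinement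

/-! ### Cones adjacent along a common facet -/

namespace Cone

variable {Δ Δ' : Fan V}

/-- Two cones with a common facet and the same span lie on opposite sides of the facet. -/
theorem IsFacetForm.opposite [FiniteDimensional ℝ V] {ρ τ₁ τ₂ : Δ.Cone} (hf₁ : ρ.IsFacet τ₁)
    (hf₂ : ρ.IsFacet τ₂) (hlin : τ₁.lin = τ₂.lin) (hne : τ₁ ≠ τ₂) {h₁ : Module.Dual ℝ τ₁.lin}
    {h₂ : Module.Dual ℝ τ₂.lin} (hh₁ : ρ.IsFacetForm τ₁ h₁) (hh₂ : ρ.IsFacetForm τ₂ h₂) :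
    ∃ c : ℝ, 0 < c ∧ h₁ = -(c • h₂ ∘ₗ Submodule.inclusion hlin.le) := by
  have p₁ := hh₁.pos τ₁.pt_mem (pt_notMem_lin hf₁.lt)
  have p₂ := hh₂.pos τ₂.pt_mem (pt_notMem_lin hf₂.lt)
  have m₂ : τ₂.pt ∈ τ₁.lin := hlin ▸ τ₂.subset_lin τ₂.pt_mem
  set e₁ : τ₁.lin := ⟨τ₁.pt, τ₁.subset_lin τ₁.pt_mem⟩
  set e₂ : τ₁.lin := ⟨τ₂.pt, m₂⟩
  have hneg : h₁ e₂ < 0 := by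
    rcases lt_trichotomy (h₁ e₂) 0 with hlt | heq | hgt
    · exact hlt
    · exact absurd ((hh₁.ker_eq e₂).1 heq) (pt_notMem_lin hf₂.lt)
    -- If `τ₂.pt` were on the same side, `τ₁.pt` would be congruent to a positive multiple of
    -- `τ₂.pt` modulo `V_ρ`. A point `ρ.pt + ε • τ₁.pt` would then lie in both cones, hence in `ρ`.
    · exfalso
      set s := h₁ e₁ / h₁ e₂
      have hs : 0 < s := div_pos p₁ hgt
      have hv : h₁ (e₁ - s • e₂) = 0 := by
        rw [map_sub, map_smul, smul_eq_mul, div_mul_cancel₀ _ hgt.ne', sub_self]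
      obtain ⟨ε, hε, hm⟩ := ρ.isRelint_pt.exists_add_smul_mem ((hh₁.ker_eq _).1 hv)
      have hm₁ : ρ.pt + ε • τ₁.pt ∈ τ₁.1 :=
        add_mem (hf₁.le ρ.pt_mem) (PointedCone.smul_mem _ hε.le τ₁.pt_mem)
      have hm₂ : ρ.pt + ε • τ₁.pt ∈ τ₂.1 := by
        have := add_mem (hf₂.le hm) (PointedCone.smul_mem _ (mul_pos hε hs).le τ₂.pt_mem)
        convert this using 1
        change _ = ρ.pt + ε • (τ₁.pt - s • τ₂.pt) + (ε * s) • τ₂.pt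
        module
      have hm₃ : ρ.pt + ε • τ₁.pt ∈ (τ₁.inter τ₂).1 := mem_inter.2 ⟨hm₁, hm₂⟩
      rw [inter_eq_of_isFacet hf₁ hf₂ hne] at hm₃
      have := Submodule.smul_mem _ ε⁻¹ (sub_mem (ρ.subset_lin hm₃) (ρ.subset_lin ρ.pt_mem))
      rw [add_sub_cancel_left, smul_smul, inv_mul_cancel₀ hε.ne', one_smul] at this
      exact pt_notMem_lin hf₁.lt this
  set c := -(h₁ e₂) / h₂ (Submodule.inclusion hlin.le e₂)
  refine ⟨c, div_pos (neg_pos.2 hneg) p₂, LinearMap.ext fun v => ?_⟩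
  set q := h₂ (Submodule.inclusion hlin.le e₂)
  have p₂' : 0 < q := p₂
  have hk : h₂ (Submodule.inclusion hlin.le (v - (h₂ (Submodule.inclusion hlin.le v) / q) • e₂))
      = 0 := by
    rw [map_sub, map_sub, map_smul, map_smul, smul_eq_mul, div_mul_cancel₀ _ p₂'.ne', sub_self]
  have := (hh₁.ker_eq (v - (h₂ (Submodule.inclusion hlin.le v) / q) • e₂)).2
    ((hh₂.ker_eq _).1 hk)
  rw [map_sub, map_smul, smul_eq_mul, sub_eq_zero] at this
  rw [this]
  simp only [LinearMap.neg_apply, LinearMap.smul_apply, LinearMap.comp_apply, smul_eq_mul, c]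
  ring

/-- A cone of codimension one in the boundary of `σ` is a facet of only one cone in `σ`. -/
theorem eq_of_isFacet_of_le_boundary [FiniteDimensional ℝ V] {ρ τ₁ τ₂ : Δ'.Cone} {σ' σ : Δ.Cone}
    (hf₁ : ρ.IsFacet τ₁) (hf₂ : ρ.IsFacet τ₂) (hσ₁ : τ₁.1 ≤ σ.1) (hσ₂ : τ₂.1 ≤ σ.1)
    (hd₁ : τ₁.dim = σ.dim) (hd₂ : τ₂.dim = σ.dim) (hσ' : σ' < σ) (hρ : ρ.1 ≤ σ'.1) :
    τ₁ = τ₂ := by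
  by_contra hne
  have h1 : ρ.dim ≤ σ'.dim := dim_mono hρ
  have h2 := dim_lt hσ'
  have h3 := hf₁.dim_eq
  have hlin : ρ.lin = σ'.lin := lin_eq_of_le_of_dim_eq hρ (by omega)
  obtain ⟨h, hh⟩ := exists_isFacetForm (τ := σ') (σ := σ) ⟨hσ'.le, by omega⟩
  have hl : τ₁.lin = τ₂.lin := (lin_eq_of_le_of_dim_eq hσ₁ hd₁).trans
    (lin_eq_of_le_of_dim_eq hσ₂ hd₂).symm
  -- The facet form of `σ'` restricts to facet forms on both cones and is non-negative on both, so
  -- these cannot be on opposite sides.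
  obtain ⟨c, hc, e⟩ := IsFacetForm.opposite hf₁ hf₂ hl hne
    (IsFacetForm.of_le hσ₁ hlin hh) (IsFacetForm.of_le hσ₂ hlin hh)
  have p₁ := (IsFacetForm.of_le hσ₁ hlin hh).pos τ₁.pt_mem (pt_notMem_lin hf₁.lt)
  have := LinearMap.congr_fun e ⟨τ₁.pt, τ₁.subset_lin τ₁.pt_mem⟩
  simp only [LinearMap.neg_apply, LinearMap.smul_apply, LinearMap.comp_apply, smul_eq_mul] at this
  rw [LinearMap.comp_apply] at p₁
  have e' : Submodule.inclusion (lin_mono hσ₂) (Submodule.inclusion hl.le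
    ⟨τ₁.pt, τ₁.subset_lin τ₁.pt_mem⟩) = Submodule.inclusion (lin_mono hσ₁)
    ⟨τ₁.pt, τ₁.subset_lin τ₁.pt_mem⟩ := rfl
  rw [e'] at this
  nlinarith

end Cone

end Fan

/-! ## Polynomial functions -/

namespace Poly

instance isDomain (W : Submodule ℝ V) : IsDomain (Poly W) :=
  inferInstanceAs (IsDomain (SymmetricAlgebra ℝ (Module.Dual ℝ W)))

/-- The algebra homomorphism given by a linear map on linear forms. -/
def lift {W : Submodule ℝ V} {B : Type*} [CommRing B] [Algebra ℝ B]
    (f : Module.Dual ℝ W →ₗ[ℝ] B) : Poly W →ₐ[ℝ] B :=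
  SymmetricAlgebra.lift f

theorem lift_ofForm {W : Submodule ℝ V} {B : Type*} [CommRing B] [Algebra ℝ B]
    (f : Module.Dual ℝ W →ₗ[ℝ] B) (l : Module.Dual ℝ W) : lift f (ofForm l) = f l :=
  SymmetricAlgebra.lift_ι_apply f l

theorem induction {W : Submodule ℝ V} {motive : Poly W → Prop}
    (algebraMap : ∀ r, motive (algebraMap ℝ (Poly W) r)) (ofForm : ∀ l, motive (ofForm l))
    (mul : ∀ a b, motive a → motive b → motive (a * b))
    (add : ∀ a b, motive a → motive b → motive (a + b)) (a : Poly W) : motive a :=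
  SymmetricAlgebra.induction ℝ _ (motive := motive) algebraMap ofForm mul add a

theorem ofForm_ne_zero {W : Submodule ℝ V} {l : Module.Dual ℝ W} (hl : l ≠ 0) :
    ofForm l ≠ 0 := by
  intro h
  refine hl (LinearMap.ext fun v => ?_)
  have := congrArg (lift (Module.Dual.eval ℝ W v)) h
  rwa [lift_ofForm, map_zero] at this

/-- A linear retraction of `W₂` onto `W₁` induces a right inverse. -/
theorem restrict_surjective {W₁ W₂ : Submodule ℝ V} (h : W₁ ≤ W₂) :
    Function.Surjective (restrict h) := by
  obtain ⟨p, hp⟩ := LinearMap.exists_leftInverse_of_injective (Submodule.inclusion h)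
    (LinearMap.ker_eq_bot.2 (Submodule.inclusion_injective h))
  intro a
  refine ⟨lift (ofForm.comp p.dualMap) a, ?_⟩
  have : (restrict h).comp (lift (ofForm.comp p.dualMap)) = AlgHom.id ℝ _ :=
    algHom_ext fun l => by
      rw [AlgHom.comp_apply, lift_ofForm, LinearMap.comp_apply, restrict_ofForm]
      change ofForm (l ∘ₗ (p ∘ₗ Submodule.inclusion h)) = _
      rw [hp]; rfl
  exact DFunLike.congr_fun this a

/-- Let `n` satisfy `h n = 1` and let `p` be the projection to `W₁` along `n`. Pulling back the
restriction by `p` is the identity modulo `h`, as one checks on linear forms: `l - l ∘ p = l(n) h`.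
-/
theorem ofForm_dvd_iff {W₁ W₂ : Submodule ℝ V} (hle : W₁ ≤ W₂) {h : Module.Dual ℝ W₂}
    (hker : ∀ v : W₂, h v = 0 ↔ (v : V) ∈ W₁) (h0 : h ≠ 0) {a : Poly W₂} :
    ofForm h ∣ a ↔ restrict hle a = 0 := by
  have hr : restrict hle (ofForm h) = 0 := by
    rw [restrict_ofForm]
    have : h ∘ₗ Submodule.inclusion hle = 0 := LinearMap.ext fun v => (hker _).2 v.2
    rw [this, map_zero]
  constructor
  · rintro ⟨b, rfl⟩
    rw [map_mul, hr, zero_mul]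
  · intro ha
    obtain ⟨v, hv⟩ : ∃ v, h v ≠ 0 := by
      by_contra! H
      exact h0 (LinearMap.ext H)
    set n : W₂ := (h v)⁻¹ • v
    have hn : h n = 1 := by simp [n, hv]
    let p : W₂ →ₗ[ℝ] W₁ := LinearMap.codRestrict W₁
      (W₂.subtype - (h.smulRight (n : V))) fun u => by
        refine (hker (u - h u • n)).1 ?_
        rw [map_sub, map_smul, hn, smul_eq_mul, mul_one, sub_self]
    have hp : ∀ u : W₂, Submodule.inclusion hle (p u) = u - h u • n := fun u => rfl
    let s : Poly W₁ →ₐ[ℝ] Poly W₂ := lift (ofForm.comp p.dualMap)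
    let q := Ideal.Quotient.mkₐ ℝ (Ideal.span {ofForm h})
    have key : q = q.comp (s.comp (restrict hle)) := algHom_ext fun l => by
      rw [AlgHom.comp_apply, AlgHom.comp_apply, restrict_ofForm, lift_ofForm,
        LinearMap.comp_apply]
      refine (Ideal.Quotient.eq).2 ?_
      rw [← map_sub, Ideal.mem_span_singleton]
      refine ⟨algebraMap ℝ _ (l n), ?_⟩
      rw [mul_comm, ← Algebra.smul_def, ← map_smul]
      congr 1
      refine LinearMap.ext fun u => ?_
      change l u - l (Submodule.inclusion hle (p u)) = l n * h u
      rw [hp, map_sub, map_smul, smul_eq_mul]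
      ring
    have := DFunLike.congr_fun key a
    rw [AlgHom.comp_apply, AlgHom.comp_apply, ha, map_zero, map_zero] at this
    exact Ideal.mem_span_singleton.1 (Ideal.Quotient.eq_zero_iff_mem.1 this)

/-- The ideal generated by the form is the kernel of restriction to `W₁`, whose target is a domain.
-/
theorem prime_ofForm {W₁ W₂ : Submodule ℝ V} (hle : W₁ ≤ W₂) {h : Module.Dual ℝ W₂}
    (hker : ∀ v : W₂, h v = 0 ↔ (v : V) ∈ W₁) (h0 : h ≠ 0) : Prime (ofForm h) := by
  rw [← Ideal.span_singleton_prime (ofForm_ne_zero h0)]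
  have : Ideal.span {ofForm h} = RingHom.ker (restrict hle).toRingHom := by
    ext a
    rw [Ideal.mem_span_singleton, ofForm_dvd_iff hle hker h0, RingHom.mem_ker]
    rfl
  rw [this]
  exact RingHom.ker_isPrime _

/-- The homomorphism `a ↦ ∑ a_k T^k`, where `a_k` is the part of `a` of polynomial degree `k`. -/
def scale (W : Submodule ℝ V) : Poly W →ₐ[ℝ] Polynomial (Poly W) :=
  lift ((LinearMap.mulLeft ℝ (Polynomial.X : Polynomial (Poly W))).comp
    ((IsScalarTower.toAlgHom ℝ (Poly W) (Polynomial (Poly W))).toLinearMap.comp ofForm))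

theorem scale_ofForm {W : Submodule ℝ V} (l : Module.Dual ℝ W) :
    scale W (ofForm l) = Polynomial.X * Polynomial.C (ofForm l) :=
  lift_ofForm _ _

theorem scale_of_mem {W : Submodule ℝ V} {k : ℕ} {a : Poly W}
    (ha : a ∈ (LinearMap.range (ofForm (W := W))) ^ k) :
    scale W a = Polynomial.X ^ k * Polynomial.C a := by
  induction ha using Submodule.pow_induction_on_left' with
  | algebraMap r => rw [AlgHom.commutes, pow_zero, one_mul]; rfl
  | add x y i _ _ hx hy => rw [map_add, hx, hy, Polynomial.C_add, mul_add]
  | mem_mul m hm i x _ hx =>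
    obtain ⟨l, rfl⟩ := hm
    rw [map_mul, hx, scale_ofForm, Polynomial.C_mul, Nat.succ_eq_add_one, pow_succ]
    ring

theorem coeff_scale_mem {W : Submodule ℝ V} (a : Poly W) (k : ℕ) :
    (scale W a).coeff k ∈ (LinearMap.range (ofForm (W := W))) ^ k := by
  induction a using induction generalizing k with
  | algebraMap r =>
    rw [AlgHom.commutes, Polynomial.algebraMap_apply, Polynomial.coeff_C]
    split_ifs with h
    · rw [h, pow_zero]; exact Submodule.mem_one.2 ⟨r, rfl⟩
    · exact zero_mem _
  | ofForm l =>
    rw [scale_ofForm]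
    match k with
    | 0 => rw [Polynomial.mul_coeff_zero, Polynomial.coeff_X_zero, zero_mul]; exact zero_mem _
    | k + 1 =>
      rw [Polynomial.coeff_X_mul, Polynomial.coeff_C]
      split_ifs with h
      · rw [h, zero_add, pow_one]; exact ⟨l, rfl⟩
      · exact zero_mem _
  | mul a b ha hb =>
    rw [map_mul, Polynomial.coeff_mul]
    refine sum_mem fun p hp => ?_
    rw [← Finset.HasAntidiagonal.mem_antidiagonal.1 hp, pow_add]
    exact Submodule.mul_mem_mul (ha _) (hb _)
  | add a b ha hb => rw [map_add, Polynomial.coeff_add]; exact add_mem (ha _) (hb _)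

theorem eval_one_scale {W : Submodule ℝ V} (a : Poly W) : (scale W a).eval 1 = a := by
  induction a using induction with
  | algebraMap r => rw [AlgHom.commutes, Polynomial.algebraMap_apply, Polynomial.eval_C]
  | ofForm l => rw [scale_ofForm, Polynomial.eval_mul, Polynomial.eval_X, one_mul,
      Polynomial.eval_C]
  | mul a b ha hb => rw [map_mul, Polynomial.eval_mul, ha, hb]
  | add a b ha hb => rw [map_add, Polynomial.eval_add, ha, hb]

theorem mem_grade_iff {W : Submodule ℝ V} {q : ℤ} {a : Poly W} :
    a ∈ grade W q ↔ a = 0 ∨ ∃ k : ℕ, 2 * (k : ℤ) = q ∧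
      a ∈ (LinearMap.range (ofForm (W := W))) ^ k := by
  constructor
  · intro h
    by_cases hq : ∃ k : ℕ, 2 * (k : ℤ) = q
    · obtain ⟨k, hk⟩ := hq
      refine Or.inr ⟨k, hk, ?_⟩
      have hle : grade W q ≤ (LinearMap.range (ofForm (W := W))) ^ k := iSup_le fun m => by
        have : (m : ℕ) = k := by have := m.2; omega
        rw [this]
      exact hle h
    · left
      have : IsEmpty {k : ℕ // 2 * (k : ℤ) = q} := ⟨fun k => hq ⟨k, k.2⟩⟩
      have hle : grade W q = ⊥ := iSup_of_empty _
      rw [hle] at h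
      exact (Submodule.mem_bot ℝ).1 h
  · rintro (rfl | ⟨k, hk, h⟩)
    · exact zero_mem _
    · exact le_iSup (fun m : {m : ℕ // 2 * (m : ℤ) = q} =>
        (LinearMap.range (ofForm (W := W))) ^ (m : ℕ)) ⟨k, hk⟩ h

theorem ofForm_mem_grade {W : Submodule ℝ V} (l : Module.Dual ℝ W) : ofForm l ∈ grade W 2 :=
  mem_grade_iff.2 (Or.inr ⟨1, rfl, by rw [pow_one]; exact ⟨l, rfl⟩⟩)

theorem one_mem_grade {W : Submodule ℝ V} : (1 : Poly W) ∈ grade W 0 :=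
  mem_grade_iff.2 (Or.inr ⟨0, rfl, by rw [pow_zero]; exact Submodule.one_le.1 le_rfl⟩)

/-- A factor of a homogeneous element by a homogeneous element is homogeneous. -/
theorem mem_grade_of_mul_mem {W : Submodule ℝ V} {i j : ℤ} {H a : Poly W} (hH : H ∈ grade W i)
    (hH0 : H ≠ 0) (h : H * a ∈ grade W (i + j)) : a ∈ grade W j := by
  by_cases ha0 : a = 0
  · rw [ha0]; exact zero_mem _
  obtain ⟨k, hk, hHk⟩ := (mem_grade_iff.1 hH).resolve_left hH0
  obtain ⟨m, hm, hm'⟩ := (mem_grade_iff.1 h).resolve_left (mul_ne_zero hH0 ha0)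
  -- In polynomials over the domain, `T^k H` times `scale a` is the monomial `T^m H a`. Cancelling
  -- `H` coefficientwise leaves only the coefficient of `T^(m-k)` in `scale a`.
  have e := scale_of_mem hm'
  rw [map_mul, scale_of_mem hHk, mul_assoc] at e
  have hkm : k ≤ m := by
    by_contra! hlt
    have := congrArg (fun p => Polynomial.coeff p m) e
    simp only [Polynomial.coeff_X_pow_mul', if_neg (not_le.2 hlt), le_refl, if_true,
      Nat.sub_self, Polynomial.coeff_C_zero] at this
    exact mul_ne_zero hH0 ha0 this.symm
  have hcoeff : ∀ n, n + k ≠ m → (scale W a).coeff n = 0 := by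
    intro n hn
    have := congrArg (fun p => Polynomial.coeff p (n + k)) e
    simp only [Polynomial.coeff_C_mul, Polynomial.coeff_X_pow_mul',
      Polynomial.coeff_C] at this
    have hz : (if m ≤ n + k then if n + k - m = 0 then H * a else 0 else 0) = 0 := by
      split_ifs with h1 h2
      · omega
      · rfl
      · rfl
    rw [hz, if_pos (Nat.le_add_left k n), Nat.add_sub_cancel] at this
    exact (mul_eq_zero.1 this).resolve_left hH0
  have hs : scale W a = Polynomial.monomial (m - k) ((scale W a).coeff (m - k)) := by
    ext n
    rw [Polynomial.coeff_monomial]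
    split_ifs with h1
    · rw [h1]
    · exact hcoeff n fun h2 => h1 (by omega)
  have hae : a = (scale W a).coeff (m - k) := by
    conv_lhs => rw [← eval_one_scale a, hs]
    rw [Polynomial.eval_monomial, one_pow, mul_one]
  refine mem_grade_iff.2 (Or.inr ⟨m - k, by push_cast [hkm]; omega, ?_⟩)
  have := coeff_scale_mem a (m - k)
  rwa [← hae] at this

end Poly

/-! ## Volume forms -/

section Tensor

variable {M L : Type*} [AddCommGroup M] [Module ℝ M] [AddCommGroup L] [Module ℝ L]

theorem tmul_left_injective {ω : L} (hω : ω ≠ 0) {m m' : M}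
    (h : m ⊗ₜ[ℝ] ω = m' ⊗ₜ[ℝ] ω) : m = m' := by
  obtain ⟨l, hl⟩ : ∃ l : Module.Dual ℝ L, l ω ≠ 0 := by
    by_contra! H
    exact hω ((Module.forall_dual_apply_eq_zero_iff ℝ ω).1 H)
  have := congrArg (fun t => TensorProduct.rid ℝ M (TensorProduct.map LinearMap.id l t)) h
  simp only [TensorProduct.map_tmul, LinearMap.id_apply, TensorProduct.rid_tmul] at this
  exact smul_right_injective M hl this

theorem exists_eq_tmul {ω : L} (hω : ∀ η : L, ∃ c : ℝ, η = c • ω) (t : M ⊗[ℝ] L) :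
    ∃ m : M, t = m ⊗ₜ[ℝ] ω := by
  induction t using TensorProduct.induction_on with
  | zero => exact ⟨0, (TensorProduct.zero_tmul _ _).symm⟩
  | tmul m η =>
    obtain ⟨c, rfl⟩ := hω η
    exact ⟨c • m, by rw [TensorProduct.smul_tmul]⟩
  | add s t hs ht =>
    obtain ⟨m, rfl⟩ := hs
    obtain ⟨m', rfl⟩ := ht
    exact ⟨m + m', by rw [TensorProduct.add_tmul]⟩

end Tensor

namespace Det

/-- A fixed generator of `det W^*`. -/
def gen [FiniteDimensional ℝ V] (W : Submodule ℝ V) : Det W := (Module.finBasis ℝ W).det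

theorem gen_ne_zero [FiniteDimensional ℝ V] (W : Submodule ℝ V) : gen W ≠ 0 :=
    (Module.finBasis ℝ W).det_ne_zero

theorem exists_eq_smul_gen [FiniteDimensional ℝ V] {W : Submodule ℝ V} (ω : Det W) : ∃ c :
    ℝ, ω = c • gen W :=
  ⟨_, ω.eq_smul_basis_det (Module.finBasis ℝ W)⟩

theorem exists_eq_smul [FiniteDimensional ℝ V] {W : Submodule ℝ V} {ω : Det W} (hω : ω ≠ 0)
    (η : Det W) :
    ∃ c : ℝ, η = c • ω := by
  obtain ⟨a, rfl⟩ := exists_eq_smul_gen ω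
  obtain ⟨b, rfl⟩ := exists_eq_smul_gen η
  have ha : a ≠ 0 := fun h => hω (by rw [h, zero_smul])
  exact ⟨b / a, by rw [smul_smul, div_mul_cancel₀ _ ha]⟩

theorem restrict_gen [FiniteDimensional ℝ V] {W₁ W₂ : Submodule ℝ V} (h : W₁ = W₂)
    (hd : Module.finrank ℝ W₁ = Module.finrank ℝ W₂) : restrict h.le hd (gen W₂) = gen W₁ := by
  subst h
  rfl

theorem neg_one_smul {W : Submodule ℝ V} (ω : Det W) : (-1 : ℝ) • ω = -ω := by
  ext v
  simp only [AlternatingMap.smul_apply, AlternatingMap.neg_apply, smul_eq_mul, neg_mul, one_mul]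

theorem smul_neg {W : Submodule ℝ V} (c : ℝ) (ω : Det W) : c • -ω = -(c • ω) := by
  ext v
  simp only [AlternatingMap.smul_apply, AlternatingMap.neg_apply, smul_eq_mul, mul_neg]

theorem contract_apply {W₁ W₂ : Submodule ℝ V} (h : W₁ ≤ W₂)
    (hd : Module.finrank ℝ W₁ + 1 = Module.finrank ℝ W₂) (n : W₂) (ω : Det W₂)
    (v : Fin (Module.finrank ℝ W₁) → W₁) :
    contract h hd n ω v = ω fun i =>
      (Fin.cons n fun j => Submodule.inclusion h (v j) : Fin _ → W₂) (finCongr hd.symm i) :=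
  rfl

theorem contract_add_left {W₁ W₂ : Submodule ℝ V} (h : W₁ ≤ W₂)
    (hd : Module.finrank ℝ W₁ + 1 = Module.finrank ℝ W₂) (n n' : W₂) (ω : Det W₂) :
    contract h hd (n + n') ω = contract h hd n ω + contract h hd n' ω := by
  ext v
  change ((ω.domDomCongr (finCongr hd.symm)).curryLeft (n + n')) _ = _
  rw [map_add]
  rfl

theorem contract_smul_left {W₁ W₂ : Submodule ℝ V} (h : W₁ ≤ W₂)
    (hd : Module.finrank ℝ W₁ + 1 = Module.finrank ℝ W₂) (c : ℝ) (n : W₂) (ω : Det W₂) :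
    contract h hd (c • n) ω = c • contract h hd n ω := by
  ext v
  change ((ω.domDomCongr (finCongr hd.symm)).curryLeft (c • n)) _ = _
  rw [map_smul]
  rfl

theorem contract_eq_zero [FiniteDimensional ℝ V] {W₁ W₂ : Submodule ℝ V} (h : W₁ ≤ W₂)
    (hd : Module.finrank ℝ W₁ + 1 = Module.finrank ℝ W₂) {n : W₂} (hn : (n : V) ∈ W₁)
    (ω : Det W₂) : contract h hd n ω = 0 := by
  ext v
  change (ω.domDomCongr (finCongr hd.symm))
    (Fin.cons n fun j => Submodule.inclusion h (v j)) = 0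
  refine AlternatingMap.map_linearDependent _ _ fun hli => ?_
  have e : (Fin.cons n fun j => Submodule.inclusion h (v j) : Fin _ → W₂) =
      Submodule.inclusion h ∘ (Fin.cons ⟨n, hn⟩ v : Fin _ → W₁) := by
    funext i
    refine Fin.cases ?_ (fun j => ?_) i <;> simp only [Function.comp, Fin.cons_zero, Fin.cons_succ]
    rfl
  rw [e] at hli
  have := (LinearIndependent.of_comp _ hli).fintype_card_le_finrank
  simp at this

/-- The vector `n` followed by a basis of `W₁` is a basis of `W₂`, and a volume form that vanishes
on a basis is zero. -/
theorem contract_ne_zero [FiniteDimensional ℝ V] {W₁ W₂ : Submodule ℝ V} (h : W₁ ≤ W₂)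
    (hd : Module.finrank ℝ W₁ + 1 = Module.finrank ℝ W₂) {n : W₂} (hn : (n : V) ∉ W₁)
    {ω : Det W₂} (hω : ω ≠ 0) : contract h hd n ω ≠ 0 := by
  intro h0
  set b : Module.Basis (Fin (Module.finrank ℝ W₁)) ℝ (W₁.submoduleOf W₂) :=
    (Module.finBasis ℝ W₁).map (Submodule.submoduleOfEquivOfLe h).symm
  have hN : W₁.submoduleOf W₂ < ⊤ := by
    refine lt_of_le_of_ne le_top fun e => hn ?_
    have : n ∈ W₁.submoduleOf W₂ := e ▸ trivial
    exact this
  obtain ⟨l, hl⟩ := exists_dual_ker_eq (W₁.submoduleOf W₂) (by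
    rw [(Submodule.submoduleOfEquivOfLe h).finrank_eq]; exact hd)
  have hln : l n ≠ 0 := fun e => hn (by
    have : n ∈ W₁.submoduleOf W₂ := hl ▸ LinearMap.mem_ker.2 e
    exact this)
  set B := Module.Basis.mkFinCons n b (fun c x hx hc => by
    have hx' : l x = 0 := by rw [← hl] at hx; exact hx
    have := congrArg l hc
    rw [map_add, map_smul, hx', add_zero, map_zero, smul_eq_mul] at this
    exact (mul_eq_zero.1 this).resolve_right hln) (fun z => ⟨-(l z / l n), by
      rw [← hl, LinearMap.mem_ker, map_add, map_smul, smul_eq_mul, neg_mul,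
        div_mul_cancel₀ _ hln, add_neg_cancel]⟩)
  have hB : (ω.domDomCongr (finCongr hd.symm)) B = 0 := by
    have := congrArg (fun η : Det W₁ => η (Module.finBasis ℝ W₁)) h0
    rw [Module.Basis.coe_mkFinCons]
    exact this
  rw [AlternatingMap.map_basis_eq_zero_iff] at hB
  exact hω (by
    ext v
    exact congrArg (fun η => η fun i => v (finCongr hd i)) hB)

theorem contract_eq_smul [FiniteDimensional ℝ V] {W₁ W₂ : Submodule ℝ V} (h : W₁ ≤ W₂)
    (hd : Module.finrank ℝ W₁ + 1 = Module.finrank ℝ W₂) {n n' : W₂} {c : ℝ}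
    (hn : ((n - c • n' : W₂) : V) ∈ W₁) (ω : Det W₂) :
    contract h hd n ω = c • contract h hd n' ω := by
  have e : n = c • n' + (n - c • n') := by abel
  rw [e, contract_add_left, contract_eq_zero h hd hn, add_zero, contract_smul_left]

/-- The two sides differ by a transposition of the first two arguments of `ω`. This sign is why a
transition coefficient `ε` is needed in the restriction maps. -/
theorem contract_contract {W W₁ W₂ W₃ : Submodule ℝ V} (h₁ : W ≤ W₁) (h₂ : W ≤ W₂) (h₁₃ : W₁ ≤ W₃)
    (h₂₃ : W₂ ≤ W₃) (d₁ : Module.finrank ℝ W + 1 = Module.finrank ℝ W₁)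
    (d₂ : Module.finrank ℝ W + 1 = Module.finrank ℝ W₂)
    (d₁₃ : Module.finrank ℝ W₁ + 1 = Module.finrank ℝ W₃)
    (d₂₃ : Module.finrank ℝ W₂ + 1 = Module.finrank ℝ W₃) (n₁ : W₂) (n₂ : W₁) (ω : Det W₃) :
    contract h₁ d₁ n₂ (contract h₁₃ d₁₃ (Submodule.inclusion h₂₃ n₁) ω) =
      -contract h₂ d₂ n₁ (contract h₂₃ d₂₃ (Submodule.inclusion h₁₃ n₂) ω) := by
  ext v
  rw [AlternatingMap.neg_apply]
  simp only [contract_apply]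
  have d : Module.finrank ℝ W₃ = Module.finrank ℝ W + 2 := by omega
  have i0 : (0 : ℕ) < Module.finrank ℝ W₃ := by omega
  have i1 : (1 : ℕ) < Module.finrank ℝ W₃ := by omega
  rw [← ω.map_swap _ (show (⟨0, i0⟩ : Fin _) ≠ ⟨1, i1⟩ by simp)]
  congr 1
  funext i
  obtain ⟨i, hi⟩ := i
  match i with
  | 0 =>
    rw [Function.comp_apply, Equiv.swap_apply_left]
    rfl
  | 1 =>
    rw [Function.comp_apply, Equiv.swap_apply_right]
    rfl
  | i + 2 =>
    rw [Function.comp_apply, Equiv.swap_apply_of_ne_of_ne (by simp) (by simp)]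
    rfl

end Det

section Positive

variable {W : Submodule ℝ V}
  {o : Orientation ℝ W (Fin (Module.finrank ℝ W))}

theorem IsPositive.smul {ω : Det W} (h : IsPositive o ω) {c : ℝ} (hc : 0 < c) :
    IsPositive o (c • ω) := by
  obtain ⟨h0, rfl⟩ := h
  exact ⟨smul_ne_zero hc.ne' h0, (ray_eq_iff _ _).2 (SameRay.sameRay_pos_smul_left ω hc)⟩

theorem IsPositive.exists_eq_smul {ω η : Det W} (h : IsPositive o ω) (h' : IsPositive o η) :
    ∃ c : ℝ, 0 < c ∧ η = c • ω := by
  obtain ⟨h0, rfl⟩ := h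
  obtain ⟨h0', e⟩ := h'
  obtain ⟨c, hc, e⟩ := ((ray_eq_iff _ _).1 e.symm).exists_pos_left h0 h0'
  exact ⟨c, hc, e.symm⟩

theorem IsPositive.not_neg {ω : Det W} (h : IsPositive o ω) : ¬ IsPositive o (-ω) := by
  intro h'
  obtain ⟨c, hc, e⟩ := h.exists_eq_smul h'
  have : (c + 1) • ω = 0 := by rw [add_smul, one_smul, ← e, neg_add_cancel]
  exact (smul_ne_zero (by linarith) h.1) this

theorem isPositive_or_neg [FiniteDimensional ℝ V] {ω : Det W} (h : ω ≠ 0) :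
    IsPositive o ω ∨ IsPositive o (-ω) := by
  induction o using Module.Ray.ind with
  | h η hη =>
    obtain ⟨c, rfl⟩ := Det.exists_eq_smul h η
    have hc : c ≠ 0 := fun e => hη (by rw [e, zero_smul])
    rcases lt_or_gt_of_ne hc with hc | hc
    · refine Or.inr ⟨neg_ne_zero.2 h, (ray_eq_iff _ _).2 ?_⟩
      have e : c • ω = (-c) • (-ω) := by rw [smul_neg, neg_smul, neg_neg]
      rw [e]
      exact SameRay.sameRay_pos_smul_right (-ω) (neg_pos.2 hc)
    · exact Or.inl ⟨h, (ray_eq_iff _ _).2 (SameRay.sameRay_pos_smul_right ω hc)⟩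

theorem IsPositive.eq_of_eq_or_neg {ω η : Det W} (h : IsPositive o ω) (h' : IsPositive o η)
    (e : η = ω ∨ η = -ω) : η = ω :=
  e.resolve_right fun e => h.not_neg (e ▸ h')

end Positive

namespace Fan.Cone.IsFacet

variable {Δ : Fan V} {τ σ : Δ.Cone}

/-- Contraction with a vector, followed by restriction to the span of a facet. -/
def contract (hf : τ.IsFacet σ) (n : σ.lin) : Det σ.lin →ₗ[ℝ] Det τ.lin :=
  Det.contract (Cone.lin_mono hf.le) hf.dim_eq n

theorem contract_smul_left (hf : τ.IsFacet σ) (c : ℝ) (n : σ.lin) (ω : Det σ.lin) :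
    hf.contract (c • n) ω = c • hf.contract n ω :=
  Det.contract_smul_left _ _ c n ω

theorem contract_eq_smul [FiniteDimensional ℝ V] (hf : τ.IsFacet σ) {n n' : σ.lin} {c : ℝ}
    (hn : ((n - c • n' : σ.lin) : V) ∈ τ.lin) (ω : Det σ.lin) :
    hf.contract n ω = c • hf.contract n' ω :=
  Det.contract_eq_smul _ _ hn ω

theorem contract_ne_zero [FiniteDimensional ℝ V] (hf : τ.IsFacet σ) {n : σ.lin}
    (hn : (n : V) ∉ τ.lin) {ω : Det σ.lin} (hω : ω ≠ 0) : hf.contract n ω ≠ 0 :=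
  Det.contract_ne_zero _ _ hn hω

theorem contract_contract {ρ τ₁ τ₂ σ : Δ.Cone} (hf₁ : ρ.IsFacet τ₁) (hf₂ : ρ.IsFacet τ₂)
    (hg₁ : τ₁.IsFacet σ) (hg₂ : τ₂.IsFacet σ) (n₁ : τ₂.lin) (n₂ : τ₁.lin) (ω : Det σ.lin) :
    hf₁.contract n₂ (hg₁.contract (Submodule.inclusion (lin_mono hg₂.le) n₁) ω) =
      -hf₂.contract n₁ (hg₂.contract (Submodule.inclusion (lin_mono hg₁.le) n₂) ω) :=
  Det.contract_contract _ _ _ _ _ _ _ _ n₁ n₂ ω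

end Fan.Cone.IsFacet

/-! ### Positive volume forms and normalized facet forms -/

namespace Fan.Orient

variable {Δ : Fan V}

/-- A positive volume form on the span of a cone, equal up to sign to the fixed one. -/
def vol [FiniteDimensional ℝ V] (o : Δ.Orient) (σ : Δ.Cone) : Det σ.lin :=
  open Classical in
  if IsPositive (o.or σ) (Det.gen σ.lin) then Det.gen σ.lin else -Det.gen σ.lin

theorem vol_eq [FiniteDimensional ℝ V] (o : Δ.Orient) (σ : Δ.Cone) :
    o.vol σ = Det.gen σ.lin ∨ o.vol σ = -Det.gen σ.lin := by
  unfold vol; split_ifs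
  exacts [Or.inl rfl, Or.inr rfl]

theorem vol_isPositive [FiniteDimensional ℝ V] (o : Δ.Orient) (σ : Δ.Cone) : IsPositive (o.or σ)
    (o.vol σ) := by
  unfold vol; split_ifs with h
  · exact h
  · exact (isPositive_or_neg (Det.gen_ne_zero _)).resolve_left h

theorem vol_ne_zero [FiniteDimensional ℝ V] (o : Δ.Orient) (σ : Δ.Cone) : o.vol σ ≠ 0 :=
    (o.vol_isPositive σ).1

theorem exists_eq_smul_vol [FiniteDimensional ℝ V] (o : Δ.Orient) {σ : Δ.Cone} (η : Det σ.lin) :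
    ∃ c : ℝ, η = c • o.vol σ := Det.exists_eq_smul (o.vol_ne_zero σ) η

/-- Compatible orientations have the same normalized volume forms. -/
theorem IsCompatible.restrict_vol [FiniteDimensional ℝ V] {Δ' : Fan V} {o' : Δ'.Orient}
    {o : Δ.Orient}
    (hor : o'.IsCompatible o) {τ : Δ'.Cone} {σ : Δ.Cone} (h : τ.1 ≤ σ.1) (hd : τ.dim = σ.dim) :
    Det.restrict (Cone.lin_mono h) hd (o.vol σ) = o'.vol τ := by
  have hp := hor τ σ h hd _ (o.vol_isPositive σ)
  have hlin := lin_eq_of_le_of_dim_eq h hd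
  -- The generator `Det.gen` depends only on the subspace, so the two forms can differ at most by a
  -- sign, which positivity excludes.
  refine (o'.vol_isPositive τ).eq_of_eq_or_neg hp ?_
  have e : Det.restrict (Cone.lin_mono h) hd (o.vol σ) = Det.gen τ.lin ∨
      Det.restrict (Cone.lin_mono h) hd (o.vol σ) = -Det.gen τ.lin := by
    rcases o.vol_eq σ with e | e <;> rw [e]
    · exact Or.inl (Det.restrict_gen hlin hd)
    · rw [map_neg]; exact Or.inr (congrArg _ (Det.restrict_gen hlin hd))
  change Det.restrict (Cone.lin_mono h) hd (o.vol σ) = _ ∨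
    Det.restrict (Cone.lin_mono h) hd (o.vol σ) = _
  rcases o'.vol_eq τ with e' | e' <;> rw [e']
  · exact e
  · rw [neg_neg]; exact e.symm

theorem sign_eq (o : Δ.Orient) {τ σ : Δ.Cone} (hf : τ.IsFacet σ) (n : σ.lin) :
    o.sign hf n = 1 ∨ o.sign hf n = -1 := by
  unfold sign; split_ifs
  exacts [Or.inl rfl, Or.inr rfl]

theorem sign_smul_contract_isPositive [FiniteDimensional ℝ V] (o : Δ.Orient) {τ σ : Δ.Cone}
    (hf : τ.IsFacet σ)
    {n : σ.lin} (hn : (n : V) ∉ τ.lin) {ω : Det σ.lin} (hω : IsPositive (o.or σ) ω) :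
    IsPositive (o.or τ)
      (o.sign hf n • hf.contract n ω) := by
  unfold sign
  split_ifs with h
  · obtain ⟨ω₀, h₁, h₂⟩ := h
    obtain ⟨c, hc, rfl⟩ := h₁.exists_eq_smul hω
    rw [one_smul, map_smul]
    exact h₂.smul hc
  · rw [Det.neg_one_smul]
    exact (isPositive_or_neg (hf.contract_ne_zero hn hω.1)).resolve_left
      fun h' => h ⟨ω, hω, h'⟩

/-- The facet form `h` is normalized by `vol τ = ± ψ_h (vol σ)`. -/
structure IsNormalForm [FiniteDimensional ℝ V] (o : Δ.Orient) {τ σ : Δ.Cone} (hf : τ.IsFacet σ)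
    (h : Module.Dual ℝ σ.lin) : Prop where
  form : τ.IsFacetForm σ h
  sign_smul : ∀ n : σ.lin, h n = 1 →
    o.sign hf n • hf.contract n (o.vol σ) = o.vol τ

theorem sign_smul_contract_vol [FiniteDimensional ℝ V] (o : Δ.Orient) {τ σ : Δ.Cone}
    (hf : τ.IsFacet σ) {n : σ.lin}
    (hn : (n : V) ∉ τ.lin) {c : ℝ} (hc : 0 < c)
    (h : hf.contract n (o.vol σ) = c • o.vol τ ∨
      hf.contract n (o.vol σ) = -(c • o.vol τ)) :
    o.sign hf n • hf.contract n (o.vol σ) = c • o.vol τ := by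
  refine ((o.vol_isPositive τ).smul hc).eq_of_eq_or_neg
    (o.sign_smul_contract_isPositive hf hn (o.vol_isPositive σ)) ?_
  rcases o.sign_eq hf n with e | e <;> rcases h with h | h <;> rw [e, h]
  · exact Or.inl (one_smul _ _)
  · exact Or.inr (one_smul _ _)
  · exact Or.inr (Det.neg_one_smul _)
  · exact Or.inl ((Det.neg_one_smul _).trans (neg_neg _))

theorem contract_vol_of_sign_smul [FiniteDimensional ℝ V] (o : Δ.Orient) {τ σ : Δ.Cone}
    (hf : τ.IsFacet σ) {n : σ.lin}
    {η : Det τ.lin}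
    (h : o.sign hf n • hf.contract n (o.vol σ) = η) :
    hf.contract n (o.vol σ) = η ∨
      hf.contract n (o.vol σ) = -η := by
  rcases o.sign_eq hf n with e | e <;> rw [e] at h
  · rw [one_smul] at h; exact Or.inl h
  · rw [Det.neg_one_smul] at h; exact Or.inr (by rw [← h, neg_neg])

/-- For a form that is a multiple of a normal one, the sign rule holds up to the factor. -/
theorem IsNormalForm.sign_smul_of_smul [FiniteDimensional ℝ V] {o : Δ.Orient} {τ σ : Δ.Cone}
    {hf : τ.IsFacet σ}
    {h : Module.Dual ℝ σ.lin} (hh : o.IsNormalForm hf h) {c : ℝ} (hc : 0 < c) {n : σ.lin}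
    (hn : (c • h) n = 1) :
    o.sign hf n • hf.contract n (o.vol σ) = c⁻¹ • o.vol τ := by
  have hcn : h (c • n) = 1 := by rw [map_smul]; exact hn
  have hnτ : (n : V) ∉ τ.lin := fun hmem => by
    rw [LinearMap.smul_apply, (hh.form.ker_eq n).2 hmem, smul_zero] at hn
    exact zero_ne_one hn
  refine o.sign_smul_contract_vol hf hnτ (inv_pos.2 hc) ?_
  have e := o.contract_vol_of_sign_smul hf (hh.sign_smul _ hcn)
  rw [Cone.IsFacet.contract_smul_left] at e
  rcases e with e | e
  · left; rw [← e, smul_smul, inv_mul_cancel₀ hc.ne', one_smul]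
  · right; rw [← Det.smul_neg, ← e, smul_smul, inv_mul_cancel₀ hc.ne', one_smul]

theorem exists_apply_eq_one {τ σ : Δ.Cone} (hlt : τ < σ) {h : Module.Dual ℝ σ.lin}
    (hh : τ.IsFacetForm σ h) : ∃ n : σ.lin, h n = 1 := by
  have := hh.pos σ.pt_mem (Cone.pt_notMem_lin hlt)
  exact ⟨(h ⟨σ.pt, σ.subset_lin σ.pt_mem⟩)⁻¹ • ⟨σ.pt, σ.subset_lin σ.pt_mem⟩, by
    rw [map_smul, smul_eq_mul, inv_mul_cancel₀ this.ne']⟩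

/-- Contraction with a vector on which a facet form takes the value one gives `±c • vol τ` with `c >
0`. Multiplying the facet form by `c` divides such vectors by `c`, modulo `V_τ`, and so removes the
constant. -/
theorem exists_isNormalForm [FiniteDimensional ℝ V] (o : Δ.Orient) {τ σ : Δ.Cone}
    (hf : τ.IsFacet σ) :
    ∃ h : Module.Dual ℝ σ.lin, o.IsNormalForm hf h := by
  obtain ⟨h, hh⟩ := Cone.exists_isFacetForm hf
  obtain ⟨n, hn⟩ := exists_apply_eq_one hf.lt hh
  have hnτ : (n : V) ∉ τ.lin := fun hmem => by
    rw [(hh.ker_eq n).2 hmem] at hn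
    exact zero_ne_one hn
  obtain ⟨c, hc, e⟩ := (o.vol_isPositive τ).exists_eq_smul
    (o.sign_smul_contract_isPositive hf hnτ (o.vol_isPositive σ))
  refine ⟨c • h, ⟨fun v => ?_, fun v hv => ?_⟩, fun n' hn' => ?_⟩
  · rw [LinearMap.smul_apply, smul_eq_mul, mul_eq_zero, or_iff_right hc.ne', hh.ker_eq]
  · exact mul_nonneg hc.le (hh.nonneg v hv)
  · have h1 : h n' = c⁻¹ := by
      rw [LinearMap.smul_apply, smul_eq_mul] at hn'
      exact eq_inv_of_mul_eq_one_right hn'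
    have hn'τ : (n' : V) ∉ τ.lin := fun hmem => by
      rw [(hh.ker_eq n').2 hmem] at h1
      exact (inv_pos.2 hc).ne h1
    have h2 := o.sign_smul_contract_vol hf hn'τ one_pos (by
      rw [hf.contract_eq_smul (n' := n) (c := c⁻¹) ((hh.ker_eq _).1 (by
        rw [map_sub, map_smul, hn, h1, smul_eq_mul, mul_one, sub_self]))]
      rcases o.contract_vol_of_sign_smul hf e with e | e <;> rw [e, one_smul]
      · left; rw [smul_smul, inv_mul_cancel₀ hc.ne', one_smul]
      · right; rw [Det.smul_neg, smul_smul, inv_mul_cancel₀ hc.ne', one_smul])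
    rwa [one_smul] at h2

/-- A normal form for a facet. -/
def form [FiniteDimensional ℝ V] (o : Δ.Orient) {τ σ : Δ.Cone} (hf : τ.IsFacet σ) :
    Module.Dual ℝ σ.lin :=
  (o.exists_isNormalForm hf).choose

theorem form_isNormalForm [FiniteDimensional ℝ V] (o : Δ.Orient) {τ σ : Δ.Cone} (hf : τ.IsFacet σ) :
    o.IsNormalForm hf (o.form hf) :=
  (o.exists_isNormalForm hf).choose_spec

theorem form_isFacetForm [FiniteDimensional ℝ V] (o : Δ.Orient) {τ σ : Δ.Cone} (hf : τ.IsFacet σ) :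
    τ.IsFacetForm σ (o.form hf) :=
  (o.form_isNormalForm hf).form

theorem exists_contract_eq [FiniteDimensional ℝ V] (o : Δ.Orient) {τ σ : Δ.Cone} (hf : τ.IsFacet σ)
    {n : σ.lin}
    (hn : o.form hf n = 1) :
    hf.contract n (o.vol σ) = o.vol τ ∨
      hf.contract n (o.vol σ) = -o.vol τ :=
  o.contract_vol_of_sign_smul hf ((o.form_isNormalForm hf).sign_smul n hn)

end Fan.Orient

/-! ## The dual sheaf -/

namespace Fan.Orient

variable {Δ : Fan V} [FiniteDimensional ℝ V]

/-- For the two cones between cones whose dimensions differ by two, the normal forms of the two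
flags have the same product. -/
theorem form_mul_form (o : Δ.Orient) {ρ τ₁ τ₂ σ : Δ.Cone} (hf₁ : ρ.IsFacet τ₁)
    (hf₂ : ρ.IsFacet τ₂) (hg₁ : τ₁.IsFacet σ) (hg₂ : τ₂.IsFacet σ) (hne : τ₁ ≠ τ₂) :
    ∃ b : ℝ, o.form hf₁ = (b • o.form hg₂) ∘ₗ Submodule.inclusion (Cone.lin_mono hg₁.le) ∧
      o.form hf₂ = (b • o.form hg₁) ∘ₗ Submodule.inclusion (Cone.lin_mono hg₂.le) := by
  have h₂₁ := (o.form_isFacetForm hg₂).restrict hf₁ hf₂ hg₁.le hg₂.le hne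
  have h₁₂ := (o.form_isFacetForm hg₁).restrict hf₂ hf₁ hg₂.le hg₁.le hne.symm
  obtain ⟨b, hb, eb⟩ := h₂₁.exists_eq_smul hf₁.lt (o.form_isFacetForm hf₁)
  obtain ⟨a, ha, ea⟩ := h₁₂.exists_eq_smul hf₂.lt (o.form_isFacetForm hf₂)
  obtain ⟨n₂, hn₂⟩ := exists_apply_eq_one hf₁.lt h₂₁
  obtain ⟨n₁, hn₁⟩ := exists_apply_eq_one hf₂.lt h₁₂
  -- Along each flag, the double contraction of `vol σ` is, up to sign, `vol ρ` times the ratio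
  -- between the normal form of the lower facet and the restricted normal form of the other upper
  -- facet.
  have key : ∀ {τ τ' : Δ.Cone} (hf : ρ.IsFacet τ) (hg : τ.IsFacet σ) (hg' : τ'.IsFacet σ)
      (n : τ.lin) (n' : τ'.lin) {c : ℝ} (_ : 0 < c)
      (_ : o.form hf = c • (o.form hg' ∘ₗ Submodule.inclusion (Cone.lin_mono hg.le)))
      (_ : (o.form hg' ∘ₗ Submodule.inclusion (Cone.lin_mono hg.le)) n = 1)
      (_ : (o.form hg ∘ₗ Submodule.inclusion (Cone.lin_mono hg'.le)) n' = 1),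
      hf.contract n (hg.contract (Submodule.inclusion (Cone.lin_mono hg'.le) n') (o.vol σ)) =
        c • o.vol ρ ∨
      hf.contract n (hg.contract (Submodule.inclusion (Cone.lin_mono hg'.le) n') (o.vol σ)) =
        -(c • o.vol ρ) := by
    intro τ τ' hf hg hg' n n' c hc ec hn hn'
    have h1 := o.exists_contract_eq hf (n := c⁻¹ • n) (by
      rw [ec, map_smul, LinearMap.smul_apply, hn, smul_eq_mul, smul_eq_mul, mul_one,
        inv_mul_cancel₀ hc.ne'])
    rw [Cone.IsFacet.contract_smul_left] at h1
    have h2 : hf.contract n (o.vol τ) = c • o.vol ρ ∨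
        hf.contract n (o.vol τ) = -(c • o.vol ρ) := by
      rcases h1 with e | e
      · left; rw [← e, smul_smul, mul_inv_cancel₀ hc.ne', one_smul]
      · right; rw [← Det.smul_neg, ← e, smul_smul, mul_inv_cancel₀ hc.ne', one_smul]
    rcases o.exists_contract_eq hg hn' with e | e <;> rw [e]
    · exact h2
    · rw [map_neg]
      rcases h2 with e | e <;> rw [e]
      · exact Or.inr rfl
      · exact Or.inl (neg_neg _)
  have k₁ := key hf₁ hg₁ hg₂ n₂ n₁ hb eb hn₂ hn₁
  have k₂ := key hf₂ hg₂ hg₁ n₁ n₂ ha ea hn₁ hn₂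
  -- The double contractions of the two flags are negatives of each other. Hence the ratios `a` and
  -- `b` agree up to sign, and both are positive.
  rw [Cone.IsFacet.contract_contract hf₁ hf₂ hg₁ hg₂] at k₁
  have hab : b • o.vol ρ = a • o.vol ρ ∨ b • o.vol ρ = -(a • o.vol ρ) := by
    rcases k₁ with e | e <;> rcases k₂ with e' | e' <;> rw [e'] at e
    · exact Or.inr e.symm
    · rw [neg_neg] at e; exact Or.inl e.symm
    · exact Or.inl (neg_injective e).symm
    · exact Or.inr (neg_injective e).symm
  have hab' : b = a := by
    rcases hab with e | e
    · exact smul_left_injective ℝ (o.vol_ne_zero ρ) e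
    · exfalso
      have : (b + a) • o.vol ρ = 0 := by rw [add_smul, e]; exact neg_add_cancel _
      exact smul_ne_zero (by linarith) (o.vol_ne_zero ρ) this
  subst hab'
  exact ⟨b, eb, ea⟩

end Fan.Orient

/-! ### Restriction of local duals to a facet -/

namespace FanSheaf

open Fan

variable {Δ : Fan V}

/-- Every section over a cone with support on the cone extends to a global section which vanishes
on all cones that do not contain the given one. -/
theorem IsFlabby.exists_section {F : FanSheaf.{u, w} Δ} (hF : F.IsFlabby) {ρ : Δ.Cone}
    {s : F.stalk ρ} (hs : s ∈ F.rel ρ) :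
    ∃ t : ∀ μ : Δ.Cone, F.stalk μ, (∀ {μ ν : Δ.Cone} (h : μ ≤ ν), F.res h (t ν) = t μ) ∧
      t ρ = s ∧ ∀ μ, ¬ ρ ≤ μ → t μ = 0 := by
  classical
  -- On the subfan of the cones not strictly containing `ρ`, the family that is `s` at `ρ` and zero
  -- elsewhere is a section: no cone there other than `ρ` has `ρ` as a face.
  let Λ : LowerSet Δ.Cone := ⟨{μ | ¬ ρ < μ}, fun _ _ h h' h'' => h' (h''.trans_le h)⟩
  have hρ : ρ ∈ Λ := lt_irrefl ρ
  let s' : ∀ μ : Λ, F.stalk μ := Function.update 0 ⟨ρ, hρ⟩ s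
  have hs' : s' ∈ F.sections Λ := by
    intro μ ν h
    by_cases hν : ν = ⟨ρ, hρ⟩
    · subst hν
      simp only [s', Function.update_self]
      by_cases hμ : μ = ⟨ρ, hρ⟩
      · subst hμ
        rw [Function.update_self, F.res_refl]
      · rw [Function.update_of_ne hμ]
        exact hs μ (lt_of_le_of_ne h fun e => hμ (Subtype.ext e))
    · have hμ : μ ≠ ⟨ρ, hρ⟩ := by
        rintro rfl
        exact ν.2 (lt_of_le_of_ne h fun e => hν (Subtype.ext e.symm))
      simp only [s', Function.update_of_ne hν, Function.update_of_ne hμ, Pi.zero_apply, map_zero]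
  obtain ⟨t, ht⟩ := hF Λ ⟨s', hs'⟩
  refine ⟨fun μ => t.1 ⟨μ, trivial⟩, fun {μ ν} h => t.2 ⟨μ, trivial⟩ ⟨ν, trivial⟩ h, ?_, ?_⟩
  · exact (ht ⟨ρ, hρ⟩).trans (Function.update_self ..)
  · intro μ hμ
    have hμΛ : μ ∈ Λ := fun h => hμ h.le
    refine (ht ⟨μ, hμΛ⟩).trans ?_
    exact Function.update_of_ne (fun e => hμ (congrArg Subtype.val e).ge) _ _

variable [FiniteDimensional ℝ V]

theorem IsFlabby.exists_extension {F : FanSheaf.{u, w} Δ} (hF : F.IsFlabby) {τ σ : Δ.Cone}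
    (hf : τ.IsFacet σ) {s : F.stalk τ} (hs : s ∈ F.rel τ) :
    ∃ x : F.stalk σ, F.IsExtension τ x ∧ F.res hf.le x = s := by
  obtain ⟨t, ht, hts, ht0⟩ := hF.exists_section hs
  refine ⟨t σ, fun μ hμ hne => ?_, by rw [ht, hts]⟩
  rw [ht]
  refine ht0 μ fun hle => hne ?_
  have h1 := Cone.dim_lt hμ
  have h2 := hf.dim_eq
  exact (Cone.eq_of_le_of_dim_le hle (by omega)).symm

theorem exists_eq_tmul_vol (F : FanSheaf.{u, w} Δ) (o : Δ.Orient) {σ : Δ.Cone}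
    (c : F.LocDual σ) :
    ∃ f : F.rel σ →ₗ[Poly σ.lin] Poly σ.lin, c = f ⊗ₜ[ℝ] o.vol σ :=
  exists_eq_tmul o.exists_eq_smul_vol c

theorem ext_of_pair (F : FanSheaf.{u, w} Δ) (o : Δ.Orient) {σ : Δ.Cone} {c d : F.LocDual σ}
    (h : ∀ y, F.pair y (AlgHom.id ℝ _) LinearMap.id c =
      F.pair y (AlgHom.id ℝ _) LinearMap.id d) : c = d := by
  obtain ⟨f, rfl⟩ := F.exists_eq_tmul_vol o c
  obtain ⟨g, rfl⟩ := F.exists_eq_tmul_vol o d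
  congr 1
  exact LinearMap.ext fun y => tmul_left_injective (o.vol_ne_zero σ) (h y)

/-- For a multiple `c • o.form hf` of the normal form, contraction of the volume form acquires the
factor `c⁻¹`, which cancels the `c` coming from `f`. So the normal form alone decides, and no sign
remains. -/
theorem isFacetRes_tmul_iff (F : FanSheaf.{u, w} Δ) (o : Δ.Orient) {τ σ : Δ.Cone}
    (hf : τ.IsFacet σ) (f : F.rel σ →ₗ[Poly σ.lin] Poly σ.lin)
    (g : F.rel τ →ₗ[Poly τ.lin] Poly τ.lin) :
    F.IsFacetRes o hf (f ⊗ₜ[ℝ] o.vol σ) (g ⊗ₜ[ℝ] o.vol τ) ↔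
      ∀ (x : F.stalk σ) (hx : F.IsExtension τ x), g ⟨F.res hf.le x, hx.res_mem hf.le⟩ =
        Poly.restrict (Cone.lin_mono hf.le) (f ⟨Poly.ofForm (o.form hf) • x,
          hx.smul_mem (o.form_isFacetForm hf)⟩) := by
  constructor
  · intro H x hx
    obtain ⟨n, hn⟩ := Orient.exists_apply_eq_one hf.lt (o.form_isFacetForm hf)
    have := H _ (o.form_isFacetForm hf) n hn x hx
    rw [pair_tmul, pair_tmul, ← TensorProduct.tmul_smul] at this
    have e := (o.form_isNormalForm hf).sign_smul n hn
    refine tmul_left_injective (o.vol_ne_zero τ) (this.trans ?_)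
    exact congrArg _ e
  · intro H h hh n hn x hx
    obtain ⟨c, hc, rfl⟩ := (o.form_isFacetForm hf).exists_eq_smul hf.lt hh
    rw [pair_tmul, pair_tmul, ← TensorProduct.tmul_smul]
    have e := (o.form_isNormalForm hf).sign_smul_of_smul hc hn
    refine Eq.trans ?_ (congrArg _ e.symm)
    have e' : (⟨Poly.ofForm (c • o.form hf) • x, hx.smul_mem hh⟩ : F.rel σ) =
        algebraMap ℝ (Poly σ.lin) c •
          ⟨Poly.ofForm (o.form hf) • x, hx.smul_mem (o.form_isFacetForm hf)⟩ := by
      refine Subtype.ext ?_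
      change Poly.ofForm (c • o.form hf) • x =
        algebraMap ℝ (Poly σ.lin) c • Poly.ofForm (o.form hf) • x
      rw [map_smul, smul_smul, Algebra.smul_def]
    rw [e', map_smul, smul_eq_mul, map_mul, AlgHom.commutes, ← H x hx, ← Algebra.smul_def,
      TensorProduct.smul_tmul_smul, mul_inv_cancel₀ hc.ne', one_smul]
    rfl

theorem restrict_form (o : Δ.Orient) {τ σ : Δ.Cone} (hf : τ.IsFacet σ) :
    Poly.restrict (Cone.lin_mono hf.le) (Poly.ofForm (o.form hf)) = 0 := by
  rw [Poly.restrict_ofForm]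
  have : o.form hf ∘ₗ Submodule.inclusion (Cone.lin_mono hf.le) = 0 :=
    LinearMap.ext fun v => ((o.form_isFacetForm hf).ker_eq _).2 v.2
  rw [this, map_zero]

/-- Two extensions of the same section differ by some `y` vanishing on `∂σ`, and `f(h y) = h f(y)`
restricts to zero on the facet. -/
theorem exists_isFacetRes {F : FanSheaf.{u, w} Δ} (hF : F.IsFlabby) (o : Δ.Orient)
    {τ σ : Δ.Cone} (hf : τ.IsFacet σ) (c : F.LocDual σ) :
    ∃ d : F.LocDual τ, F.IsFacetRes o hf c d := by
  obtain ⟨f, rfl⟩ := F.exists_eq_tmul_vol o c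
  have hform := o.form_isFacetForm hf
  have hwd : ∀ (x x' : F.stalk σ) (hx : F.IsExtension τ x) (hx' : F.IsExtension τ x'),
      F.res hf.le x = F.res hf.le x' →
      Poly.restrict (Cone.lin_mono hf.le) (f ⟨Poly.ofForm (o.form hf) • x, hx.smul_mem hform⟩) =
      Poly.restrict (Cone.lin_mono hf.le)
        (f ⟨Poly.ofForm (o.form hf) • x', hx'.smul_mem hform⟩) := by
    intro x x' hx hx' e
    have hmem : x - x' ∈ F.rel σ := by
      intro μ hμ
      rw [map_sub, sub_eq_zero]
      by_cases hμτ : μ = τ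
      · subst hμτ; exact e
      · rw [hx μ hμ hμτ, hx' μ hμ hμτ]
    rw [← sub_eq_zero, ← map_sub, ← map_sub]
    have e' : (⟨Poly.ofForm (o.form hf) • x, hx.smul_mem hform⟩ -
        ⟨Poly.ofForm (o.form hf) • x', hx'.smul_mem hform⟩ : F.rel σ) =
        Poly.ofForm (o.form hf) • ⟨x - x', hmem⟩ := Subtype.ext (smul_sub _ _ _).symm
    rw [e', map_smul, smul_eq_mul, map_mul, restrict_form, zero_mul]
  have hex := fun s : F.rel τ => hF.exists_extension hf s.2
  choose x hx hxs using hex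
  let g : F.rel τ →ₗ[Poly τ.lin] Poly τ.lin :=
    { toFun := fun s => Poly.restrict (Cone.lin_mono hf.le)
        (f ⟨Poly.ofForm (o.form hf) • x s, (hx s).smul_mem hform⟩)
      map_add' := fun s s' => by
        have hadd : F.IsExtension τ (x s + x s') := fun μ hμ hne => by
          rw [map_add, hx s μ hμ hne, hx s' μ hμ hne, add_zero]
        rw [hwd _ _ (hx (s + s')) hadd (by rw [hxs, map_add, hxs, hxs]; rfl), ← map_add,
          ← map_add]
        congr 2
        exact Subtype.ext (smul_add _ _ _)
      map_smul' := fun a s => by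
        -- A scalar over `τ` is lifted to one over `σ`, which can then multiply the chosen
        -- extension.
        obtain ⟨a, rfl⟩ := Poly.restrict_surjective (Cone.lin_mono hf.le) a
        have hsm : F.IsExtension τ (a • x s) := fun μ hμ hne => by
          rw [F.res_smul, hx s μ hμ hne, smul_zero]
        rw [hwd _ _ (hx _) hsm (by rw [hxs, F.res_smul, hxs]; rfl), RingHom.id_apply, smul_eq_mul,
          ← map_mul, ← smul_eq_mul, ← map_smul]
        congr 2
        exact Subtype.ext (smul_comm _ _ _) }
  refine ⟨g ⊗ₜ[ℝ] o.vol τ, (F.isFacetRes_tmul_iff o hf f g).2 fun y hy => ?_⟩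
  exact hwd _ _ (hx _) hy (hxs _)

theorem IsFacetRes.unique {F : FanSheaf.{u, w} Δ} (hF : F.IsFlabby) {o : Δ.Orient}
    {τ σ : Δ.Cone} {hf : τ.IsFacet σ} {c : F.LocDual σ} {d d' : F.LocDual τ}
    (h : F.IsFacetRes o hf c d) (h' : F.IsFacetRes o hf c d') : d = d' := by
  refine F.ext_of_pair o fun y => ?_
  obtain ⟨x, hx, hxy⟩ := hF.exists_extension hf y.2
  obtain ⟨n, hn⟩ := Orient.exists_apply_eq_one hf.lt (o.form_isFacetForm hf)
  have e := (h _ (o.form_isFacetForm hf) n hn x hx).trans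
    (h' _ (o.form_isFacetForm hf) n hn x hx).symm
  have e' : (⟨F.res hf.le x, hx.res_mem hf.le⟩ : F.rel τ) = y := Subtype.ext hxy
  rwa [e'] at e

/-- The restriction maps of the two flags between cones whose dimensions differ by two agree. -/
theorem IsFacetRes.diamond {F : FanSheaf.{u, w} Δ} (hF : F.IsFlabby) {o : Δ.Orient}
    {ρ τ₁ τ₂ σ : Δ.Cone} {hf₁ : ρ.IsFacet τ₁} {hf₂ : ρ.IsFacet τ₂} {hg₁ : τ₁.IsFacet σ}
    {hg₂ : τ₂.IsFacet σ} (hne : τ₁ ≠ τ₂) {c : F.LocDual σ} {d₁ : F.LocDual τ₁}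
    {d₂ : F.LocDual τ₂} {e₁ e₂ : F.LocDual ρ} (h₁ : F.IsFacetRes o hg₁ c d₁)
    (h₁' : F.IsFacetRes o hf₁ d₁ e₁) (h₂ : F.IsFacetRes o hg₂ c d₂)
    (h₂' : F.IsFacetRes o hf₂ d₂ e₂) : e₁ = e₂ := by
  obtain ⟨b, eb, ea⟩ := o.form_mul_form hf₁ hf₂ hg₁ hg₂ hne
  obtain ⟨f, rfl⟩ := F.exists_eq_tmul_vol o c
  -- Along the flag through `τ`, the value at `t ρ` is the restriction of `f` applied to the product
  -- of two forms with `t σ`. By `form_mul_form` the product is the same for both flags.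
  have key : ∀ {τ τ' : Δ.Cone} (hf : ρ.IsFacet τ) (hf' : ρ.IsFacet τ') (hg : τ.IsFacet σ)
      (hg' : τ'.IsFacet σ) (_ : τ ≠ τ') {d : F.LocDual τ}
      {k : F.rel ρ →ₗ[Poly ρ.lin] Poly ρ.lin}
      (_ : F.IsFacetRes o hg (f ⊗ₜ[ℝ] o.vol σ) d) (_ : F.IsFacetRes o hf d (k ⊗ₜ[ℝ] o.vol ρ))
      (_ : o.form hf = (b • o.form hg') ∘ₗ Submodule.inclusion (Cone.lin_mono hg.le))
      (t : ∀ μ : Δ.Cone, F.stalk μ) (_ : ∀ {μ ν : Δ.Cone} (h : μ ≤ ν), F.res h (t ν) = t μ)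
      (_ : ∀ μ, ¬ ρ ≤ μ → t μ = 0) (hρ : t ρ ∈ F.rel ρ),
      ∃ hmem : Poly.ofForm (o.form hg) • Poly.ofForm (b • o.form hg') • t σ ∈ F.rel σ,
        k ⟨t ρ, hρ⟩ = Poly.restrict (Cone.lin_mono (hf.le.trans hg.le)) (f ⟨_, hmem⟩) := by
    intro τ τ' hf hf' hg hg' hne d k h h' e t ht ht0 hρ
    obtain ⟨g, rfl⟩ := F.exists_eq_tmul_vol o d
    have hd : ρ.dim + 2 = σ.dim := by have := hf.dim_eq; have := hg.dim_eq; omega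
    -- Among the proper faces of `σ`, the section `t σ` is non-zero at most on `ρ`, `τ` and `τ'`.
    -- The normal form of `τ'` kills the restrictions to `τ'` and to `ρ`.
    have hx : F.IsExtension τ (Poly.ofForm (b • o.form hg') • t σ) := by
      intro μ hμ hμτ
      rw [F.res_smul, ht]
      by_cases hle : ρ ≤ μ
      · have hμτ' : μ ≤ τ' := by
          rcases eq_or_lt_of_le hle with rfl | hlt
          · exact hf'.le
          · exact ((Cone.eq_or_eq_of_between hd hf.lt hf'.lt hlt hg.lt hg'.lt hμ
              hne).resolve_left hμτ).le
        rw [map_smul, map_smul, ← Poly.restrict_trans (Cone.lin_mono hμτ') (Cone.lin_mono hg'.le),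
          restrict_form, map_zero, smul_zero, zero_smul]
      · rw [ht0 μ hle, smul_zero]
    refine ⟨hx.smul_mem (o.form_isFacetForm hg), ?_⟩
    have hy : F.IsExtension ρ (t τ) := by
      intro μ hμ hμρ
      rw [ht]
      refine ht0 μ fun hle => hμρ ?_
      have h1 := Cone.dim_lt hμ
      have h2 := hf.dim_eq
      exact (Cone.eq_of_le_of_dim_le hle (by omega)).symm
    have a1 := (F.isFacetRes_tmul_iff o hg f g).1 h _ hx
    have a2 := (F.isFacetRes_tmul_iff o hf g k).1 h' _ hy
    have b1 : (⟨F.res hf.le (t τ), hy.res_mem hf.le⟩ : F.rel ρ) = ⟨t ρ, hρ⟩ :=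
      Subtype.ext (ht hf.le)
    have b2 : (⟨Poly.ofForm (o.form hf) • t τ, hy.smul_mem (o.form_isFacetForm hf)⟩ : F.rel τ) =
        ⟨F.res hg.le (Poly.ofForm (b • o.form hg') • t σ), hx.res_mem hg.le⟩ := by
      refine Subtype.ext ?_
      change Poly.ofForm (o.form hf) • t τ = F.res hg.le _
      rw [F.res_smul, ht, Poly.restrict_ofForm, e]
    rw [b1, b2, a1, Poly.restrict_trans] at a2
    exact a2
  obtain ⟨k₁, rfl⟩ := F.exists_eq_tmul_vol o e₁
  obtain ⟨k₂, rfl⟩ := F.exists_eq_tmul_vol o e₂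
  congr 1
  refine LinearMap.ext fun s => ?_
  obtain ⟨t, ht, hts, ht0⟩ := hF.exists_section s.2
  have hs : t ρ ∈ F.rel ρ := by rw [hts]; exact s.2
  have es : s = ⟨t ρ, hs⟩ := Subtype.ext hts.symm
  obtain ⟨m₁, r₁⟩ := key hf₁ hf₂ hg₁ hg₂ hne h₁ h₁' eb t ht ht0 hs
  obtain ⟨m₂, r₂⟩ := key hf₂ hf₁ hg₂ hg₁ hne.symm h₂ h₂' ea t ht ht0 hs
  rw [es, r₁, r₂]
  congr 2
  refine Subtype.ext ?_
  change Poly.ofForm (o.form hg₁) • Poly.ofForm (b • o.form hg₂) • t σ =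
    Poly.ofForm (o.form hg₂) • Poly.ofForm (b • o.form hg₁) • t σ
  rw [map_smul, map_smul, smul_smul, smul_smul, mul_smul_comm, mul_smul_comm,
    mul_comm (Poly.ofForm (o.form hg₁))]

end FanSheaf

/-! ### Restriction along flags of facets -/

namespace FanSheaf

open Fan

variable {Δ : Fan V}

/-- `e` is obtained from `c` by restriction along a flag of facets. -/
inductive Reach (F : FanSheaf.{u, w} Δ) (o : Δ.Orient) :
    (σ ρ : Δ.Cone) → F.LocDual σ → F.LocDual ρ → Prop
  | refl (σ : Δ.Cone) (c : F.LocDual σ) : Reach F o σ σ c c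
  | step {σ τ ρ : Δ.Cone} (hf : τ.IsFacet σ) {c : F.LocDual σ} {d : F.LocDual τ}
      {e : F.LocDual ρ} (h : F.IsFacetRes o hf c d) (h' : Reach F o τ ρ d e) : Reach F o σ ρ c e

namespace Reach

variable {F : FanSheaf.{u, w} Δ} {o : Δ.Orient}

theorem le {σ ρ : Δ.Cone} {c : F.LocDual σ} {e : F.LocDual ρ} (h : F.Reach o σ ρ c e) :
    ρ ≤ σ := by
  induction h with
  | refl => exact le_rfl
  | step hf _ _ ih => exact ih.trans hf.le

theorem trans {σ τ ρ : Δ.Cone} {c : F.LocDual σ} {d : F.LocDual τ} {e : F.LocDual ρ}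
    (h : F.Reach o σ τ c d) (h' : F.Reach o τ ρ d e) : F.Reach o σ ρ c e := by
  induction h with
  | refl => exact h'
  | step hf hcd _ ih => exact step hf hcd (ih h')

theorem eq_of_self {σ : Δ.Cone} {c e : F.LocDual σ} (h : F.Reach o σ σ c e) : c = e := by
  cases h with
  | refl => rfl
  | step hf h h' => exact absurd h'.le hf.lt.not_ge

variable [FiniteDimensional ℝ V]

theorem isFacetRes {σ ρ : Δ.Cone} {c : F.LocDual σ} {e : F.LocDual ρ} (h : F.Reach o σ ρ c e)
    (hf : ρ.IsFacet σ) : F.IsFacetRes o hf c e := by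
  cases h with
  | refl => exact absurd hf.lt (lt_irrefl _)
  | @step _ τ _ hf' _ d _ h h' =>
    have e := Cone.eq_of_le_of_dim_le h'.le (by
      have := hf.dim_eq; have := hf'.dim_eq; omega)
    subst e
    rwa [← h'.eq_of_self]

theorem exists_of_le (hF : F.IsFlabby) (o : Δ.Orient) {σ ρ : Δ.Cone} (h : ρ ≤ σ)
    (c : F.LocDual σ) : ∃ e : F.LocDual ρ, F.Reach o σ ρ c e := by
  induction hn : σ.dim using Nat.strong_induction_on generalizing σ with
  | _ n ih =>
    rcases eq_or_lt_of_le h with rfl | hlt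
    · exact ⟨c, refl _ c⟩
    · obtain ⟨τ, hf, hle⟩ := Cone.exists_isFacet hlt
      obtain ⟨d, hd⟩ := exists_isFacetRes hF o hf c
      obtain ⟨e, he⟩ := ih τ.dim (by have := hf.dim_eq; omega) hle d rfl
      exact ⟨e, step hf hd he⟩

/-- Restriction along flags of facets does not depend on the flag. -/
theorem unique (hF : F.IsFlabby) {σ ρ : Δ.Cone} {c : F.LocDual σ} {e e' : F.LocDual ρ}
    (h : F.Reach o σ ρ c e) (h' : F.Reach o σ ρ c e') : e = e' := by
  induction hn : σ.dim - ρ.dim using Nat.strong_induction_on generalizing σ ρ with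
  | _ n ih =>
    cases h with
    | refl => exact h'.eq_of_self
    | @step _ τ₁ _ hg₁ _ d₁ _ h₁ r₁ =>
      cases h' with
      | refl => exact absurd r₁.le hg₁.lt.not_ge
      | @step _ τ₂ _ hg₂ _ d₂ _ h₂ r₂ =>
        have e₁ := hg₁.dim_eq
        have e₂ := hg₂.dim_eq
        have l₁ : ρ.dim ≤ τ₁.dim := Cone.dim_mono r₁.le
        by_cases hne : τ₁ = τ₂
        · subst hne
          obtain rfl := h₁.unique hF h₂
          exact ih (τ₁.dim - ρ.dim) (by omega) r₁ r₂ rfl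
        have hlt : ρ.dim + 2 ≤ σ.dim := by
          by_contra! hlt
          have a₁ : ρ = τ₁ := Cone.eq_of_le_of_dim_le r₁.le (by omega)
          have a₂ : ρ = τ₂ := Cone.eq_of_le_of_dim_le r₂.le (by omega)
          exact hne (a₁.symm.trans a₂)
        rcases eq_or_lt_of_le hlt with hd | hd
        · have f₁ : ρ.IsFacet τ₁ := ⟨r₁.le, by omega⟩
          have f₂ : ρ.IsFacet τ₂ := ⟨r₂.le, by omega⟩
          exact IsFacetRes.diamond hF hne h₁ (r₁.isFacetRes f₁) h₂ (r₂.isFacetRes f₂)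
        -- `S μ` is the set of results on `ρ` of flags through `μ`. By the induction hypothesis it
        -- is the same for comparable cones strictly between `ρ` and `σ`, so by connectivity it is
        -- the same for `τ₁` and `τ₂`.
        · let S : Δ.Cone → Set (F.LocDual ρ) := fun μ =>
            {x | ∃ d, F.Reach o σ μ c d ∧ F.Reach o μ ρ d x}
          have hS : S τ₁ = S τ₂ := by
            refine Cone.rel_of_between (ρ := ρ) (σ := σ) (by omega) (fun μ ν => S μ = S ν)
              ⟨fun _ => rfl, fun h => h.symm, fun h h' => h.trans h'⟩ ?_ r₁.le r₂.le hg₁ hg₂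
            intro μ ν hρμ hμν hνσ
            have c₁ := Cone.dim_lt hρμ
            have c₂ := Cone.dim_lt hνσ
            have c₃ : μ.dim ≤ ν.dim := Cone.dim_mono hμν
            ext x
            constructor
            · rintro ⟨d, hd, hx⟩
              obtain ⟨d', hd'⟩ := exists_of_le hF o hνσ.le c
              obtain ⟨d'', hd''⟩ := exists_of_le hF o hμν d'
              obtain rfl := ih (σ.dim - μ.dim) (by omega) hd (hd'.trans hd'') rfl
              exact ⟨d', hd', hd''.trans hx⟩
            · rintro ⟨d', hd', hx⟩
              obtain ⟨d'', hd''⟩ := exists_of_le hF o hμν d'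
              obtain ⟨x', hx'⟩ := exists_of_le hF o hρμ.le d''
              obtain rfl := ih (ν.dim - ρ.dim) (by omega) hx (hd''.trans hx') rfl
              exact ⟨d'', hd'.trans hd'', hx'⟩
          have hmem : e ∈ S τ₂ := hS ▸ ⟨d₁, step hg₁ h₁ (refl _ _), r₁⟩
          obtain ⟨d, hd₂, hx⟩ := hmem
          obtain rfl := ih (σ.dim - τ₂.dim) (by omega) hd₂ (step hg₂ h₂ (refl _ _)) rfl
          exact ih (τ₂.dim - ρ.dim) (by omega) hx r₂ rfl

end Reach

section FiniteDimensional

variable [FiniteDimensional ℝ V]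

theorem DualStalk.reach {F : FanSheaf.{u, w} Δ} {o : Δ.Orient} {σ : Δ.Cone}
    (ψ : F.DualStalk o σ) {ρ τ : Set.Iic σ} (h : ρ ≤ τ) :
    F.Reach o τ.1 ρ.1 (ψ.1 τ) (ψ.1 ρ) := by
  induction hn : τ.1.dim using Nat.strong_induction_on generalizing τ with
  | _ n ih =>
    rcases eq_or_lt_of_le h with rfl | hlt
    · exact Reach.refl _ _
    · obtain ⟨τ', hf, hle⟩ := Cone.exists_isFacet (show ρ.1 < τ.1 from hlt)
      exact Reach.step hf (ψ.2 ⟨τ', hf.le.trans τ.2⟩ τ hf)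
        (ih τ'.dim (by have := hf.dim_eq; omega) (τ := ⟨τ', hf.le.trans τ.2⟩) hle rfl)

theorem dualTop_injective {F : FanSheaf.{u, w} Δ} (hF : F.IsFlabby) (o : Δ.Orient) (σ : Δ.Cone) :
    Function.Injective (F.dualTop o σ) := by
  intro ψ ψ' h
  refine Subtype.ext (funext fun τ => ?_)
  have h₁ := DualStalk.reach ψ (ρ := τ) (τ := ⟨σ, Set.mem_Iic.2 le_rfl⟩) τ.2
  have h₂ := DualStalk.reach ψ' (ρ := τ) (τ := ⟨σ, Set.mem_Iic.2 le_rfl⟩) τ.2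
  change F.Reach o σ τ.1 (F.dualTop o σ ψ) _ at h₁
  rw [h] at h₁
  exact h₁.unique hF h₂

/-- Restricting `c` along any flag to each face gives a compatible family, because the result does
not depend on the flag. -/
theorem dualTop_surjective {F : FanSheaf.{u, w} Δ} (hF : F.IsFlabby) (o : Δ.Orient)
    (σ : Δ.Cone) : Function.Surjective (F.dualTop o σ) := by
  intro c
  choose ψ hψ using fun τ : Set.Iic σ => Reach.exists_of_le hF o τ.2 c
  refine ⟨⟨ψ, fun ρ τ hf => ?_⟩, ?_⟩
  · obtain ⟨d, hd⟩ := exists_isFacetRes hF o hf (ψ τ)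
    have := (hψ ρ).unique hF ((hψ τ).trans (Reach.step hf hd (Reach.refl _ _)))
    rwa [this]
  · exact (hψ ⟨σ, Set.mem_Iic.2 le_rfl⟩).eq_of_self.symm

/-! ### Gradings -/

/-- Projections onto the homogeneous parts which are compatible with restriction. -/
structure HomogProj (F : FanSheaf.{u, w} Δ) where
  proj : ∀ σ : Δ.Cone, ℤ → F.stalk σ →+ F.stalk σ
  proj_mem : ∀ {σ : Δ.Cone} (j : ℤ) (x : F.stalk σ), proj σ j x ∈ F.gr σ j
  proj_eq : ∀ {σ : Δ.Cone} {j : ℤ} {x : F.stalk σ}, x ∈ F.gr σ j → proj σ j x = x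
  res_proj : ∀ {τ σ : Δ.Cone} (h : τ ≤ σ) (j : ℤ) (x : F.stalk σ),
    F.res h (proj σ j x) = proj τ j (F.res h x)

/-- The projections onto the homogeneous parts of a sheaf of graded modules. -/
def IsGraded.homogProj {F : FanSheaf.{u, w} Δ} (hF : F.IsGraded) : F.HomogProj := by
  classical
  let e := fun σ => AddEquiv.ofBijective (DirectSum.coeAddMonoidHom (F.gr σ)) (hF σ)
  let p : ∀ σ : Δ.Cone, ℤ → F.stalk σ →+ F.stalk σ := fun σ j =>
    (F.gr σ j).subtype.comp ((DFinsupp.evalAddMonoidHom j).comp (e σ).symm.toAddMonoidHom)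
  have hp : ∀ {σ : Δ.Cone} {i : ℤ} (j : ℤ) {x : F.stalk σ}, x ∈ F.gr σ i →
      p σ j x = if i = j then x else 0 := by
    intro σ i j x hx
    have h1 : (e σ).symm x = DirectSum.of (fun i => F.gr σ i) i ⟨x, hx⟩ := by
      rw [AddEquiv.symm_apply_eq]
      exact (DirectSum.coeAddMonoidHom_of (F.gr σ) i ⟨x, hx⟩).symm
    change ((((e σ).symm x : DirectSum ℤ fun i => F.gr σ i) j : F.gr σ j) : F.stalk σ) = _
    rw [h1, DirectSum.of_apply]
    split_ifs with h
    · subst h; rfl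
    · rfl
  exact
    { proj := p
      proj_mem := fun j x => SetLike.coe_mem _
      proj_eq := fun {σ j x} hx => by rw [hp j hx, if_pos rfl]
      res_proj := fun {τ σ} h j x => by
        obtain ⟨y, rfl⟩ := (e σ).surjective x
        induction y using DirectSum.induction_on with
        | zero => simp only [map_zero]
        | of i z =>
          have h1 : (e σ) (DirectSum.of (fun i => F.gr σ i) i z) = z :=
            DirectSum.coeAddMonoidHom_of (F.gr σ) i z
          rw [h1, hp j z.2, hp j (F.res_mem_gr h z.2)]
          split_ifs
          · rfl
          · exact map_zero _
        | add y y' hy hy' => simp only [map_add, hy, hy'] }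

/-- Since `det V_σ^*` is a line, every generator of the homogeneous part can be written with `vol`
as second factor, the scalar being moved into the functional. -/
theorem tmul_vol_mem_locGr_iff (F : FanSheaf.{u, w} Δ) (o : Δ.Orient) {σ : Δ.Cone} {q : ℤ}
    {f : F.rel σ →ₗ[Poly σ.lin] Poly σ.lin} :
    f ⊗ₜ[ℝ] o.vol σ ∈ F.locGr σ q ↔ ∀ (j : ℤ) (x : F.rel σ), (x : F.stalk σ) ∈ F.gr σ j →
      f x ∈ Poly.grade σ.lin (j + (q - 2 * (σ.dim : ℤ))) := by
  constructor
  · intro h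
    suffices H : ∀ t ∈ F.locGr σ q, ∃ g : F.rel σ →ₗ[Poly σ.lin] Poly σ.lin,
        t = g ⊗ₜ[ℝ] o.vol σ ∧ ∀ (j : ℤ) (x : F.rel σ), (x : F.stalk σ) ∈ F.gr σ j →
          g x ∈ Poly.grade σ.lin (j + (q - 2 * (σ.dim : ℤ))) by
      obtain ⟨g, e, hg⟩ := H _ h
      rwa [tmul_left_injective (o.vol_ne_zero σ) e]
    intro t ht
    unfold locGr at ht
    induction ht using AddSubgroup.closure_induction with
    | mem t ht =>
      obtain ⟨g, ω, hg, rfl⟩ := ht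
      obtain ⟨c, rfl⟩ := o.exists_eq_smul_vol ω
      refine ⟨c • g, (TensorProduct.smul_tmul _ _ _).symm, fun j x hx => ?_⟩
      exact Submodule.smul_mem _ c (hg j x hx)
    | zero => exact ⟨0, (TensorProduct.zero_tmul _ _).symm, fun _ _ _ => zero_mem _⟩
    | add s t _ _ hs ht =>
      obtain ⟨g, rfl, hg⟩ := hs
      obtain ⟨g', rfl, hg'⟩ := ht
      exact ⟨g + g', (TensorProduct.add_tmul _ _ _).symm,
        fun j x hx => add_mem (hg j x hx) (hg' j x hx)⟩
    | neg t _ ht =>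
      obtain ⟨g, rfl, hg⟩ := ht
      exact ⟨-g, (TensorProduct.neg_tmul _ _).symm, fun j x hx => neg_mem (hg j x hx)⟩
  · intro h
    exact AddSubgroup.subset_closure ⟨f, o.vol σ, h, rfl⟩

theorem IsFacetRes.mem_locGr {F : FanSheaf.{u, w} Δ} (hF : F.IsFlabby) (P : F.HomogProj)
    {o : Δ.Orient} {τ σ : Δ.Cone} {hf : τ.IsFacet σ} {c : F.LocDual σ} {d : F.LocDual τ}
    (h : F.IsFacetRes o hf c d) {q : ℤ} (hc : c ∈ F.locGr σ q) : d ∈ F.locGr τ q := by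
  obtain ⟨f, rfl⟩ := F.exists_eq_tmul_vol o c
  obtain ⟨g, rfl⟩ := F.exists_eq_tmul_vol o d
  rw [tmul_vol_mem_locGr_iff] at hc ⊢
  rw [isFacetRes_tmul_iff] at h
  intro j s hs
  obtain ⟨x, hx, hxs⟩ := hF.exists_extension hf s.2
  -- An extension of a homogeneous section need not be homogeneous, but its part of degree `j` is,
  -- and it is again an extension of the same section.
  have hy : F.IsExtension τ (P.proj σ j x) := fun μ hμ hne => by
    rw [P.res_proj, hx μ hμ hne, map_zero]
  have e := h _ hy
  have e' : (⟨F.res hf.le (P.proj σ j x), hy.res_mem hf.le⟩ : F.rel τ) = s :=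
    Subtype.ext (by change F.res hf.le (P.proj σ j x) = s; rw [P.res_proj, hxs, P.proj_eq hs])
  rw [e'] at e
  rw [e]
  refine Poly.restrict_mem_grade _ ?_
  -- The degree `2` of the facet form compensates for the drop of `2 dim` from `σ` to `τ`.
  have := hc (2 + j) ⟨_, hy.smul_mem (o.form_isFacetForm hf)⟩
    (F.smul_mem_gr (Poly.ofForm_mem_grade _) (P.proj_mem j x))
  convert this using 1
  have := hf.dim_eq
  congr 1
  omega

theorem Reach.mem_locGr {F : FanSheaf.{u, w} Δ} (hF : F.IsFlabby) (P : F.HomogProj)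
    {o : Δ.Orient} {σ ρ : Δ.Cone} {c : F.LocDual σ} {e : F.LocDual ρ}
    (h : F.Reach o σ ρ c e) {q : ℤ} (hc : c ∈ F.locGr σ q) : e ∈ F.locGr ρ q := by
  induction h with
  | refl => exact hc
  | step hf hcd _ ih => exact ih (hcd.mem_locGr hF P hc)

/-- The restriction maps of the dual of a flabby sheaf of graded modules are well defined. -/
theorem hasDualStalks {F : FanSheaf.{u, w} Δ} (hF : F.IsFlabby) (P : F.HomogProj)
    (o : Δ.Orient) : F.HasDualStalks o := by
  refine fun σ => ⟨⟨dualTop_injective hF o σ, dualTop_surjective hF o σ⟩, fun q ψ =>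
    ⟨fun h => h ⟨σ, Set.mem_Iic.2 le_rfl⟩, fun h τ => ?_⟩⟩
  exact (DualStalk.reach ψ (ρ := τ) (τ := ⟨σ, Set.mem_Iic.2 le_rfl⟩) τ.2).mem_locGr hF P h

end FiniteDimensional

/-! ### The direct image -/

variable {Δ' : Fan V}

/-- A section of the direct image over `Λ` is a section of `F` over the subfan of the cones lying in
some cone of `Λ`. The values do not depend on the chosen cone of `Λ`, since two such cones can be
compared on their intersection. -/
theorem push_flabby {F : FanSheaf.{u, w} Δ'} (hF : F.IsFlabby) : (push Δ F).IsFlabby := by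
  intro Λ s
  let Λ' : LowerSet Δ'.Cone := ⟨{τ | ∃ σ : Λ, τ.1 ≤ σ.1.1},
    fun _ _ h ⟨σ, hσ⟩ => ⟨σ, le_trans (α := PointedCone ℝ V) h hσ⟩⟩
  choose σ hσ using fun τ : Λ' => τ.2
  have hs : ∀ (τ : Δ'.Cone) (σ₁ σ₂ : Λ) (h₁ : τ.1 ≤ σ₁.1.1) (h₂ : τ.1 ≤ σ₂.1.1),
      (s.1 σ₁).1 ⟨τ, h₁⟩ = (s.1 σ₂).1 ⟨τ, h₂⟩ := by
    intro τ σ₁ σ₂ h₁ h₂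
    let σ₃ : Λ := ⟨σ₁.1.inter σ₂.1, Λ.lower (Cone.inter_le_left _ _) σ₁.2⟩
    have h₃ : τ.1 ≤ σ₃.1.1 := fun v hv => ⟨h₁ hv, h₂ hv⟩
    have e₁ := s.2 σ₃ σ₁ (Cone.inter_le_left _ _)
    have e₂ := s.2 σ₃ σ₂ (Cone.inter_le_right _ _)
    exact (congrArg (fun x : (push Δ F).stalk σ₃.1 => x.1 ⟨τ, h₃⟩) e₁).trans
      (congrArg (fun x : (push Δ F).stalk σ₃.1 => x.1 ⟨τ, h₃⟩) e₂).symm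
  obtain ⟨t, ht⟩ := hF Λ' ⟨fun τ => (s.1 (σ τ)).1 ⟨τ, hσ τ⟩, fun ρ τ h => by
    have h₁ : ρ.1.1 ≤ (σ τ).1.1 := le_trans (α := PointedCone ℝ V) h (hσ τ)
    exact ((s.1 (σ τ)).2 ⟨ρ, h₁⟩ ⟨τ, hσ τ⟩ h).trans (hs ρ (σ ρ) (σ τ) (hσ ρ) h₁).symm⟩
  refine ⟨⟨fun τ => ⟨fun ρ => t.1 ⟨ρ, trivial⟩, fun ρ ρ' h => t.2 ⟨ρ, trivial⟩ ⟨ρ', trivial⟩ h⟩,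
    fun _ _ _ => rfl⟩, fun τ => Subtype.ext (funext fun ρ => ?_)⟩
  exact (ht ⟨ρ.1, τ, ρ.2⟩).trans (hs ρ.1 _ τ _ ρ.2)

variable (Δ) in
/-- Projections onto the homogeneous parts of the direct image. -/
def HomogProj.push {F : FanSheaf.{u, w} Δ'} (P : F.HomogProj) :
    (FanSheaf.push Δ F).HomogProj where
  proj σ j :=
    { toFun := fun s => ⟨fun τ => P.proj τ j (s.1 τ), fun ρ τ h => by
        rw [P.res_proj, s.2 ρ τ h]⟩
      map_zero' := Subtype.ext (funext fun τ => map_zero _)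
      map_add' := fun s t => Subtype.ext (funext fun τ => map_add _ _ _) }
  proj_mem j s τ := P.proj_mem j _
  proj_eq hs := Subtype.ext (funext fun τ => P.proj_eq (hs τ))
  res_proj _ _ _ := rfl

end FanSheaf

/-! ## Comparison of duality and direct image -/

theorem Det.restrict_contract {W₁ W₂ U₁ U₂ : Submodule ℝ V} (h₁ : W₁ ≤ U₁) (h₂ : W₂ ≤ U₂)
    (hW : W₁ ≤ W₂) (hU : U₁ ≤ U₂) (d₁ : Module.finrank ℝ W₁ = Module.finrank ℝ U₁)
    (d₂ : Module.finrank ℝ W₂ = Module.finrank ℝ U₂)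
    (dW : Module.finrank ℝ W₁ + 1 = Module.finrank ℝ W₂)
    (dU : Module.finrank ℝ U₁ + 1 = Module.finrank ℝ U₂) (n : W₂) (ω : Det U₂) :
    restrict h₁ d₁ (contract hU dU (Submodule.inclusion h₂ n) ω) =
      contract hW dW n (restrict h₂ d₂ ω) := by
  ext v
  change ω _ = ω _
  congr 1
  funext i
  obtain ⟨i, hi⟩ := i
  match i with
  | 0 => rfl
  | i + 1 => rfl

/-! ### Normal forms of a fan and of its refinement -/

namespace Fan

/-- A nonzero form which is `± a` times and `± b` times another form, with `a, b > 0`. -/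
theorem eq_of_smul_eq_or_neg {W : Submodule ℝ V} {ω η : Det W} (hω : ω ≠ 0) {a b : ℝ}
    (ha : 0 < a) (hb : 0 < b) (h : η = a • ω ∨ η = -(a • ω)) (h' : η = b • ω ∨ η = -(b • ω)) :
    a = b := by
  have key : a • ω = -(b • ω) → False := fun e => by
    have : (a + b) • ω = 0 := by rw [add_smul, e]; exact neg_add_cancel _
    exact smul_ne_zero (by linarith) hω this
  rcases h with h | h <;> rcases h' with h' | h' <;> rw [h] at h'
  · exact smul_left_injective ℝ hω h'
  · exact (key h').elim
  · exact (key ((neg_eq_iff_eq_neg).1 h')).elim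
  · exact smul_left_injective ℝ hω (neg_injective h')

variable {Δ Δ' : Fan V} [FiniteDimensional ℝ V]

theorem Orient.contract_vol_eq (o : Δ.Orient) {τ σ : Δ.Cone} (hf : τ.IsFacet σ) {n : σ.lin}
    {k : ℝ} (hk : k ≠ 0) (hn : o.form hf n = k) :
    hf.contract n (o.vol σ) = k • o.vol τ ∨ hf.contract n (o.vol σ) = -(k • o.vol τ) := by
  have := o.exists_contract_eq hf (n := k⁻¹ • n) (by
    rw [map_smul, hn, smul_eq_mul, inv_mul_cancel₀ hk])
  rw [Cone.IsFacet.contract_smul_left] at this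
  rcases this with e | e
  · left; rw [← e, smul_smul, mul_inv_cancel₀ hk, one_smul]
  · right; rw [← Det.smul_neg, ← e, smul_smul, mul_inv_cancel₀ hk, one_smul]

namespace Orient.IsCompatible

variable {o' : Δ'.Orient} {o : Δ.Orient}

/-- The normal forms of a common facet of two cones of the refinement in `σ`, both of the
dimension of `σ`, are opposite. -/
theorem form_eq_neg (hor : o'.IsCompatible o) {ρ τ₁ τ₂ : Δ'.Cone} {σ : Δ.Cone}
    (hσ₁ : τ₁.1 ≤ σ.1) (hσ₂ : τ₂.1 ≤ σ.1) (hd₁ : τ₁.dim = σ.dim) (hd₂ : τ₂.dim = σ.dim)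
    (hf₁ : ρ.IsFacet τ₁) (hf₂ : ρ.IsFacet τ₂) (hne : τ₁ ≠ τ₂) (hlin : τ₁.lin = τ₂.lin) :
    o'.form hf₁ = -(o'.form hf₂ ∘ₗ Submodule.inclusion hlin.le) := by
  obtain ⟨c, hc, e⟩ := Cone.IsFacetForm.opposite hf₁ hf₂ hlin hne (o'.form_isFacetForm hf₁)
    (o'.form_isFacetForm hf₂)
  obtain ⟨n, hn⟩ := exists_apply_eq_one hf₁.lt (o'.form_isFacetForm hf₁)
  have hn₂ : o'.form hf₂ (Submodule.inclusion hlin.le n) = -c⁻¹ := by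
    rw [e] at hn
    change -(c * o'.form hf₂ (Submodule.inclusion hlin.le n)) = (1 : ℝ) at hn
    rw [← neg_eq_iff_eq_neg]
    exact eq_inv_of_mul_eq_one_right (by rw [mul_neg]; exact hn)
  have hρ : ρ.1 ≤ σ.1 := le_trans (α := PointedCone ℝ V) hf₁.le hσ₁
  have hdρ : Module.finrank ℝ ρ.lin + 1 = Module.finrank ℝ σ.lin := hf₁.dim_eq.trans hd₁
  have a₁ := Det.restrict_contract le_rfl (Cone.lin_mono hσ₁) (Cone.lin_mono hf₁.le)
    (Cone.lin_mono hρ) rfl hd₁ hf₁.dim_eq hdρ n (o.vol σ)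
  have a₂ := Det.restrict_contract le_rfl (Cone.lin_mono hσ₂) (Cone.lin_mono hf₂.le)
    (Cone.lin_mono hρ) rfl hd₂ hf₂.dim_eq hdρ (Submodule.inclusion hlin.le n) (o.vol σ)
  -- By compatibility both volume forms are restrictions of `vol σ`, so contraction with the same
  -- vector gives the same form on `V_ρ`. Comparing its size for `τ₁` and `τ₂` forces `c = 1`.
  have a : hf₁.contract n (o'.vol τ₁) =
      hf₂.contract (Submodule.inclusion hlin.le n) (o'.vol τ₂) := by
    rw [← hor.restrict_vol hσ₁ hd₁, ← hor.restrict_vol hσ₂ hd₂]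
    exact a₁.symm.trans a₂
  have b₁ := o'.contract_vol_eq hf₁ one_ne_zero hn
  have b₂ := o'.contract_vol_eq hf₂ (neg_ne_zero.2 (inv_pos.2 hc).ne') hn₂
  rw [← a] at b₂
  have hc1 : (1 : ℝ) = c⁻¹ := by
    refine eq_of_smul_eq_or_neg (o'.vol_ne_zero ρ) one_pos (inv_pos.2 hc) b₁ ?_
    have e₁ : (-c⁻¹) • o'.vol ρ = -(c⁻¹ • o'.vol ρ) := by
      ext v
      simp only [AlternatingMap.smul_apply, AlternatingMap.neg_apply, smul_eq_mul, neg_mul]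
    rw [e₁, neg_neg] at b₂
    exact b₂.symm
  have hc2 : c = 1 := by rw [← inv_inv c, ← hc1, inv_one]
  rw [e, hc2, one_smul]

/-- The normal form of a facet `σ'` of `σ` restricts to the normal form of a facet in `σ'` of a
cone in `σ`, if the dimensions agree. -/
theorem form_restrict (hor : o'.IsCompatible o) {ρ τ : Δ'.Cone} {σ' σ : Δ.Cone}
    (hρ : ρ.1 ≤ σ'.1) (hτ : τ.1 ≤ σ.1) (hdρ : ρ.dim = σ'.dim) (hdτ : τ.dim = σ.dim)
    (hf : ρ.IsFacet τ) (hg : σ'.IsFacet σ) :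
    o.form hg ∘ₗ Submodule.inclusion (Cone.lin_mono hτ) = o'.form hf := by
  have hform := (o.form_isFacetForm hg).of_le hτ (lin_eq_of_le_of_dim_eq hρ hdρ)
  obtain ⟨c, hc, e⟩ := hform.exists_eq_smul hf.lt (o'.form_isFacetForm hf)
  obtain ⟨n, hn⟩ := exists_apply_eq_one hf.lt (o'.form_isFacetForm hf)
  have hn' : o.form hg (Submodule.inclusion (Cone.lin_mono hτ) n) = c⁻¹ := by
    rw [e] at hn
    exact eq_inv_of_mul_eq_one_right hn
  have a := Det.restrict_contract (Cone.lin_mono hρ) (Cone.lin_mono hτ) (Cone.lin_mono hf.le)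
    (Cone.lin_mono hg.le) hdρ hdτ hf.dim_eq hg.dim_eq n (o.vol σ)
  -- The volume forms of `τ` and `ρ` are the restrictions of those of `σ` and `σ'`, and contraction
  -- commutes with restriction. So the scaling factor `c` must be one.
  have a' : Det.restrict (Cone.lin_mono hρ) hdρ (hg.contract
      (Submodule.inclusion (Cone.lin_mono hτ) n) (o.vol σ)) = hf.contract n (o'.vol τ) := by
    rw [← hor.restrict_vol hτ hdτ]; exact a
  have b := o'.contract_vol_eq hf one_ne_zero hn
  have b' := o.contract_vol_eq hg (inv_pos.2 hc).ne' hn'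
  have hc1 : (1 : ℝ) = c⁻¹ := by
    refine eq_of_smul_eq_or_neg (o'.vol_ne_zero ρ) one_pos (inv_pos.2 hc) b ?_
    rw [← a']
    rcases b' with b' | b' <;> rw [b']
    · left; rw [map_smul, hor.restrict_vol hρ hdρ]
    · right; rw [map_neg, map_smul, hor.restrict_vol hρ hdρ]
  have hc2 : c = 1 := by rw [← inv_inv c, ← hc1, inv_one]
  rw [e, hc2, one_smul]

end Orient.IsCompatible

/-- At most two cones with the same span have a given cone as a facet. -/
theorem Cone.eq_or_eq_of_isFacet {ρ τ₁ τ₂ τ₃ : Δ.Cone} (hf₁ : ρ.IsFacet τ₁) (hf₂ : ρ.IsFacet τ₂)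
    (hf₃ : ρ.IsFacet τ₃) (h₁₂ : τ₁.lin = τ₂.lin) (h₁₃ : τ₁.lin = τ₃.lin) (hne : τ₁ ≠ τ₂) :
    τ₃ = τ₁ ∨ τ₃ = τ₂ := by
  by_contra! hcon
  obtain ⟨h₁, k₁⟩ := exists_isFacetForm hf₁
  obtain ⟨h₂, k₂⟩ := exists_isFacetForm hf₂
  obtain ⟨h₃, k₃⟩ := exists_isFacetForm hf₃
  obtain ⟨a, ha, ea⟩ := k₁.opposite hf₁ hf₂ h₁₂ hne k₂
  obtain ⟨b, hb, eb⟩ := k₁.opposite hf₁ hf₃ h₁₃ hcon.1.symm k₃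
  obtain ⟨c, hc, ec⟩ := k₂.opposite hf₂ hf₃ (h₁₂.symm.trans h₁₃) hcon.2.symm k₃
  -- Three forms cannot be pairwise opposite: evaluated at `τ₁.pt`, the first is positive, so the
  -- other two are both negative there, although they are negative multiples of each other.
  have p := k₁.pos τ₁.pt_mem (pt_notMem_lin hf₁.lt)
  have e₁ := LinearMap.congr_fun ea ⟨τ₁.pt, τ₁.subset_lin τ₁.pt_mem⟩
  have e₂ := LinearMap.congr_fun eb ⟨τ₁.pt, τ₁.subset_lin τ₁.pt_mem⟩
  have e₃ := LinearMap.congr_fun ec (Submodule.inclusion h₁₂.le ⟨τ₁.pt, τ₁.subset_lin τ₁.pt_mem⟩)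
  set x₁ := h₁ ⟨τ₁.pt, τ₁.subset_lin τ₁.pt_mem⟩
  set x₂ := h₂ (Submodule.inclusion h₁₂.le ⟨τ₁.pt, τ₁.subset_lin τ₁.pt_mem⟩)
  set x₃ := h₃ (Submodule.inclusion h₁₃.le ⟨τ₁.pt, τ₁.subset_lin τ₁.pt_mem⟩)
  change x₁ = -(a * x₂) at e₁
  change x₁ = -(b * x₃) at e₂
  change x₂ = -(c * x₃) at e₃
  have hx₂ : x₂ < 0 := by
    by_contra! h
    have := mul_nonneg ha.le h
    linarith
  have hx₃ : x₃ < 0 := by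
    by_contra! h
    have := mul_nonneg hb.le h
    linarith
  have := mul_pos_of_neg_of_neg (neg_lt_zero.2 hc) hx₃
  linarith

end Fan

/-! ### Gluing sections of the direct image from full-dimensional cones -/

namespace FanSheaf

open Fan

variable {Δ Δ' : Fan V}

theorem push_ext {F : FanSheaf.{u, w} Δ'} {σ : Δ.Cone} {x y : (push Δ F).stalk σ}
    (h : ∀ τ : below Δ' σ, x.1 τ = y.1 τ) : x = y :=
  Subtype.ext (funext h)

variable (Δ) in
/-- The section of the direct image given by a global section. -/
def pushOfGlobal (F : FanSheaf.{u, w} Δ') (t : ∀ μ : Δ'.Cone, F.stalk μ)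
    (ht : ∀ {μ ν : Δ'.Cone} (h : μ ≤ ν), F.res h (t ν) = t μ) (σ : Δ.Cone) :
    (push Δ F).stalk σ :=
  ⟨fun μ => t μ, fun _ _ h => ht h⟩

variable [FiniteDimensional ℝ V]

theorem push_ext_of_dim_eq (href : Δ'.IsRefinement Δ) {G : FanSheaf.{u, w} Δ'} {σ : Δ.Cone}
    {x y : (push Δ G).stalk σ} (h : ∀ τ : below Δ' σ, τ.1.dim = σ.dim → x.1 τ = y.1 τ) :
    x = y := by
  refine push_ext fun ρ => ?_
  obtain ⟨τ, h₁, h₂, h₃⟩ := href.exists_dim_eq ρ.2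
  rw [← x.2 ρ ⟨τ, h₂⟩ h₁, ← y.2 ρ ⟨τ, h₂⟩ h₁, h ⟨τ, h₂⟩ h₃]

/-- Elements over the cones in `σ` of the dimension of `σ` define a section over `σ` of the direct
image, if they agree on common facets. -/
theorem exists_push_of_dim_eq (href : Δ'.IsRefinement Δ) (G : FanSheaf.{u, w} Δ') {σ : Δ.Cone}
    (v : ∀ τ : below Δ' σ, τ.1.dim = σ.dim → G.stalk τ)
    (hv : ∀ (ρ : Δ'.Cone) (τ₁ τ₂ : below Δ' σ) (hd₁ : τ₁.1.dim = σ.dim) (hd₂ : τ₂.1.dim = σ.dim)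
      (hf₁ : ρ.IsFacet τ₁.1) (hf₂ : ρ.IsFacet τ₂.1),
      G.res hf₁.le (v τ₁ hd₁) = G.res hf₂.le (v τ₂ hd₂)) :
    ∃ s : (push Δ G).stalk σ, ∀ (τ : below Δ' σ) (hd : τ.1.dim = σ.dim), s.1 τ = v τ hd := by
  -- Agreement on common facets implies agreement on common faces of every codimension, by induction
  -- on the codimension of `ρ` in `σ`.
  have key : ∀ (ρ : Δ'.Cone) (τ₁ τ₂ : below Δ' σ) (hd₁ : τ₁.1.dim = σ.dim)
      (hd₂ : τ₂.1.dim = σ.dim) (h₁ : ρ ≤ τ₁.1) (h₂ : ρ ≤ τ₂.1),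
      G.res h₁ (v τ₁ hd₁) = G.res h₂ (v τ₂ hd₂) := by
    intro ρ
    induction hn : σ.dim - ρ.dim using Nat.strong_induction_on generalizing ρ with
    | _ n ih =>
      intro τ₁ τ₂ hd₁ hd₂ h₁ h₂
      have hle : ρ.dim ≤ τ₁.1.dim := Cone.dim_mono h₁
      rcases Nat.lt_or_ge (ρ.dim + 1) σ.dim with hd | hd
      -- `T μ` is the set of values on `ρ` given by the full-dimensional cones that contain `μ`. By
      -- induction all of these agree on a cone `μ` strictly larger than `ρ`, so `T` is constant on
      -- the connected star of `ρ`.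
      · let T : Δ'.Cone → Set (G.stalk ρ) := fun μ => {y | ∃ (τ : below Δ' σ)
          (hτ : τ.1.dim = σ.dim) (_ : μ ≤ τ.1) (hρ : ρ ≤ τ.1), y = G.res hρ (v τ hτ)}
        have hT : T τ₁.1 = T τ₂.1 := by
          refine href.rel_of_star (ρ := ρ) (σ := σ) (by omega) (fun μ ν => T μ = T ν)
            ⟨fun _ => rfl, fun h => h.symm, fun h h' => h.trans h'⟩ ?_ h₁ h₂ τ₁.2 τ₂.2 hd₁ hd₂
          intro μ ν hρμ hμν hνσ
          have c₁ := Cone.dim_lt hρμ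
          ext y
          constructor
          · rintro ⟨τ, hτ, hμτ, hρτ, rfl⟩
            obtain ⟨τ', a₁, a₂, a₃⟩ := href.exists_dim_eq hνσ
            refine ⟨⟨τ', a₂⟩, a₃, a₁, hρμ.le.trans (hμν.trans a₁), ?_⟩
            have := ih (σ.dim - μ.dim) (by omega) μ rfl τ ⟨τ', a₂⟩ hτ a₃ hμτ (hμν.trans a₁)
            rw [← G.res_trans hρμ.le hμτ, this, G.res_trans]
          · rintro ⟨τ, hτ, hντ, hρτ, rfl⟩
            exact ⟨τ, hτ, hμν.trans hντ, hρτ, rfl⟩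
        have hmem : G.res h₁ (v τ₁ hd₁) ∈ T τ₂.1 := hT ▸ ⟨τ₁, hd₁, le_rfl, h₁, rfl⟩
        obtain ⟨τ, hτ, hle', hρ, e⟩ := hmem
        obtain rfl : τ₂ = τ := Subtype.ext
          (Cone.eq_of_le_of_dim_le hle' (by omega))
        exact e
      · rcases Nat.lt_or_ge ρ.dim σ.dim with hd' | hd'
        · exact hv ρ τ₁ τ₂ hd₁ hd₂ ⟨h₁, by omega⟩ ⟨h₂, by omega⟩
        · have e₁ : ρ = τ₁.1 := Cone.eq_of_le_of_dim_le h₁ (by omega)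
          have e₂ : ρ = τ₂.1 := Cone.eq_of_le_of_dim_le h₂ (by omega)
          obtain rfl : τ₁ = τ₂ := Subtype.ext (e₁.symm.trans e₂)
          rfl
  choose τ h₁ h₂ h₃ using fun ρ : below Δ' σ => href.exists_dim_eq ρ.2
  refine ⟨⟨fun ρ => G.res (h₁ ρ) (v ⟨τ ρ, h₂ ρ⟩ (h₃ ρ)), fun ρ ρ' h => ?_⟩, fun μ hd => ?_⟩
  · rw [G.res_trans]
    exact key ρ ⟨τ ρ', h₂ ρ'⟩ ⟨τ ρ, h₂ ρ⟩ _ _ _ _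
  · exact (key μ ⟨τ μ, h₂ μ⟩ μ (h₃ μ) hd (h₁ μ) le_rfl).trans (G.res_refl _ _)

end FanSheaf

/-! ### Sections with support on a chamber -/

namespace FanSheaf

open Fan

variable {Δ Δ' : Fan V}

/-- The cones of `Δ'` contained in `σ` which have the dimension of `σ`. -/
abbrev Chamber (Δ' : Fan V) (σ : Δ.Cone) : Type u := {τ : below Δ' σ // τ.1.dim = σ.dim}

theorem push_smul_apply (F : FanSheaf.{u, w} Δ') {σ : Δ.Cone} (a : Poly σ.lin)
    (s : (push Δ F).stalk σ) (τ : below Δ' σ) :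
    (a • s).1 τ = Poly.restrict (lin_le_of_below τ) a • s.1 τ :=
  rfl

variable [FiniteDimensional ℝ V]

namespace Chamber

variable {σ : Δ.Cone} (τ : Chamber Δ' σ)

theorem lin_eq : τ.1.1.lin = σ.lin := lin_eq_of_le_of_dim_eq τ.1.2 τ.2

theorem eq_of_le {μ : below Δ' σ} (h : τ.1.1 ≤ μ.1) : τ.1 = μ :=
  Subtype.ext (Cone.eq_of_le_of_dim_le h ((Cone.dim_mono μ.2).trans τ.2.ge))

theorem not_le {σ' : Δ.Cone} (h : σ' < σ) : ¬ τ.1.1.1 ≤ σ'.1 := fun hle => by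
  have h₁ := Cone.dim_mono hle
  have h₂ := Cone.dim_lt h
  have h₃ := τ.2
  omega

instance : Finite (Chamber Δ' σ) :=
  Finite.of_injective (fun τ : Chamber Δ' σ => τ.1.1)
    fun _ _ h => Subtype.ext (Subtype.ext h)

noncomputable instance : Fintype (Chamber Δ' σ) := Fintype.ofFinite _

/-- Polynomial functions on the span of a chamber of `σ` are polynomial functions on `V_σ`. -/
def extend : Poly τ.1.1.lin →ₐ[ℝ] Poly σ.lin := Poly.restrict τ.lin_eq.ge

theorem extend_restrict (a : Poly σ.lin) :
    τ.extend (Poly.restrict (lin_le_of_below τ.1) a) = a :=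
  (Poly.restrict_trans _ _ a).trans (Poly.restrict_refl _ a)

theorem restrict_extend (a : Poly τ.1.1.lin) :
    Poly.restrict (lin_le_of_below τ.1) (τ.extend a) = a :=
  (Poly.restrict_trans _ _ a).trans (Poly.restrict_refl _ a)

/-- Extension by zero of a section with support on a chamber. -/
def single (F : FanSheaf.{u, w} Δ') (y : F.rel τ.1.1) : (push Δ F).rel σ := by
  classical
  refine ⟨⟨Function.update 0 τ.1 y.1, fun μ ν h => ?_⟩, fun σ' h => push_ext fun μ => ?_⟩
  · by_cases hν : ν = τ.1
    · subst hν
      rw [Function.update_self]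
      by_cases hμ : μ = τ.1
      · subst hμ
        rw [Function.update_self, F.res_refl]
      · rw [Function.update_of_ne hμ]
        exact y.2 μ.1 (lt_of_le_of_ne h fun e => hμ (Subtype.ext e))
    · have hμ : μ ≠ τ.1 := fun e => hν (by subst e; exact (τ.eq_of_le h).symm)
      rw [Function.update_of_ne hν, Function.update_of_ne hμ]
      exact map_zero _
  · refine Function.update_of_ne (fun e => τ.not_le h ?_) _ _
    rw [← e]
    exact μ.2

theorem single_self (F : FanSheaf.{u, w} Δ') (y : F.rel τ.1.1) : (τ.single F y).1.1 τ.1 = y.1 :=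
  Function.update_self ..

theorem single_of_ne (F : FanSheaf.{u, w} Δ') (y : F.rel τ.1.1) {μ : below Δ' σ} (h : μ ≠ τ.1) :
    (τ.single F y).1.1 μ = 0 :=
  Function.update_of_ne h _ _

theorem eq_single (F : FanSheaf.{u, w} Δ') {x : (push Δ F).rel σ} {y : F.rel τ.1.1}
    (h : x.1.1 τ.1 = y.1) (h0 : ∀ μ : below Δ' σ, μ ≠ τ.1 → x.1.1 μ = 0) : x = τ.single F y := by
  refine Subtype.ext (push_ext fun μ => ?_)
  by_cases hμ : μ = τ.1
  · subst hμ; exact h.trans (τ.single_self F y).symm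
  · exact (h0 μ hμ).trans (τ.single_of_ne F y hμ).symm

theorem single_add (F : FanSheaf.{u, w} Δ') (y y' : F.rel τ.1.1) :
    τ.single F (y + y') = τ.single F y + τ.single F y' := by
  symm
  refine τ.eq_single F ?_ fun μ hμ => ?_
  · change (τ.single F y).1.1 τ.1 + (τ.single F y').1.1 τ.1 = _
    rw [single_self, single_self]; rfl
  · change (τ.single F y).1.1 μ + (τ.single F y').1.1 μ = _
    rw [single_of_ne _ _ _ hμ, single_of_ne _ _ _ hμ, add_zero]

theorem single_smul (F : FanSheaf.{u, w} Δ') (a : Poly σ.lin) (y : F.rel τ.1.1) :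
    τ.single F (Poly.restrict (lin_le_of_below τ.1) a • y) = a • τ.single F y := by
  symm
  refine τ.eq_single F ?_ fun μ hμ => ?_
  · change Poly.restrict (lin_le_of_below τ.1) a • (τ.single F y).1.1 τ.1 = _
    rw [single_self]; rfl
  · change Poly.restrict (lin_le_of_below μ) a • (τ.single F y).1.1 μ = _
    rw [single_of_ne _ _ _ hμ, smul_zero]

/-- The component at a chamber of a functional on the sections over `σ`. -/
def comp (F : FanSheaf.{u, w} Δ') (f : (push Δ F).rel σ →ₗ[Poly σ.lin] Poly σ.lin) :
    F.rel τ.1.1 →ₗ[Poly τ.1.1.lin] Poly τ.1.1.lin where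
  toFun y := Poly.restrict (lin_le_of_below τ.1) (f (τ.single F y))
  map_add' y y' := by rw [single_add, map_add, map_add]
  map_smul' a y := by
    obtain ⟨a, rfl⟩ := Poly.restrict_surjective (lin_le_of_below τ.1) a
    rw [single_smul, map_smul, smul_eq_mul, map_mul]
    rfl

theorem comp_apply (F : FanSheaf.{u, w} Δ') (f : (push Δ F).rel σ →ₗ[Poly σ.lin] Poly σ.lin)
    (y : F.rel τ.1.1) :
    τ.comp F f y = Poly.restrict (lin_le_of_below τ.1) (f (τ.single F y)) :=
  rfl

theorem extend_comp_apply (F : FanSheaf.{u, w} Δ')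
    (f : (push Δ F).rel σ →ₗ[Poly σ.lin] Poly σ.lin) (y : F.rel τ.1.1) :
    τ.extend (τ.comp F f y) = f (τ.single F y) :=
  τ.extend_restrict _

/-- The elements `c` and `d` take the same values on the sections with support on a chamber. -/
def IsTransfer (F : FanSheaf.{u, w} Δ') (c : (push Δ F).LocDual σ) (d : F.LocDual τ.1.1) : Prop :=
  ∀ y : F.rel τ.1.1, F.pair y (AlgHom.id ℝ _) LinearMap.id d =
    (push Δ F).pair (τ.single F y) (Poly.restrict (lin_le_of_below τ.1))
      (Det.restrict (lin_le_of_below τ.1) τ.2) c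

/-- Compatible orientations make the volume form of `σ` restrict to that of `τ`, so transfer reduces
to taking the component of the functional. -/
theorem isTransfer_tmul_iff (F : FanSheaf.{u, w} Δ') {o' : Δ'.Orient} {o : Δ.Orient}
    (hor : o'.IsCompatible o) (f : (push Δ F).rel σ →ₗ[Poly σ.lin] Poly σ.lin)
    (g : F.rel τ.1.1 →ₗ[Poly τ.1.1.lin] Poly τ.1.1.lin) :
    τ.IsTransfer F (f ⊗ₜ[ℝ] o.vol σ) (g ⊗ₜ[ℝ] o'.vol τ.1.1) ↔ g = τ.comp F f := by
  have e := hor.restrict_vol τ.1.2 τ.2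
  constructor
  · refine fun h => LinearMap.ext fun y => tmul_left_injective (o'.vol_ne_zero τ.1.1) ?_
    refine (h y).trans ?_
    rw [pair_tmul]
    exact congrArg _ e
  · rintro rfl y
    rw [pair_tmul, pair_tmul]
    exact congrArg _ e.symm

theorem exists_isTransfer (F : FanSheaf.{u, w} Δ') {o' : Δ'.Orient} {o : Δ.Orient}
    (hor : o'.IsCompatible o) (c : (push Δ F).LocDual σ) : ∃ d, τ.IsTransfer F c d := by
  obtain ⟨f, rfl⟩ := (push Δ F).exists_eq_tmul_vol o c
  exact ⟨τ.comp F f ⊗ₜ[ℝ] o'.vol τ.1.1, (τ.isTransfer_tmul_iff F hor f _).2 rfl⟩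

variable {τ} in
theorem IsTransfer.unique {F : FanSheaf.{u, w} Δ'} (o' : Δ'.Orient) {c : (push Δ F).LocDual σ}
    {d d' : F.LocDual τ.1.1} (h : τ.IsTransfer F c d) (h' : τ.IsTransfer F c d') : d = d' :=
  F.ext_of_pair o' fun y => (h y).trans (h' y).symm

variable {τ} in
theorem IsTransfer.add {F : FanSheaf.{u, w} Δ'} {c c' : (push Δ F).LocDual σ}
    {d d' : F.LocDual τ.1.1} (h : τ.IsTransfer F c d) (h' : τ.IsTransfer F c' d') :
    τ.IsTransfer F (c + c') (d + d') := fun y => by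
  rw [map_add, map_add, h y, h' y]

variable {τ} in
theorem IsTransfer.smul {F : FanSheaf.{u, w} Δ'} {c : (push Δ F).LocDual σ}
    {d : F.LocDual τ.1.1} (h : τ.IsTransfer F c d) (a : Poly σ.lin) :
    τ.IsTransfer F (a • c) (Poly.restrict (lin_le_of_below τ.1) a • d) := fun y => by
  rw [pair_smul, pair_smul, h y]; rfl

end Chamber

/-- The restrictions to a common facet of two transfers agree. -/
theorem Chamber.IsTransfer.eq_of_isFacetRes {F : FanSheaf.{u, w} Δ'} (hF : F.IsFlabby)
    {o' : Δ'.Orient} {o : Δ.Orient} (hor : o'.IsCompatible o) {σ : Δ.Cone} {τ₁ τ₂ : Chamber Δ' σ}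
    {ρ : Δ'.Cone} {hf₁ : ρ.IsFacet τ₁.1.1} {hf₂ : ρ.IsFacet τ₂.1.1} {c : (push Δ F).LocDual σ}
    {d₁ : F.LocDual τ₁.1.1} {d₂ : F.LocDual τ₂.1.1} {e₁ e₂ : F.LocDual ρ}
    (h₁ : τ₁.IsTransfer F c d₁) (h₂ : τ₂.IsTransfer F c d₂) (r₁ : F.IsFacetRes o' hf₁ d₁ e₁)
    (r₂ : F.IsFacetRes o' hf₂ d₂ e₂) : e₁ = e₂ := by
  by_cases hne : τ₁ = τ₂
  · subst hne
    obtain rfl := h₁.unique o' h₂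
    exact r₁.unique hF r₂
  have hne' : τ₁.1.1 ≠ τ₂.1.1 := fun e => hne (Subtype.ext (Subtype.ext e))
  have hlin : τ₁.1.1.lin = τ₂.1.1.lin := τ₁.lin_eq.trans τ₂.lin_eq.symm
  obtain ⟨f, rfl⟩ := (push Δ F).exists_eq_tmul_vol o c
  obtain ⟨g₁, rfl⟩ := F.exists_eq_tmul_vol o' d₁
  obtain ⟨g₂, rfl⟩ := F.exists_eq_tmul_vol o' d₂
  obtain ⟨k₁, rfl⟩ := F.exists_eq_tmul_vol o' e₁
  obtain ⟨k₂, rfl⟩ := F.exists_eq_tmul_vol o' e₂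
  rw [Chamber.isTransfer_tmul_iff _ F hor] at h₁ h₂
  rw [isFacetRes_tmul_iff] at r₁ r₂
  subst h₁ h₂
  congr 1
  refine LinearMap.ext fun s => ?_
  obtain ⟨t, ht, hts, ht0⟩ := hF.exists_section s.2
  have hρσ : ρ.1 ≤ σ.1 := le_trans (α := PointedCone ℝ V) hf₁.le τ₁.1.2
  have hdρ : ρ.dim + 1 = σ.dim := hf₁.dim_eq.trans τ₁.2
  have ht1 : ∀ μ : below Δ' σ, μ.1 ≠ ρ → μ ≠ τ₁.1 → μ ≠ τ₂.1 → t μ.1 = 0 := by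
    intro μ a b c
    refine ht0 _ fun hle => ?_
    have hlt := Cone.dim_lt (lt_of_le_of_ne hle (Ne.symm a))
    have hle' := Cone.dim_mono μ.2
    have hμd : μ.1.dim = σ.dim := by omega
    rcases Cone.eq_or_eq_of_isFacet hf₁ hf₂ (τ₃ := μ.1) ⟨hle, by omega⟩ hlin
      (τ₁.lin_eq.trans (lin_eq_of_le_of_dim_eq μ.2 hμd).symm) hne' with e | e
    · exact b (Subtype.ext e)
    · exact c (Subtype.ext e)
  have hext : ∀ {τ : Δ'.Cone} (hf : ρ.IsFacet τ), F.IsExtension ρ (t τ) := by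
    intro τ hf μ hμ hne
    rw [ht]
    refine ht0 μ fun hle => hne ?_
    have h1 := Cone.dim_lt hμ
    have h2 := hf.dim_eq
    exact (Cone.eq_of_le_of_dim_le hle (by omega)).symm
  -- The global extension `t` is non-zero only on cones containing `ρ`. None of them lies in `∂σ`,
  -- since a facet in the boundary belongs to only one chamber.
  have hx : pushOfGlobal Δ F t ht σ ∈ (push Δ F).rel σ := by
    intro σ' hσ'
    refine push_ext fun μ => ?_
    change t μ.1 = 0
    refine ht0 _ fun hle => hne' ?_
    exact Cone.eq_of_isFacet_of_le_boundary hf₁ hf₂ τ₁.1.2 τ₂.1.2 τ₁.2 τ₂.2 hσ'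
      (le_trans (α := PointedCone ℝ V) hle μ.2)
  have es : ∀ {τ : Δ'.Cone} (hf : ρ.IsFacet τ),
      (⟨F.res hf.le (t τ), (hext hf).res_mem hf.le⟩ : F.rel ρ) = s :=
    fun hf => Subtype.ext ((ht hf.le).trans hts)
  let y₁ : F.rel τ₁.1.1 := ⟨Poly.ofForm (o'.form hf₁) • t τ₁.1.1,
    (hext hf₁).smul_mem (o'.form_isFacetForm hf₁)⟩
  let y₂ : F.rel τ₂.1.1 := ⟨Poly.ofForm (o'.form hf₂) • t τ₂.1.1,
    (hext hf₂).smul_mem (o'.form_isFacetForm hf₂)⟩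
  -- Extended to `V_σ`, the normal form of `ρ` in `τ₁` restricts on `τ₂` to minus the normal form of
  -- `ρ` in `τ₂`.
  let h : Module.Dual ℝ σ.lin := o'.form hf₁ ∘ₗ Submodule.inclusion τ₁.lin_eq.ge
  have e₁ : h ∘ₗ Submodule.inclusion (lin_le_of_below τ₁.1) = o'.form hf₁ := rfl
  have e₂ : h ∘ₗ Submodule.inclusion (lin_le_of_below τ₂.1) = -o'.form hf₂ := by
    have := hor.form_eq_neg τ₁.1.2 τ₂.1.2 τ₁.2 τ₂.2 hf₁ hf₂ hne' hlin
    refine LinearMap.ext fun v => ?_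
    exact LinearMap.congr_fun this (Submodule.inclusion hlin.ge v)
  have hh0 : h ∘ₗ Submodule.inclusion (Cone.lin_mono hρσ) = 0 :=
    LinearMap.ext fun v => ((o'.form_isFacetForm hf₁).ker_eq _).2 v.2
  -- The section `x` given by `t` is non-zero at most on `ρ`, `τ₁` and `τ₂`, and `h` vanishes on
  -- `ρ`. Hence `h x` splits into its parts on the two chambers.
  have hsum : Poly.ofForm h • (⟨_, hx⟩ : (push Δ F).rel σ) =
      τ₁.single F y₁ - τ₂.single F y₂ := by
    refine Subtype.ext (push_ext fun μ => ?_)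
    change Poly.restrict (lin_le_of_below μ) (Poly.ofForm h) • t μ.1 =
      (τ₁.single F y₁).1.1 μ - (τ₂.single F y₂).1.1 μ
    rw [Poly.restrict_ofForm]
    by_cases m₁ : μ = τ₁.1
    · subst m₁
      rw [e₁, τ₁.single_self, τ₂.single_of_ne F y₂ (fun e => hne (Subtype.ext e)), sub_zero]
    by_cases m₂ : μ = τ₂.1
    · subst m₂
      rw [e₂, τ₂.single_self, τ₁.single_of_ne F y₁ m₁, zero_sub, map_neg, neg_smul]
    rw [τ₁.single_of_ne F y₁ m₁, τ₂.single_of_ne F y₂ m₂, sub_zero]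
    by_cases m₃ : μ.1 = ρ
    · obtain ⟨μ, hμ⟩ := μ
      subst m₃
      rw [hh0, map_zero, zero_smul]
    · rw [ht1 μ m₃ m₁ m₂, smul_zero]
  have a₁ := r₁ _ (hext hf₁)
  have a₂ := r₂ _ (hext hf₂)
  rw [es hf₁, Chamber.comp_apply, Poly.restrict_trans] at a₁
  rw [es hf₂, Chamber.comp_apply, Poly.restrict_trans] at a₂
  rw [a₁, a₂, ← sub_eq_zero, ← map_sub, ← map_sub]
  -- The difference of the two restrictions is `f(h x) = h f(x)` restricted to `ρ`, where `h` is
  -- zero.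
  refine (congrArg (fun z => Poly.restrict (Cone.lin_mono hρσ) (f z)) hsum.symm).trans ?_
  rw [map_smul, smul_eq_mul, map_mul, Poly.restrict_ofForm, hh0, map_zero, zero_mul]

end FanSheaf

/-! ### The comparison map -/

namespace FanSheaf

open Fan

variable {Δ Δ' : Fan V} [FiniteDimensional ℝ V]

/-- The section `s` of the direct image of the dual takes the same values as `c` on all sections
with support on a chamber. -/
def IsComparison (F : FanSheaf.{u, w} Δ') (o' : Δ'.Orient) {σ : Δ.Cone}
    (c : (push Δ F).LocDual σ) (s : (push Δ (F.dual o')).stalk σ) : Prop :=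
  ∀ τ : Chamber Δ' σ, τ.IsTransfer F c (F.dualTop o' τ.1.1 (s.1 τ.1))

theorem IsComparison.unique (href : Δ'.IsRefinement Δ) {F : FanSheaf.{u, w} Δ'}
    (hF : F.IsFlabby) {o' : Δ'.Orient} {σ : Δ.Cone} {c : (push Δ F).LocDual σ}
    {s s' : (push Δ (F.dual o')).stalk σ} (h : F.IsComparison o' c s)
    (h' : F.IsComparison o' c s') : s = s' :=
  push_ext_of_dim_eq href fun τ hd =>
    dualTop_injective hF o' τ.1 ((h ⟨τ, hd⟩).unique o' (h' ⟨τ, hd⟩))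

theorem exists_isComparison (href : Δ'.IsRefinement Δ) {F : FanSheaf.{u, w} Δ'}
    (hF : F.IsFlabby) {o' : Δ'.Orient} {o : Δ.Orient} (hor : o'.IsCompatible o) {σ : Δ.Cone}
    (c : (push Δ F).LocDual σ) : ∃ s, F.IsComparison o' c s := by
  choose d hd using fun τ : Chamber Δ' σ => τ.exists_isTransfer F hor c
  choose v hv using fun τ : Chamber Δ' σ => dualTop_surjective hF o' τ.1.1 (d τ)
  obtain ⟨s, hs⟩ := exists_push_of_dim_eq href (F.dual o') (fun τ hτ => v ⟨τ, hτ⟩) (by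
    intro ρ τ₁ τ₂ hd₁ hd₂ hf₁ hf₂
    refine dualTop_injective hF o' ρ ?_
    have r₁ := (v ⟨τ₁, hd₁⟩).2 ⟨ρ, hf₁.le⟩ ⟨τ₁.1, Set.mem_Iic.2 le_rfl⟩ hf₁
    have r₂ := (v ⟨τ₂, hd₂⟩).2 ⟨ρ, hf₂.le⟩ ⟨τ₂.1, Set.mem_Iic.2 le_rfl⟩ hf₂
    have t₁ := hd ⟨τ₁, hd₁⟩
    have t₂ := hd ⟨τ₂, hd₂⟩
    rw [← hv] at t₁ t₂
    exact t₁.eq_of_isFacetRes hF hor t₂ r₁ r₂)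
  refine ⟨s, fun τ => ?_⟩
  have e := hs τ.1 τ.2
  rw [e, hv]
  exact hd τ

theorem IsComparison.add {F : FanSheaf.{u, w} Δ'} {o' : Δ'.Orient} {σ : Δ.Cone}
    {c c' : (push Δ F).LocDual σ} {s s' : (push Δ (F.dual o')).stalk σ}
    (h : F.IsComparison o' c s) (h' : F.IsComparison o' c' s') :
    F.IsComparison o' (c + c') (s + s') :=
  fun τ => (h τ).add (h' τ)

theorem IsComparison.smul {F : FanSheaf.{u, w} Δ'} {o' : Δ'.Orient} {σ : Δ.Cone}
    {c : (push Δ F).LocDual σ} {s : (push Δ (F.dual o')).stalk σ}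
    (h : F.IsComparison o' c s) (a : Poly σ.lin) : F.IsComparison o' (a • c) (a • s) := by
  intro τ
  have e : F.dualTop o' τ.1.1 ((a • s).1 τ.1) =
      Poly.restrict (lin_le_of_below τ.1) a • F.dualTop o' τ.1.1 (s.1 τ.1) := by
    change Poly.restrict (lin_le_of_Iic _) (Poly.restrict (lin_le_of_below τ.1) a) • _ = _
    rw [Poly.restrict_refl]; rfl
  rw [e]
  exact (h τ).smul a

/-- Transfer commutes with restriction to a facet. -/
theorem Chamber.IsTransfer.isFacetRes {F : FanSheaf.{u, w} Δ'} (hF : F.IsFlabby)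
    {o' : Δ'.Orient} {o : Δ.Orient} (hor : o'.IsCompatible o) {σ' σ : Δ.Cone}
    {τ : Chamber Δ' σ} {ρ : Chamber Δ' σ'} {hg : σ'.IsFacet σ} {hf : ρ.1.1.IsFacet τ.1.1}
    {c : (push Δ F).LocDual σ} {c' : (push Δ F).LocDual σ'} {d : F.LocDual τ.1.1}
    {d' : F.LocDual ρ.1.1} (h : τ.IsTransfer F c d) (hc : (push Δ F).IsFacetRes o hg c c')
    (hd : F.IsFacetRes o' hf d d') : ρ.IsTransfer F c' d' := by
  obtain ⟨f, rfl⟩ := (push Δ F).exists_eq_tmul_vol o c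
  obtain ⟨f', rfl⟩ := (push Δ F).exists_eq_tmul_vol o c'
  obtain ⟨g, rfl⟩ := F.exists_eq_tmul_vol o' d
  obtain ⟨g', rfl⟩ := F.exists_eq_tmul_vol o' d'
  rw [Chamber.isTransfer_tmul_iff _ F hor] at h ⊢
  rw [isFacetRes_tmul_iff] at hc hd
  subst h
  refine LinearMap.ext fun s => ?_
  obtain ⟨t, ht, hts, ht0⟩ := hF.exists_section s.2
  have hρσ : ρ.1.1.1 ≤ σ.1 := le_trans (α := PointedCone ℝ V) ρ.1.2 hg.le
  have hdρ : ρ.1.1.dim + 1 = σ.dim := hf.dim_eq.trans τ.2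
  have hlinρ := ρ.lin_eq
  -- As `ρ` lies in the boundary of `σ`, it is a facet of no chamber of `σ` other than `τ`.
  have huniq : ∀ μ : below Δ' σ, ρ.1.1 ≤ μ.1 → μ.1 = ρ.1.1 ∨ μ = τ.1 := by
    intro μ hle
    rcases eq_or_lt_of_le hle with e | hlt
    · exact Or.inl e.symm
    · have h1 := Cone.dim_lt hlt
      have h2 := Cone.dim_mono μ.2
      refine Or.inr (Subtype.ext ?_)
      exact Cone.eq_of_isFacet_of_le_boundary (ρ := ρ.1.1) ⟨hle, by omega⟩ hf μ.2 τ.1.2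
        (by omega) τ.2 hg.lt ρ.1.2
  have hext : F.IsExtension ρ.1.1 (t τ.1.1) := by
    intro μ hμ hne
    rw [ht]
    refine ht0 μ fun hle => hne ?_
    have h1 := Cone.dim_lt hμ
    have h2 := hf.dim_eq
    exact (Cone.eq_of_le_of_dim_le hle (by omega)).symm
  -- A face of `σ` that contains `ρ` also contains `σ'`, because its intersection with `σ'` has the
  -- dimension of `σ'`. So `t` vanishes on the proper faces of `σ` other than `σ'`.
  have hpext : (push Δ F).IsExtension σ' (pushOfGlobal Δ F t ht σ) := by
    intro σ'' hσ'' hne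
    refine push_ext fun μ => ?_
    change t μ.1 = 0
    refine ht0 _ fun hle => hne ?_
    have hρσ'' : ρ.1.1.1 ≤ σ''.1 := le_trans (α := PointedCone ℝ V) hle μ.2
    have hle' : σ' ≤ σ'' := by
      have h1 : ρ.1.1.1 ≤ (σ'.inter σ'').1 := fun v hv => ⟨ρ.1.2 hv, hρσ'' hv⟩
      have h2 := Cone.dim_mono h1
      have h3 : σ'.inter σ'' = σ' :=
        Cone.eq_of_le_of_dim_le (Cone.inter_le_left _ _) (by have := ρ.2; omega)
      rw [← h3]
      exact Cone.inter_le_right _ _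
    have h1 := Cone.dim_lt hσ''
    have h2 := hg.dim_eq
    exact (Cone.eq_of_le_of_dim_le hle' (by omega)).symm
  have a := hd _ hext
  have b := hc _ hpext
  have es : (⟨F.res hf.le (t τ.1.1), hext.res_mem hf.le⟩ : F.rel ρ.1.1) = s :=
    Subtype.ext ((ht hf.le).trans hts)
  have es' : (⟨(push Δ F).res hg.le (pushOfGlobal Δ F t ht σ), hpext.res_mem hg.le⟩ :
      (push Δ F).rel σ') = ρ.single F s := by
    refine ρ.eq_single F hts fun μ hμ => ht0 _ fun hle => hμ ?_
    exact (ρ.eq_of_le hle).symm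
  -- Multiplied by the normal form of `σ'`, the section given by `t` lives on `τ` alone. The normal
  -- form of `σ'` in `σ` restricts to that of `ρ` in `τ`, so both restriction maps evaluate on the
  -- same section.
  have ey : (⟨Poly.ofForm (o.form hg) • pushOfGlobal Δ F t ht σ,
      hpext.smul_mem (o.form_isFacetForm hg)⟩ : (push Δ F).rel σ) =
      τ.single F ⟨Poly.ofForm (o'.form hf) • t τ.1.1,
        hext.smul_mem (o'.form_isFacetForm hf)⟩ := by
    refine τ.eq_single F ?_ fun μ hμ => ?_
    · change Poly.restrict (lin_le_of_below τ.1) (Poly.ofForm (o.form hg)) • t τ.1.1 =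
        Poly.ofForm (o'.form hf) • t τ.1.1
      rw [Poly.restrict_ofForm, hor.form_restrict ρ.1.2 τ.1.2 ρ.2 τ.2 hf hg]
    · change Poly.restrict (lin_le_of_below μ) (Poly.ofForm (o.form hg)) • t μ.1 = 0
      by_cases hle : ρ.1.1 ≤ μ.1
      · have e := (huniq μ hle).resolve_right hμ
        have hμσ' : μ.1.lin ≤ σ'.lin := by rw [e]; exact hlinρ.le
        rw [← Poly.restrict_trans hμσ' (Cone.lin_mono hg.le), restrict_form, map_zero, zero_smul]
      · rw [ht0 _ hle, smul_zero]
  rw [es, Chamber.comp_apply, Poly.restrict_trans] at a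
  rw [es', ey] at b
  rw [a, Chamber.comp_apply, b, Poly.restrict_trans]

/-- Comparison commutes with restriction to a facet. -/
theorem IsComparison.isFacetRes (href : Δ'.IsRefinement Δ) {F : FanSheaf.{u, w} Δ'}
    (hF : F.IsFlabby) {o' : Δ'.Orient} {o : Δ.Orient} (hor : o'.IsCompatible o) {σ' σ : Δ.Cone}
    {hg : σ'.IsFacet σ} {c : (push Δ F).LocDual σ} {c' : (push Δ F).LocDual σ'}
    {s : (push Δ (F.dual o')).stalk σ} (h : F.IsComparison o' c s)
    (hc : (push Δ F).IsFacetRes o hg c c') :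
    F.IsComparison o' c' ((push Δ (F.dual o')).res hg.le s) := by
  intro ρ
  obtain ⟨τ, h₁, h₂, h₃⟩ := href.exists_dim_eq
    (le_trans (α := PointedCone ℝ V) ρ.1.2 hg.le : ρ.1.1.1 ≤ σ.1)
  have hf : ρ.1.1.IsFacet τ := ⟨h₁, by have := ρ.2; have := hg.dim_eq; omega⟩
  refine (h ⟨⟨τ, h₂⟩, h₃⟩).isFacetRes hF hor (hf := hf) hc ?_
  have e := s.2 ⟨ρ.1.1, le_trans (α := PointedCone ℝ V) ρ.1.2 hg.le⟩ ⟨τ, h₂⟩ h₁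
  have r := (s.1 ⟨τ, h₂⟩).2 ⟨ρ.1.1, h₁⟩ ⟨τ, Set.mem_Iic.2 le_rfl⟩ hf
  have e' := congrArg (F.dualTop o' ρ.1.1) e
  change F.IsFacetRes o' hf _ (F.dualTop o' ρ.1.1 (s.1 ⟨ρ.1.1, _⟩))
  rw [← e']
  exact r

theorem IsComparison.reach (href : Δ'.IsRefinement Δ) {F : FanSheaf.{u, w} Δ'}
    (hF : F.IsFlabby) {o' : Δ'.Orient} {o : Δ.Orient} (hor : o'.IsCompatible o) {ρ σ : Δ.Cone}
    {c : (push Δ F).LocDual σ} {e : (push Δ F).LocDual ρ} (hr : (push Δ F).Reach o σ ρ c e)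
    {s : (push Δ (F.dual o')).stalk σ} (h : F.IsComparison o' c s) :
    F.IsComparison o' e ((push Δ (F.dual o')).res hr.le s) := by
  induction hr with
  | refl => exact h
  | step hf hcd hr ih => exact ih (h.isFacetRes href hF hor hcd)

/-- The comparison map from the dual of the direct image to the direct image of the dual. -/
def comparison (href : Δ'.IsRefinement Δ) (F : FanSheaf.{u, w} Δ') (hF : F.IsFlabby)
    (o' : Δ'.Orient) (o : Δ.Orient) (hor : o'.IsCompatible o) :
    Hom ((push Δ F).dual o) (push Δ (F.dual o')) :=
  let Φ := fun (σ : Δ.Cone) (c : ((push Δ F).dual o).stalk σ) =>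
    (exists_isComparison href hF hor ((push Δ F).dualTop o σ c)).choose
  have hΦ : ∀ σ c, F.IsComparison o' ((push Δ F).dualTop o σ c) (Φ σ c) := fun σ c =>
    (exists_isComparison href hF hor ((push Δ F).dualTop o σ c)).choose_spec
  { app := fun σ =>
      { toFun := Φ σ
        -- A section of the direct image of the dual is determined by its values on sections
        -- supported on chambers, so additivity, linearity and compatibility with restriction follow
        -- from uniqueness.
        map_add' := fun c c' => (hΦ σ (c + c')).unique href hF ((hΦ σ c).add (hΦ σ c'))
        map_smul' := fun a c => (hΦ σ (a • c)).unique href hF (by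
          have e : (push Δ F).dualTop o σ (a • c) = a • (push Δ F).dualTop o σ c := by
            change Poly.restrict (lin_le_of_Iic _) a • _ = _
            rw [Poly.restrict_refl]; rfl
          rw [e]
          exact (hΦ σ c).smul a) }
    comm := fun {τ σ} h c => (hΦ τ _).unique href hF
      ((hΦ σ c).reach href hF hor (DualStalk.reach c (ρ := ⟨τ, h⟩)
        (τ := ⟨σ, Set.mem_Iic.2 le_rfl⟩) h)) }

theorem comparison_isComparison (href : Δ'.IsRefinement Δ) (F : FanSheaf.{u, w} Δ')
    (hF : F.IsFlabby) (o' : Δ'.Orient) (o : Δ.Orient) (hor : o'.IsCompatible o) (σ : Δ.Cone)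
    (c : ((push Δ F).dual o).stalk σ) :
    F.IsComparison o' ((push Δ F).dualTop o σ c) ((comparison href F hF o' o hor).app σ c) :=
  (exists_isComparison href hF hor ((push Δ F).dualTop o σ c)).choose_spec

theorem isCanonical_iff {F : FanSheaf.{u, w} Δ'} {o' : Δ'.Orient} {o : Δ.Orient}
    {Φ : Hom ((push Δ F).dual o) (push Δ (F.dual o'))} :
    F.IsCanonical o' o Φ ↔
      ∀ σ c, F.IsComparison o' ((push Δ F).dualTop o σ c) (Φ.app σ c) := by
  constructor
  · intro h σ c τ y
    have := h σ τ.1 τ.2 (τ.single F y) (fun μ hμ => τ.single_of_ne F y hμ) c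
    rw [← this]
    congr 1
    exact congrArg (fun z => F.pair z (AlgHom.id ℝ _) LinearMap.id)
      (Subtype.ext (τ.single_self F y).symm)
  · intro h σ τ hd x hx c
    refine (h σ c ⟨τ, hd⟩ _).trans ?_
    rw [← Chamber.eq_single ⟨τ, hd⟩ F rfl hx]

end FanSheaf

/-! ### Walls -/

theorem exists_dual_ker_iff {W U : Submodule ℝ V} [FiniteDimensional ℝ V] (hle : W ≤ U)
    (hd : Module.finrank ℝ W + 1 = Module.finrank ℝ U) :
    ∃ l : Module.Dual ℝ U, ∀ v : U, l v = 0 ↔ (v : V) ∈ W := by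
  obtain ⟨l, hl⟩ := exists_dual_ker_eq (W.submoduleOf U) (by
    rw [(Submodule.submoduleOfEquivOfLe hle).finrank_eq]; exact hd)
  exact ⟨l, fun v => by rw [← LinearMap.mem_ker, hl]; rfl⟩

theorem exists_eq_smul_of_ker {E : Type*} [AddCommGroup E] [Module ℝ E] {l l' : Module.Dual ℝ E}
    (hl : l ≠ 0) (h : ∀ v, l v = 0 → l' v = 0) : ∃ c : ℝ, l' = c • l := by
  obtain ⟨e, he⟩ : ∃ e, l e ≠ 0 := by
    by_contra! h0
    exact hl (LinearMap.ext h0)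
  refine ⟨l' e / l e, LinearMap.ext fun v => ?_⟩
  have h1 := h (v - (l v / l e) • e) (by
    rw [map_sub, map_smul, smul_eq_mul, div_mul_cancel₀ _ he, sub_self])
  rw [map_sub, map_smul, smul_eq_mul, sub_eq_zero] at h1
  rw [h1, LinearMap.smul_apply, smul_eq_mul]
  ring

theorem prod_dvd_of_prime {ι R : Type*} [CommRing R] [IsDomain R] (S : Finset ι)
    {p : ι → R} (hp : ∀ i ∈ S, Prime (p i)) (hne : ∀ i ∈ S, ∀ j ∈ S, p i ∣ p j → i = j) {a : R}
    (ha : ∀ i ∈ S, p i ∣ a) : ∏ i ∈ S, p i ∣ a := by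
  classical
  induction S using Finset.induction_on with
  | empty => exact one_dvd _
  | insert i S hi ih =>
    obtain ⟨b, rfl⟩ := ih (fun j hj => hp j (Finset.mem_insert_of_mem hj))
      (fun j hj k hk => hne j (Finset.mem_insert_of_mem hj) k (Finset.mem_insert_of_mem hk))
      (fun j hj => ha j (Finset.mem_insert_of_mem hj))
    have hpi := hp i (Finset.mem_insert_self i S)
    rcases hpi.dvd_or_dvd (ha i (Finset.mem_insert_self i S)) with h | h
    · obtain ⟨j, hj, hij⟩ := (hpi.dvd_finsetProd_iff _).1 h
      have := hne i (Finset.mem_insert_self i S) j (Finset.mem_insert_of_mem hj) hij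
      exact absurd (this ▸ hj) hi
    · rw [Finset.prod_insert hi, mul_comm]
      exact mul_dvd_mul_left _ h

namespace FanSheaf

open Fan

variable {Δ Δ' : Fan V}

/-- The spans of the cones in `σ` whose codimension in `σ` is one. -/
def walls (Δ' : Fan V) (σ : Δ.Cone) : Finset (Submodule ℝ V) :=
  (Set.finite_range fun ρ : {ρ : Δ'.Cone // ρ.1 ≤ σ.1 ∧ ρ.dim + 1 = σ.dim} =>
    ρ.1.lin).toFinset

theorem mem_walls {σ : Δ.Cone} {W : Submodule ℝ V} :
    W ∈ walls Δ' σ ↔ ∃ ρ : Δ'.Cone, ρ.1 ≤ σ.1 ∧ ρ.dim + 1 = σ.dim ∧ ρ.lin = W := by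
  rw [walls, Set.Finite.mem_toFinset]
  constructor
  · rintro ⟨ρ, rfl⟩; exact ⟨ρ.1, ρ.2.1, ρ.2.2, rfl⟩
  · rintro ⟨ρ, h₁, h₂, rfl⟩; exact ⟨⟨ρ, h₁, h₂⟩, rfl⟩

theorem lin_mem_walls {σ : Δ.Cone} (τ : Chamber Δ' σ) {ρ : Δ'.Cone} (hf : ρ.IsFacet τ.1.1) :
    ρ.lin ∈ walls Δ' σ :=
  mem_walls.2 ⟨ρ, le_trans (α := PointedCone ℝ V) hf.le τ.1.2, hf.dim_eq.trans τ.2, rfl⟩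

theorem le_of_mem_walls {σ : Δ.Cone} {W : Submodule ℝ V} (h : W ∈ walls Δ' σ) : W ≤ σ.lin := by
  obtain ⟨ρ, hρ, -, rfl⟩ := mem_walls.1 h
  exact Cone.lin_mono hρ

theorem finrank_of_mem_walls {σ : Δ.Cone} {W : Submodule ℝ V} (h : W ∈ walls Δ' σ) :
    Module.finrank ℝ W + 1 = Module.finrank ℝ σ.lin := by
  obtain ⟨ρ, -, hρ, rfl⟩ := mem_walls.1 h
  exact hρ

open Classical in
/-- A linear form on `V_σ` with a given wall as its kernel. -/
def wallForm (σ : Δ.Cone) (W : Submodule ℝ V) : Module.Dual ℝ σ.lin :=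
  if h : ∃ l : Module.Dual ℝ σ.lin, ∀ v : σ.lin, l v = 0 ↔ (v : V) ∈ W then h.choose else 0

/-- The product of the linear forms of all walls. -/
def wallProd (Δ' : Fan V) (σ : Δ.Cone) : Poly σ.lin :=
  ∏ W ∈ walls Δ' σ, Poly.ofForm (wallForm σ W)

theorem wallProd_mem_grade (σ : Δ.Cone) :
    ∃ i : ℤ, wallProd Δ' σ ∈ Poly.grade σ.lin i := by
  unfold wallProd
  induction walls Δ' σ using Finset.cons_induction with
  | empty => exact ⟨0, Poly.one_mem_grade⟩
  | cons W S hW ih =>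
    obtain ⟨i, hi⟩ := ih
    rw [Finset.prod_cons]
    exact ⟨2 + i, Poly.mul_mem_grade (Poly.ofForm_mem_grade _) hi⟩

variable [FiniteDimensional ℝ V]

theorem wallForm_eq_zero_iff {σ : Δ.Cone} {W : Submodule ℝ V} (h : W ∈ walls Δ' σ) (v : σ.lin) :
    wallForm σ W v = 0 ↔ (v : V) ∈ W := by
  have hex := exists_dual_ker_iff (le_of_mem_walls h) (finrank_of_mem_walls h)
  rw [wallForm, dif_pos hex]
  exact hex.choose_spec v

theorem wallForm_ne_zero {σ : Δ.Cone} {W : Submodule ℝ V} (h : W ∈ walls Δ' σ) :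
    wallForm σ W ≠ 0 := by
  intro h0
  have h1 := finrank_of_mem_walls h
  have h2 : σ.lin ≤ W := fun v hv => (wallForm_eq_zero_iff h ⟨v, hv⟩).1 (by rw [h0]; rfl)
  have := Submodule.finrank_mono h2
  omega

theorem restrict_wallForm {σ : Δ.Cone} {W U : Submodule ℝ V} (h : W ∈ walls Δ' σ) (hU : U ≤ W)
    (hUσ : U ≤ σ.lin) : Poly.restrict hUσ (Poly.ofForm (wallForm σ W)) = 0 := by
  rw [Poly.restrict_ofForm]
  have : wallForm σ W ∘ₗ Submodule.inclusion hUσ = 0 :=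
    LinearMap.ext fun v => (wallForm_eq_zero_iff h _).2 (hU v.2)
  rw [this, map_zero]

theorem restrict_prod_wallForm {σ : Δ.Cone} {S : Finset (Submodule ℝ V)} (hS : S ⊆ walls Δ' σ)
    {W U : Submodule ℝ V} (hW : W ∈ S) (hU : U ≤ W) (hUσ : U ≤ σ.lin) :
    Poly.restrict hUσ (∏ W ∈ S, Poly.ofForm (wallForm σ W)) = 0 := by
  rw [map_prod]
  exact Finset.prod_eq_zero hW (restrict_wallForm (hS hW) hU hUσ)

theorem wallProd_ne_zero (σ : Δ.Cone) : wallProd Δ' σ ≠ 0 :=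
  Finset.prod_ne_zero_iff.2 fun _ hW => Poly.ofForm_ne_zero (wallForm_ne_zero hW)

/-- Divisibility by a wall form is vanishing on the wall. The wall forms are primes, and one divides
another only if the walls coincide, so their product divides as well. -/
theorem wallProd_dvd {σ : Δ.Cone} {a : Poly σ.lin}
    (h : ∀ (W : Submodule ℝ V) (hW : W ∈ walls Δ' σ), Poly.restrict (le_of_mem_walls hW) a = 0) :
    wallProd Δ' σ ∣ a := by
  refine prod_dvd_of_prime _ (fun W hW => ?_) (fun W hW W' hW' hdvd => ?_) fun W hW => ?_
  · exact Poly.prime_ofForm (le_of_mem_walls hW) (wallForm_eq_zero_iff hW) (wallForm_ne_zero hW)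
  · rw [Poly.ofForm_dvd_iff (le_of_mem_walls hW) (wallForm_eq_zero_iff hW) (wallForm_ne_zero hW),
      Poly.restrict_ofForm] at hdvd
    have h0 : wallForm σ W' ∘ₗ Submodule.inclusion (le_of_mem_walls hW) = 0 := by
      by_contra h0
      exact Poly.ofForm_ne_zero h0 hdvd
    refine Submodule.eq_of_le_of_finrank_eq (fun v hv => ?_) ?_
    · exact (wallForm_eq_zero_iff hW' _).1 (LinearMap.congr_fun h0 ⟨v, hv⟩)
    · have h₁ := finrank_of_mem_walls hW
      have h₂ := finrank_of_mem_walls hW'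
      omega
  · rw [Poly.ofForm_dvd_iff (le_of_mem_walls hW) (wallForm_eq_zero_iff hW) (wallForm_ne_zero hW)]
    exact h W hW

/-- A cone in `σ` of smaller dimension is a proper face of a chamber, so it lies in a facet of it
and hence in a wall. -/
theorem wallProd_smul_apply (href : Δ'.IsRefinement Δ) (F : FanSheaf.{u, w} Δ') {σ : Δ.Cone}
    (s : (push Δ F).stalk σ) {μ : below Δ' σ} (hμ : μ.1.dim ≠ σ.dim) :
    (wallProd Δ' σ • s).1 μ = 0 := by
  obtain ⟨τ, h₁, h₂, h₃⟩ := href.exists_dim_eq μ.2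
  obtain ⟨ρ, hf, hle⟩ := Cone.exists_isFacet (lt_of_le_of_ne h₁ fun e => hμ (e ▸ h₃))
  rw [push_smul_apply, wallProd, restrict_prod_wallForm subset_rfl
    (lin_mem_walls ⟨⟨τ, h₂⟩, h₃⟩ hf) (Cone.lin_mono hle), zero_smul]

/-- The product of the linear forms of all walls, times a section, at a chamber. -/
def Chamber.cut {F : FanSheaf.{u, w} Δ'} {σ : Δ.Cone} (τ : Chamber Δ' σ)
    (s : (push Δ F).stalk σ) : F.rel τ.1.1 :=
  ⟨(wallProd Δ' σ • s).1 τ.1, fun ρ hρ => by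
    obtain ⟨ρ', hf, hle⟩ := Cone.exists_isFacet hρ
    rw [push_smul_apply, F.res_smul, wallProd, Poly.restrict_trans,
      restrict_prod_wallForm subset_rfl (lin_mem_walls τ hf) (Cone.lin_mono hle), zero_smul]⟩

theorem Chamber.cut_add {F : FanSheaf.{u, w} Δ'} {σ : Δ.Cone} (τ : Chamber Δ' σ)
    (s t : (push Δ F).stalk σ) : τ.cut (s + t) = τ.cut s + τ.cut t :=
  Subtype.ext (congrArg (fun x : (push Δ F).stalk σ => x.1 τ.1) (smul_add (wallProd Δ' σ) s t))

theorem Chamber.cut_smul {F : FanSheaf.{u, w} Δ'} {σ : Δ.Cone} (τ : Chamber Δ' σ)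
    (a : Poly σ.lin) (s : (push Δ F).stalk σ) :
    τ.cut (a • s) = Poly.restrict (lin_le_of_below τ.1) a • τ.cut s :=
  Subtype.ext (congrArg (fun x : (push Δ F).stalk σ => x.1 τ.1)
    (smul_comm (wallProd Δ' σ) a s))

/-- Multiplication by `wallProd` kills every section on the walls, so that its values at the
different chambers become independent of each other. -/
theorem wallProd_smul_eq_sum (href : Δ'.IsRefinement Δ) {F : FanSheaf.{u, w} Δ'} {σ : Δ.Cone}
    (s : (push Δ F).rel σ) : wallProd Δ' σ • s = ∑ τ : Chamber Δ' σ, τ.single F (τ.cut s.1) := by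
  refine Subtype.ext (push_ext fun μ => ?_)
  let ev : (push Δ F).rel σ →+ F.stalk μ.1 :=
    { toFun := fun x => x.1.1 μ
      map_zero' := rfl
      map_add' := fun _ _ => rfl }
  refine Eq.trans ?_ (map_sum ev _ _).symm
  by_cases hμ : μ.1.dim = σ.dim
  · rw [Finset.sum_eq_single (⟨μ, hμ⟩ : Chamber Δ' σ)]
    · exact (Chamber.single_self ⟨μ, hμ⟩ F (Chamber.cut ⟨μ, hμ⟩ s.1)).symm
    · exact fun (τ : Chamber Δ' σ) _ hne => τ.single_of_ne F _ fun e => hne (Subtype.ext e.symm)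
    · exact fun h => absurd (Finset.mem_univ _) h
  · rw [Finset.sum_eq_zero]
    · exact wallProd_smul_apply href F s.1 hμ
    · exact fun (τ : Chamber Δ' σ) _ => τ.single_of_ne F _ fun e => hμ (e ▸ τ.2)

/-- The functional on the sections over `σ`, given by functionals at the chambers, whose
quotient by `wallProd` has the given components. -/
def glue {F : FanSheaf.{u, w} Δ'} {σ : Δ.Cone}
    (g : ∀ τ : Chamber Δ' σ, F.rel τ.1.1 →ₗ[Poly τ.1.1.lin] Poly τ.1.1.lin) :
    (push Δ F).rel σ →ₗ[Poly σ.lin] Poly σ.lin where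
  toFun s := ∑ τ : Chamber Δ' σ, τ.extend (g τ (τ.cut s.1))
  map_add' s t := by
    rw [← Finset.sum_add_distrib]
    refine Finset.sum_congr rfl fun (τ : Chamber Δ' σ) _ => ?_
    rw [← map_add, ← map_add, ← τ.cut_add]
    rfl
  map_smul' a s := by
    rw [RingHom.id_apply, Finset.smul_sum]
    refine Finset.sum_congr rfl fun (τ : Chamber Δ' σ) _ => ?_
    have e := τ.cut_smul a s.1
    change τ.extend (g τ (τ.cut (a • s.1))) = _
    rw [e, map_smul, smul_eq_mul, map_mul, τ.extend_restrict, smul_eq_mul]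

theorem glue_apply {F : FanSheaf.{u, w} Δ'} {σ : Δ.Cone}
    (g : ∀ τ : Chamber Δ' σ, F.rel τ.1.1 →ₗ[Poly τ.1.1.lin] Poly τ.1.1.lin)
    (s : (push Δ F).rel σ) : glue g s = ∑ τ : Chamber Δ' σ, τ.extend (g τ (τ.cut s.1)) :=
  rfl

theorem wallProd_mul_apply (href : Δ'.IsRefinement Δ) {F : FanSheaf.{u, w} Δ'} {σ : Δ.Cone}
    (f : (push Δ F).rel σ →ₗ[Poly σ.lin] Poly σ.lin) (s : (push Δ F).rel σ) :
    wallProd Δ' σ * f s = glue (fun τ => τ.comp F f) s := by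
  rw [← smul_eq_mul, ← map_smul, wallProd_smul_eq_sum href, map_sum, glue_apply]
  exact Finset.sum_congr rfl fun (τ : Chamber Δ' σ) _ => (τ.extend_comp_apply F f _).symm

/-- The components determine `wallProd * f s`, and `wallProd` can be cancelled. This gives
injectivity of the comparison map. -/
theorem eq_of_comp_eq (href : Δ'.IsRefinement Δ) {F : FanSheaf.{u, w} Δ'} {σ : Δ.Cone}
    {f f' : (push Δ F).rel σ →ₗ[Poly σ.lin] Poly σ.lin}
    (h : ∀ τ : Chamber Δ' σ, τ.comp F f = τ.comp F f') : f = f' := by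
  refine LinearMap.ext fun s => mul_left_cancel₀ (wallProd_ne_zero (Δ' := Δ') σ) ?_
  rw [wallProd_mul_apply href, wallProd_mul_apply href, funext h]

theorem glue_single {F : FanSheaf.{u, w} Δ'} {σ : Δ.Cone}
    (g : ∀ τ : Chamber Δ' σ, F.rel τ.1.1 →ₗ[Poly τ.1.1.lin] Poly τ.1.1.lin) (τ : Chamber Δ' σ)
    (y : F.rel τ.1.1) : glue g (τ.single F y) = wallProd Δ' σ * τ.extend (g τ y) := by
  rw [glue_apply, Finset.sum_eq_single τ (fun (τ' : Chamber Δ' σ) _ hne => ?_)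
    fun h => absurd (Finset.mem_univ _) h]
  swap
  · have : τ'.cut (τ.single F y).1 = 0 := by
      refine Subtype.ext ?_
      change Poly.restrict _ _ • (τ.single F y).1.1 τ'.1 = 0
      rw [τ.single_of_ne F y fun e => hne (Subtype.ext e), smul_zero]
    rw [this, map_zero, map_zero]
  · have : τ.cut (τ.single F y).1 = Poly.restrict (lin_le_of_below τ.1) (wallProd Δ' σ) • y := by
      refine Subtype.ext ?_
      change Poly.restrict _ _ • (τ.single F y).1.1 τ.1 = _
      rw [τ.single_self]; rfl
    rw [this, map_smul, smul_eq_mul, map_mul, τ.extend_restrict]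

/-- Functionals at the chambers are the components of a functional, if `wallProd` divides the
values of `glue`. -/
theorem exists_comp_eq {F : FanSheaf.{u, w} Δ'} {σ : Δ.Cone}
    (g : ∀ τ : Chamber Δ' σ, F.rel τ.1.1 →ₗ[Poly τ.1.1.lin] Poly τ.1.1.lin)
    (h : ∀ s, wallProd Δ' σ ∣ glue g s) :
    ∃ f : (push Δ F).rel σ →ₗ[Poly σ.lin] Poly σ.lin, ∀ τ : Chamber Δ' σ, τ.comp F f = g τ := by
  choose f hf using h
  -- The quotient of `glue g` by `wallProd` inherits linearity by cancellation.
  have h0 := wallProd_ne_zero (Δ' := Δ') σ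
  refine ⟨⟨⟨f, fun s t => mul_left_cancel₀ h0 ?_⟩, fun a s => mul_left_cancel₀ h0 ?_⟩,
    fun τ => LinearMap.ext fun y => ?_⟩
  · rw [← hf, map_add, hf, hf, mul_add]
  · change _ * f (a • s) = _
    rw [← hf, map_smul, hf, RingHom.id_apply, smul_eq_mul, smul_eq_mul, mul_left_comm]
  · rw [Chamber.comp_apply, ← τ.restrict_extend (g τ y)]
    congr 1
    refine mul_left_cancel₀ h0 ?_
    rw [← glue_single]
    exact (hf _).symm

end FanSheaf

/-! ### The comparison map is an isomorphism -/

namespace Fan.Cone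

theorem eq_of_lin_eq {Δ : Fan V} {ρ ρ' τ : Δ.Cone} (h : ρ ≤ τ) (h' : ρ' ≤ τ)
    (e : ρ.lin = ρ'.lin) : ρ = ρ' :=
  le_antisymm (fun _ hv => mem_of_mem_lin h' (h hv) (e ▸ ρ.subset_lin hv))
    (fun _ hv => mem_of_mem_lin h (h' hv) (e ▸ ρ'.subset_lin hv))

end Fan.Cone

namespace FanSheaf

open Fan

variable {Δ Δ' : Fan V}

open Classical in
/-- The product of the linear forms of all walls but one. -/
def wallProdErase (Δ' : Fan V) (σ : Δ.Cone) (W : Submodule ℝ V) : Poly σ.lin :=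
  ∏ W ∈ (walls Δ' σ).erase W, Poly.ofForm (wallForm σ W)

theorem wallProd_eq_mul {σ : Δ.Cone} {W : Submodule ℝ V} (hW : W ∈ walls Δ' σ) :
    wallProd Δ' σ = Poly.ofForm (wallForm σ W) * wallProdErase Δ' σ W := by
  classical
  exact (Finset.mul_prod_erase _ _ hW).symm

variable [FiniteDimensional ℝ V]

theorem res_wallProdErase_smul {F : FanSheaf.{u, w} Δ'} {σ : Δ.Cone} (τ : Chamber Δ' σ)
    (W : Submodule ℝ V) (s : (push Δ F).stalk σ) {μ ρ : Δ'.Cone} (hμ : μ ≤ τ.1.1)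
    (hf : ρ.IsFacet τ.1.1) (hρ : ρ.lin ≠ W) (hμρ : μ ≤ ρ) :
    F.res hμ ((wallProdErase Δ' σ W • s).1 τ.1) = 0 := by
  classical
  rw [push_smul_apply, F.res_smul, Poly.restrict_trans, wallProdErase,
    restrict_prod_wallForm (Finset.erase_subset _ _)
      (Finset.mem_erase.2 ⟨hρ, lin_mem_walls τ hf⟩) (Cone.lin_mono hμρ), zero_smul]

/-- If no facet of the chamber spans `W`, the remaining wall forms still kill everything on its
boundary. -/
theorem wallProdErase_smul_mem_rel {F : FanSheaf.{u, w} Δ'} {σ : Δ.Cone} (τ : Chamber Δ' σ)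
    {W : Submodule ℝ V} (hW : ∀ ρ : Δ'.Cone, ρ.IsFacet τ.1.1 → ρ.lin ≠ W)
    (s : (push Δ F).stalk σ) : (wallProdErase Δ' σ W • s).1 τ.1 ∈ F.rel τ.1.1 := by
  intro μ hμ
  obtain ⟨ρ, hf, hle⟩ := Cone.exists_isFacet hμ
  exact res_wallProdErase_smul τ W s hμ.le hf (hW ρ hf) hle

/-- A proper face other than `ρ` lies in a facet other than `ρ`, since a face of codimension at
least two lies in two facets. That facet spans a different wall, whose form is still a factor. -/
theorem isExtension_wallProdErase_smul {F : FanSheaf.{u, w} Δ'} {σ : Δ.Cone} (τ : Chamber Δ' σ)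
    {ρ : Δ'.Cone} (hf : ρ.IsFacet τ.1.1) (s : (push Δ F).stalk σ) :
    F.IsExtension ρ ((wallProdErase Δ' σ ρ.lin • s).1 τ.1) := by
  intro μ hμ hne
  obtain ⟨ρ', hf', hle, hne'⟩ : ∃ ρ' : Δ'.Cone, ρ'.IsFacet τ.1.1 ∧ μ ≤ ρ' ∧ ρ' ≠ ρ := by
    obtain ⟨ρ', hf', hle⟩ := Cone.exists_isFacet hμ
    by_cases e : ρ' = ρ
    · subst e
      exact Cone.exists_isFacet_ne (lt_of_le_of_ne hle hne) hf.lt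
    · exact ⟨ρ', hf', hle, e⟩
  exact res_wallProdErase_smul τ _ s hμ.le hf'
    (fun e => hne' (Cone.eq_of_lin_eq hf'.le hf.le e)) hle

theorem Chamber.cut_eq {F : FanSheaf.{u, w} Δ'} {σ : Δ.Cone} (τ : Chamber Δ' σ)
    {W : Submodule ℝ V} (hW : W ∈ walls Δ' σ) (s : (push Δ F).stalk σ) :
    (τ.cut s).1 = Poly.restrict (lin_le_of_below τ.1) (Poly.ofForm (wallForm σ W)) •
      (wallProdErase Δ' σ W • s).1 τ.1 := by
  change Poly.restrict _ _ • s.1 τ.1 = Poly.restrict _ _ • Poly.restrict _ _ • s.1 τ.1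
  rw [wallProd_eq_mul hW, map_mul, mul_smul]

/-- Functionals over the cones in `σ`, in which each member restricts to the members at its
facets. -/
def IsCompatibleFamily (F : FanSheaf.{u, w} Δ') (o' : Δ'.Orient) {σ : Δ.Cone}
    (g : ∀ μ : below Δ' σ, F.rel μ.1 →ₗ[Poly μ.1.lin] Poly μ.1.lin) : Prop :=
  ∀ (ρ τ : below Δ' σ) (hf : ρ.1.IsFacet τ.1) (x : F.stalk τ.1) (hx : F.IsExtension ρ.1 x),
    g ρ ⟨F.res hf.le x, hx.res_mem hf.le⟩ = Poly.restrict (Cone.lin_mono hf.le)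
      (g τ ⟨Poly.ofForm (o'.form hf) • x, hx.smul_mem (o'.form_isFacetForm hf)⟩)

namespace IsCompatibleFamily

variable {F : FanSheaf.{u, w} Δ'} {o' : Δ'.Orient} {σ : Δ.Cone}
  {g : ∀ μ : below Δ' σ, F.rel μ.1 →ₗ[Poly μ.1.lin] Poly μ.1.lin}

/-- The restriction to a wall of a member of the sum that defines `glue`, for a chamber with a
facet in the wall. -/
theorem restrict_extend (hg : F.IsCompatibleFamily o' g) (τ : Chamber Δ' σ) (ρ : below Δ' σ)
    (hf : ρ.1.IsFacet τ.1.1) {c : ℝ} (hc : wallForm σ ρ.1.lin ∘ₗ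
      Submodule.inclusion (lin_le_of_below τ.1) = c • o'.form hf) (s : (push Δ F).stalk σ)
    (hmem : (wallProdErase Δ' σ ρ.1.lin • s).1 ρ ∈ F.rel ρ.1) :
    Poly.restrict (lin_le_of_below ρ) (τ.extend (g τ.1 (τ.cut s))) = c • g ρ ⟨_, hmem⟩ := by
  have hx := isExtension_wallProdErase_smul τ hf s
  have e := hg ρ τ.1 hf _ hx
  have e₁ : (⟨F.res hf.le ((wallProdErase Δ' σ ρ.1.lin • s).1 τ.1), hx.res_mem hf.le⟩ :
      F.rel ρ.1) = ⟨_, hmem⟩ :=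
    Subtype.ext ((wallProdErase Δ' σ ρ.1.lin • s).2 ρ τ.1 hf.le)
  -- Splitting off the form of the wall of `ρ`, which is `c` times the normal form on `τ`, exhibits
  -- the cut section as the one at which the facet restriction of `g τ` is evaluated.
  have e₂ : τ.cut s = algebraMap ℝ (Poly τ.1.1.lin) c •
      ⟨Poly.ofForm (o'.form hf) • (wallProdErase Δ' σ ρ.1.lin • s).1 τ.1,
        hx.smul_mem (o'.form_isFacetForm hf)⟩ := by
    refine Subtype.ext ?_
    rw [τ.cut_eq (lin_mem_walls τ hf), Poly.restrict_ofForm, hc, map_smul, Algebra.smul_def,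
      mul_smul]
    rfl
  rw [e₁] at e
  rw [e, e₂, map_smul, smul_eq_mul, Chamber.extend, Poly.restrict_trans, map_mul,
    AlgHom.commutes, ← Algebra.smul_def]

/-- On a wall the terms of the sum cancel in pairs of chambers that are adjacent across a facet in
the wall. Chambers without such a partner contribute zero. -/
theorem restrict_glue (hg : F.IsCompatibleFamily o' g) (href : Δ'.IsRefinement Δ)
    {o : Δ.Orient} (hor : o'.IsCompatible o) (s : (push Δ F).rel σ) {W : Submodule ℝ V}
    (hW : W ∈ walls Δ' σ) :
    Poly.restrict (le_of_mem_walls hW) (glue (fun τ : Chamber Δ' σ => g τ.1) s) = 0 := by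
  classical
  rw [glue_apply, map_sum]
  let T : Chamber Δ' σ → Poly W := fun τ =>
    Poly.restrict (le_of_mem_walls hW) (τ.extend (g τ.1 (τ.cut s.1)))
  -- Adjacency across a facet that spans `W`.
  let R : Chamber Δ' σ → Chamber Δ' σ → Prop := fun τ τ' =>
    τ' ≠ τ ∧ ∃ ρ : Δ'.Cone, ρ.IsFacet τ.1.1 ∧ ρ.IsFacet τ'.1.1 ∧ ρ.lin = W
  have hprop : ∀ (τ : Chamber Δ' σ) {ρ : Δ'.Cone} (hf : ρ.IsFacet τ.1.1), ρ.lin = W →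
      ∃ c : ℝ, wallForm σ W ∘ₗ Submodule.inclusion (lin_le_of_below τ.1) = c • o'.form hf := by
    intro τ ρ hf e
    refine exists_eq_smul_of_ker (fun h0 => ?_) fun v hv => ?_
    · obtain ⟨n, hn⟩ := Orient.exists_apply_eq_one hf.lt (o'.form_isFacetForm hf)
      rw [h0] at hn
      exact zero_ne_one hn
    · exact (wallForm_eq_zero_iff hW _).2 (e ▸ ((o'.form_isFacetForm hf).ker_eq v).1 hv)
  have hmem : ∀ (τ : Chamber Δ' σ) {ρ : Δ'.Cone} (hρ : ρ ∈ below Δ' σ) (hf : ρ.IsFacet τ.1.1),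
      (wallProdErase Δ' σ ρ.lin • s.1).1 ⟨ρ, hρ⟩ ∈ F.rel ρ := by
    intro τ ρ hρ hf
    have := (isExtension_wallProdErase_smul τ hf s.1).res_mem hf.le
    rwa [(wallProdErase Δ' σ ρ.lin • s.1).2 ⟨ρ, hρ⟩ τ.1 hf.le] at this
  -- A chamber without a partner either has its facet in `∂σ`, where `s` vanishes, or has no facet
  -- in `W`. In the latter case the form of `W` factors out of the term and restricts to zero.
  have hex : ∀ τ : Chamber Δ' σ, T τ ≠ 0 → ∃ τ', R τ τ' := by
    intro τ hT
    by_contra! hR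
    refine hT ?_
    by_cases hρ : ∃ ρ : Δ'.Cone, ρ.IsFacet τ.1.1 ∧ ρ.lin = W
    · obtain ⟨ρ, hf, rfl⟩ := hρ
      obtain ⟨c, hc⟩ := hprop τ hf rfl
      have hρσ : ρ ∈ below Δ' σ := le_trans (α := PointedCone ℝ V) hf.le τ.1.2
      refine (hg.restrict_extend τ ⟨ρ, hρσ⟩ hf hc s.1 (hmem τ hρσ hf)).trans ?_
      rcases href.exists_ne_or_exists_lt τ.1.2 τ.2 hf with ⟨τ', hne, h₁, h₂, hf'⟩ | ⟨σ', hlt, hle⟩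
      · exact absurd ⟨fun e => hne (congrArg (fun τ : Chamber Δ' σ => τ.1.1) e), ρ, hf, hf', rfl⟩
          (hR ⟨⟨τ', h₁⟩, h₂⟩)
      · have h0 : s.1.1 ⟨ρ, hρσ⟩ = 0 :=
          congrArg (fun x : (push Δ F).stalk σ' => x.1 ⟨ρ, hle⟩) (s.2 σ' hlt)
        have h1 : (⟨_, hmem τ hρσ hf⟩ : F.rel ρ) = 0 := by
          refine Subtype.ext ?_
          change Poly.restrict _ _ • s.1.1 ⟨ρ, hρσ⟩ = 0
          rw [h0, smul_zero]
        rw [h1, map_zero, smul_zero]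
    · push Not at hρ
      have e : τ.cut s.1 = Poly.restrict (lin_le_of_below τ.1) (Poly.ofForm (wallForm σ W)) •
          ⟨_, wallProdErase_smul_mem_rel τ hρ s.1⟩ := Subtype.ext (τ.cut_eq hW s.1)
      change Poly.restrict _ (τ.extend (g τ.1 (τ.cut s.1))) = 0
      rw [e, map_smul, smul_eq_mul, map_mul, τ.extend_restrict, map_mul,
        restrict_wallForm hW le_rfl, zero_mul]
  -- The form of `W` is `c`, respectively `c'`, times the normal form. The two normal forms are
  -- opposite, so `c + c' = 0`, and both terms are multiples of the same value of `g ρ`.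
  have hadd : ∀ τ τ' : Chamber Δ' σ, R τ τ' → T τ + T τ' = 0 := by
    rintro τ τ' ⟨hne, ρ, hf, hf', rfl⟩
    obtain ⟨c, hc⟩ := hprop τ hf rfl
    obtain ⟨c', hc'⟩ := hprop τ' hf' rfl
    have hρσ : ρ ∈ below Δ' σ := le_trans (α := PointedCone ℝ V) hf.le τ.1.2
    have hlin : τ.1.1.lin = τ'.1.1.lin := τ.lin_eq.trans τ'.lin_eq.symm
    have hform := hor.form_eq_neg τ.1.2 τ'.1.2 τ.2 τ'.2 hf hf'
      (fun e => hne (Subtype.ext (Subtype.ext e.symm))) hlin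
    obtain ⟨n, hn⟩ := Orient.exists_apply_eq_one hf.lt (o'.form_isFacetForm hf)
    have h₁ := LinearMap.congr_fun hc n
    have h₂ := LinearMap.congr_fun hc' (Submodule.inclusion hlin.le n)
    have h₃ := LinearMap.congr_fun hform n
    change _ = c * o'.form hf n at h₁
    change _ = c' * o'.form hf' (Submodule.inclusion hlin.le n) at h₂
    change _ = -(o'.form hf' (Submodule.inclusion hlin.le n)) at h₃
    have h₄ := h₁.symm.trans h₂
    rw [← neg_eq_iff_eq_neg] at h₃
    rw [← h₃, hn] at h₄
    have hcc : c + c' = 0 := by linarith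
    refine (congrArg₂ (· + ·) (hg.restrict_extend τ ⟨ρ, hρσ⟩ hf hc s.1 (hmem τ hρσ hf))
      (hg.restrict_extend τ' ⟨ρ, hρσ⟩ hf' hc' s.1 (hmem τ hρσ hf))).trans ?_
    rw [← add_smul, hcc, zero_smul]
  -- A chamber has at most one facet in `W`, and at most two chambers share it.
  have hinv : ∀ τ τ' τ'' : Chamber Δ' σ, R τ τ' → R τ' τ'' → τ'' = τ := by
    rintro τ τ' τ'' ⟨hne, ρ, h₁, h₂, e⟩ ⟨hne', ρ', h₃, h₄, e'⟩
    obtain rfl : ρ = ρ' := Cone.eq_of_lin_eq h₂.le h₃.le (e.trans e'.symm)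
    have hval : ∀ {μ ν : Chamber Δ' σ}, μ.1.1 = ν.1.1 → μ = ν :=
      fun e => Subtype.ext (Subtype.ext e)
    refine hval ((Cone.eq_or_eq_of_isFacet h₂ h₁ h₄ (τ'.lin_eq.trans τ.lin_eq.symm)
      (τ'.lin_eq.trans τ''.lin_eq.symm) fun e => hne (hval e)).resolve_left
      fun e => hne' (hval e))
  change ∑ τ, T τ = 0
  -- Only chambers with a non-zero term are known to have a partner, and the partner's term is again
  -- non-zero, so the pairing is an involution on these.
  rw [← Finset.sum_filter_ne_zero]
  choose N hN using hex
  have hN0 : ∀ τ hτ, T (N τ hτ) ≠ 0 := fun τ hτ h0 => hτ (by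
    have := hadd _ _ (hN τ hτ)
    rwa [h0, add_zero] at this)
  exact Finset.sum_involution (fun τ hτ => N τ (Finset.mem_filter.1 hτ).2)
    (fun τ hτ => hadd _ _ (hN τ _)) (fun τ hτ _ => (hN τ _).1)
    (fun τ hτ => Finset.mem_filter.2 ⟨Finset.mem_univ _, hN0 τ _⟩)
    fun τ hτ => hinv _ _ _ (hN τ _) (hN _ (hN0 τ _))

end IsCompatibleFamily

/-- Injectivity is determination by components. Surjectivity is divisibility by `wallProd`. For the
grading, homogeneity of the components is transferred to the functional by dividing by the
homogeneous `wallProd`. -/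
theorem comparison_isIso (href : Δ'.IsRefinement Δ) {F : FanSheaf.{u, w} Δ'} (hF : F.IsFlabby)
    (P : F.HomogProj) (o' : Δ'.Orient) (o : Δ.Orient) (hor : o'.IsCompatible o) :
    (comparison href F hF o' o hor).IsIso := by
  intro σ
  have hΦ := comparison_isComparison href F hF o' o hor σ
  have hpF : (push Δ F).IsFlabby := push_flabby hF
  refine ⟨⟨fun c c' e => ?_, fun ψ => ?_⟩, fun q c => ?_⟩
  · refine dualTop_injective hpF o σ ?_
    have h := hΦ c
    have h' := hΦ c'
    rw [e] at h
    obtain ⟨f, hf⟩ := (push Δ F).exists_eq_tmul_vol o ((push Δ F).dualTop o σ c)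
    obtain ⟨f', hf'⟩ := (push Δ F).exists_eq_tmul_vol o ((push Δ F).dualTop o σ c')
    rw [hf] at h ⊢
    rw [hf'] at h' ⊢
    congr 1
    refine eq_of_comp_eq href fun τ => ?_
    obtain ⟨g, hg⟩ := F.exists_eq_tmul_vol o'
      (F.dualTop o' τ.1.1 (((comparison href F hF o' o hor).app σ c').1 τ.1))
    have hτ := h τ
    have hτ' := h' τ
    rw [hg, Chamber.isTransfer_tmul_iff _ F hor] at hτ hτ'
    exact hτ.symm.trans hτ'
  · choose g hg using fun μ : below Δ' σ =>
      F.exists_eq_tmul_vol o' (F.dualTop o' μ.1 (ψ.1 μ))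
    -- The members of a section of the dual sheaf restrict to each other on facets, which is what
    -- the cancellation on the walls requires.
    have hfam : F.IsCompatibleFamily o' g := by
      intro ρ τ hf
      refine (F.isFacetRes_tmul_iff o' hf (g τ) (g ρ)).1 ?_
      rw [← hg, ← hg, ← ψ.2 ρ τ hf.le]
      exact (ψ.1 τ).2 ⟨ρ.1, hf.le⟩ ⟨τ.1, Set.mem_Iic.2 le_rfl⟩ hf
    obtain ⟨f, hf⟩ := exists_comp_eq (fun τ : Chamber Δ' σ => g τ.1) fun s =>
      wallProd_dvd fun W hW => hfam.restrict_glue href hor s hW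
    obtain ⟨c, hc⟩ := dualTop_surjective hpF o σ (f ⊗ₜ[ℝ] o.vol σ)
    refine ⟨c, (hΦ c).unique href hF fun τ => ?_⟩
    rw [hc, hg, Chamber.isTransfer_tmul_iff _ F hor]
    exact (hf τ).symm
  · have h := hΦ c
    set ψ := (comparison href F hF o' o hor).app σ c
    -- Every cone in `σ` is a face of a chamber and restriction preserves degrees, so homogeneity
    -- can be tested at the chambers.
    have hgr : ψ ∈ (push Δ (F.dual o')).gr σ q ↔
        ∀ τ : Chamber Δ' σ, F.dualTop o' τ.1.1 (ψ.1 τ.1) ∈ F.locGr τ.1.1 q := by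
      refine ⟨fun hψ τ => ((hasDualStalks hF P o' τ.1.1).2 q _).1 (hψ τ.1), fun hψ ρ => ?_⟩
      obtain ⟨τ, h₁, h₂, h₃⟩ := href.exists_dim_eq ρ.2
      have := ((hasDualStalks hF P o' τ).2 q _).2 (hψ ⟨⟨τ, h₂⟩, h₃⟩)
      rw [← ψ.2 ρ ⟨τ, h₂⟩ h₁]
      exact (F.dual o').res_mem_gr h₁ this
    rw [hgr, (hasDualStalks hpF (P.push Δ) o σ).2 q c]
    obtain ⟨f, hf⟩ := (push Δ F).exists_eq_tmul_vol o ((push Δ F).dualTop o σ c)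
    rw [hf] at h ⊢
    have hcomp : ∀ τ : Chamber Δ' σ,
        F.dualTop o' τ.1.1 (ψ.1 τ.1) = τ.comp F f ⊗ₜ[ℝ] o'.vol τ.1.1 := fun τ =>
      (h τ).unique o' ((τ.isTransfer_tmul_iff F hor f _).2 rfl)
    rw [tmul_vol_mem_locGr_iff]
    constructor
    · intro hf τ
      rw [hcomp, tmul_vol_mem_locGr_iff]
      intro j y hy
      refine Poly.restrict_mem_grade _ ?_
      rw [τ.2]
      refine hf j _ fun μ => ?_
      by_cases hμ : μ = τ.1
      · subst hμ
        rw [τ.single_self]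
        exact hy
      · rw [τ.single_of_ne F y hμ]
        exact zero_mem _
    · intro hτ j s hs
      obtain ⟨i, hi⟩ := wallProd_mem_grade (Δ' := Δ') σ
      -- After multiplication by `wallProd`, of degree `i`, the value is a sum of values of the
      -- components at homogeneous sections of degree `i + j`.
      refine Poly.mem_grade_of_mul_mem hi (wallProd_ne_zero σ) ?_
      rw [wallProd_mul_apply href, glue_apply]
      refine sum_mem fun (τ : Chamber Δ' σ) _ => Poly.restrict_mem_grade _ ?_
      have h₁ := hτ τ
      rw [hcomp, tmul_vol_mem_locGr_iff] at h₁
      have h₂ := h₁ (i + j) (τ.cut s.1)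
        (F.smul_mem_gr (Poly.restrict_mem_grade _ hi) (hs τ.1))
      rw [τ.2, add_assoc] at h₂
      exact h₂

/-- Extension by zero from a chamber commutes with `f`. Hence both sides take the same values on all
sections supported on chambers, and uniqueness applies. -/
theorem IsCanonical.natural (href : Δ'.IsRefinement Δ) {F : FanSheaf.{u, w} Δ'}
    {G : FanSheaf.{u, w'} Δ'} (hF : F.IsFlabby) {o' : Δ'.Orient} {o : Δ.Orient} (f : Hom F G)
    {ΦF : Hom ((push Δ F).dual o) (push Δ (F.dual o'))}
    {ΦG : Hom ((push Δ G).dual o) (push Δ (G.dual o'))} (hΦF : F.IsCanonical o' o ΦF)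
    (hΦG : G.IsCanonical o' o ΦG) (σ : Δ.Cone) (c : ((push Δ G).dual o).stalk σ) :
    ΦF.app σ ((dualMap (pushMap Δ f) o).app σ c) =
      (pushMap Δ (dualMap f o')).app σ (ΦG.app σ c) := by
  rw [isCanonical_iff] at hΦF hΦG
  refine (hΦF σ _).unique href hF fun τ y => ?_
  have e₁ : F.dualTop o' τ.1.1 (((pushMap Δ (dualMap f o')).app σ (ΦG.app σ c)).1 τ.1) =
      locDualMap f τ.1.1 (G.dualTop o' τ.1.1 ((ΦG.app σ c).1 τ.1)) := rfl
  have e₂ : (push Δ F).dualTop o σ ((dualMap (pushMap Δ f) o).app σ c) =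
      locDualMap (pushMap Δ f) σ ((push Δ G).dualTop o σ c) := rfl
  have e₃ : relMap (pushMap Δ f) σ (τ.single F y) = τ.single G (relMap f τ.1.1 y) := by
    refine τ.eq_single G ?_ fun μ hμ => ?_
    · change f.app τ.1.1 ((τ.single F y).1.1 τ.1) = _
      rw [τ.single_self]; rfl
    · change f.app μ.1 ((τ.single F y).1.1 μ) = 0
      rw [τ.single_of_ne F y hμ, map_zero]
  rw [e₁, e₂, pair_locDualMap, pair_locDualMap, e₃]
  exact hΦG σ c τ _

end FanSheaf

end FanDuality

end

open FanDuality FanDuality.FanSheaf in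
theorem proposition4p1 {V : Type u} [AddCommGroup V] [Module ℝ V] [FiniteDimensional ℝ V]
    (Δ' Δ : Fan V) (href : Δ'.IsRefinement Δ) (o' : Δ'.Orient) (o : Δ.Orient)
    (hor : o'.IsCompatible o) :
    (∀ F : FanSheaf.{u, w} Δ', F.IsPure →
      F.HasDualStalks o' ∧ (push Δ F).HasDualStalks o ∧
      ∃! Φ : Hom ((push Δ F).dual o) (push Δ (F.dual o')), Φ.IsIso ∧ F.IsCanonical o' o Φ) ∧
    (∀ (F : FanSheaf.{u, w} Δ') (G : FanSheaf.{u, w'} Δ'), F.IsPure → G.IsPure →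
      ∀ (f : Hom F G) (ΦF : Hom ((push Δ F).dual o) (push Δ (F.dual o')))
        (ΦG : Hom ((push Δ G).dual o) (push Δ (G.dual o'))),
        F.IsCanonical o' o ΦF → G.IsCanonical o' o ΦG →
        ∀ (σ : Δ.Cone) (c : ((push Δ G).dual o).stalk σ),
          ΦF.app σ ((dualMap (pushMap Δ f) o).app σ c) =
            (pushMap Δ (dualMap f o')).app σ (ΦG.app σ c)) := by
  refine ⟨fun F hF => ?_, fun F G hF _ f ΦF ΦG hΦF hΦG σ c =>
    IsCanonical.natural href hF.flabby f hΦF hΦG σ c⟩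
  let P := hF.graded.homogProj
  refine ⟨hasDualStalks hF.flabby P o', hasDualStalks (push_flabby hF.flabby) (P.push Δ) o,
    comparison href F hF.flabby o' o hor, ⟨comparison_isIso href hF.flabby P o' o hor,
      isCanonical_iff.2 fun σ c => comparison_isComparison href F hF.flabby o' o hor σ c⟩, ?_⟩
  rintro Φ ⟨-, hΦ⟩
  refine Hom.ext (funext fun σ => LinearMap.ext fun c => ?_)
  exact (isCanonical_iff.1 hΦ σ c).unique href hF.flabby
    (comparison_isComparison href F hF.flabby o' o hor σ c)
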